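/- **Setting.** Let $a,b\ge 0$ and let $\nu$ be a lattice path from $(0,0)$ to $(a,b)$ with steps $E=(1,0)$, $N=(0,1)$. Put $\overline\nu=E\nu N$ and index its letters from left to right by $1,2,\dots$, each letter receiving the next integer, except that an $N$ directly preceded by an $E$ receives the index of that $E$. Let $I$ and $J$ be the sets of indices of the $E$ and $N$ steps, $I\cup J=[n]$, and let $v_1<\dots<v_w$ be the elements of $I\cap J$; they index the $w$ valleys $E_kN_k$ of $\overline\nu$. *Graphs.* An edge $(i,j)$, $i<j$, of a graph is forward ($+$, directed to $j$), backward ($-$, directed to $i$) or bidirectional ($\pm$). $G_B(\nu)$ is the graph on $[n]$ with an edge $(i,j)$, $i<j$, whenever $E_i\cdots N_j$ is a factor of $\overline\nu$ whose only valleys $E_kN_k$ have $k\in\{i,j\}$; the edge is bidirectional if $i,j\in I\cap J$ and forward otherwise. For $i\in[w]$, $G(\nu,i)$ is obtained from $G_B(\nu)$ by replacing the path of bidirectional edges by the cycle $v_1\to v_2\to\dots\to v_w\to v_1$ without its edge that begins at $v_i$ (for $w=1$ there are no such edges). For a graph $G$ on $[n]$, $\widetilde G$ is $G$ with a source $s$,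 a sink $t$ and the forward edges $(s,i)$, $i\in I$, and $(j,t)$, $j\in J$, where $s<1<\dots<n<t$. *Flow polytopes.* $\mathcal F_{\widetilde G}$ is the set of real vectors $(x_e)_{e\in E(\widetilde G)}$ with $x_e\ge0$ on forward edges and $x_e\le 0$ on backward edges, such that at every vertex $v$ the sum of $x_e$ over the edges from $v$ to larger vertices minus the sum over the edges from smaller vertices to $v$ is $1$ for $v=s$, $-1$ for $v=t$, and $0$ otherwise. Write $P\equiv Q$ if $P$ and $Q$ are integrally equivalent: some affine map restricts to a bijection $P\to Q$ and to a bijection between the lattice points of $\mathrm{aff}(P)$ and of $\mathrm{aff}(Q)$. *Simplex-subdivision.* A route is a directed path from $s$ to $t$ in $\widetilde G_B(\nu)$, identified with its signed characteristic vector. For $i<w$, $\mathcal Q_i$ is the convex hull of the routes that do not traverse $(v_i,v_{i+1})$ upwards and that, if they traverse any edge downwards, traverse $(v_i,v_{i+1})$ downwards; $\mathcal Q_w$ is the set of nonnegative flows in $\mathcal F_{\widetilde G_B(\nu)}$. The simplex-subdivision is the collection of all nonempty faces of $\mathcal Q_1,\dots,\mathcal Q_w$. *Algebra.* The extended subdivision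 algebra $\mathcal S(\beta)$ is the commutative $\mathbb Z[\beta]$-algebra generated by $x_{ij}$ ($i\ne j$ in $[n]$) with relations $x_{ij}x_{jk}=x_{ik}x_{ij}+x_{jk}x_{ik}+\beta x_{ik}$, $i\neq k$. A reduction of a polynomial, for fixed distinct $i,j,k$, replaces $x_{ij}x_{jk}$ by the right-hand side in every term divisible by $x_{ij}x_{jk}$. For a graph $G$ with forward and backward edges, $M(G)=\prod_{(i,j,+)\in G}x_{ij}\prod_{(i,j,-)\in G}x_{ji}$. Let $$P_\nu=\sum_{\emptyset\ne S\subseteq[w]}\beta^{|S|-1}M\Big(\bigcap_{i\in S}G(\nu,i)\Big).$$ *Encoding.* For a graph $G$ on $[n]$ with forward and backward edges let $\mathrm{cell}(G)\subseteq\mathcal F_{\widetilde G_B(\nu)}$ be the set of flows whose values on the source and sink edges are those of some flow in $\mathcal F_{\widetilde G}$. A polynomial $R$ encodes a polytopal subdivision $\mathcal D$ of $\mathcal F_{\widetilde G_B(\nu)}$ if there is a finite set $\mathcal G$ of such graphs for which $G\mapsto\mathrm{cell}(G)$ is a bijection from $\mathcal G$ onto the inner faces of $\mathcal D$ (those not contained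 in the relative boundary), $\mathrm{cell}(G)\equiv\mathcal F_{\widetilde G}$ for all $G\in\mathcal G$, and $R=\sum_{G\in\mathcal G}\beta^{\operatorname{codim}\mathrm{cell}(G)}M(G)$. For an injective affine image of $\mathcal F_{\widetilde G_B(\nu)}$, encoding is defined in the same way with the images of the cells. **Theorem.** 1. The simplex-subdivision is a polytopal subdivision of $\mathcal F_{\widetilde G_B(\nu)}$ and is encoded by $P_\nu$. For each nonempty $S\subseteq[w]$, $\bigcap_{i\in S}\mathcal Q_i$ is the inner face $\mathrm{cell}(\bigcap_{i\in S}G(\nu,i))$; it has codimension $|S|-1$ and is integrally equivalent to the flow polytope of $\bigcap_{i\in S}\widetilde G(\nu,i)$. 2. To every polynomial $R$ obtained from $P_\nu$ by a finite sequence of reductions one can attach a polytopal subdivision $\mathcal D_R$ of $\mathcal F_{\widetilde G_B(\nu)}$ encoded by $R$, such that $\mathcal D_{P_\nu}$ is the simplex-subdivision and $\mathcal D_{R'}$ refines $\mathcal D_R$ whenever $R'$ is obtained from $R$ by further reductions. (In particular every $\mathcal D_R$ refines the simplex-subdivision.) Moreover $R=P_\nu$ in $\mathcal S(\beta)$. 3.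 There is an integral equivalence $\varphi:\mathcal F_{\widetilde G_B(\nu)}\to\Delta_a\times\Delta_b$ such that, for all these $R$, the images under $\varphi$ of the cells of $\mathcal D_R$ form a subdivision of $\Delta_a\times\Delta_b$ encoded by $R$; further reductions again give refinements. -/

import Mathlib

open Set

/-! ### Signed graphs and flow polytopes -/

/-- The three types of an edge `(i, j)` with `i < j`: directed toward `j`, directed toward `i`,
or traversable both ways. -/
inductive EdgeKind where
  | forward
  | backward
  | bidirectional
deriving DecidableEq

instance : Fintype EdgeKind :=
  ⟨{.forward, .backward, .bidirectional}, fun k => by cases k <;> decide⟩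

/-- A signed edge `(lo, hi, kind)`, `lo < hi`, on a linearly ordered vertex set. -/
structure SignedEdge (V : Type) [LinearOrder V] where
  lo : V
  hi : V
  lt : lo < hi
  kind : EdgeKind
deriving DecidableEq

instance (V : Type) [LinearOrder V] [Fintype V] : Fintype (SignedEdge V) :=
  Fintype.ofEquiv {p : V × V × EdgeKind // p.1 < p.2.1}
    { toFun := fun p => ⟨p.1.1, p.1.2.1, p.2, p.1.2.2⟩
      invFun := fun e => ⟨(e.lo, e.hi, e.kind), e.lt⟩
      left_inv := fun _ => rfl
      right_inv := fun _ => rfl }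

/-- The edge `e` may be traversed from `u` to `v`. -/
def SignedEdge.Allows {V : Type} [LinearOrder V] (e : SignedEdge V) (u v : V) : Prop :=
  (e.lo = u ∧ e.hi = v ∧ e.kind ≠ .backward) ∨ (e.hi = u ∧ e.lo = v ∧ e.kind ≠ .forward)

section Flow

variable {V E : Type} [LinearOrder V] [Fintype E]

/-- The flow polytope of the graph with edge family `edge : E → SignedEdge V`, source `s` and
sink `t`: at each vertex the flow in the larger edges minus the flow in the smaller edges is the
netflow (`1` at `s`, `-1` at `t`, `0` elsewhere); the flow is `≥ 0` in forward edges, `≤ 0` in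
backward edges and unrestricted in bidirectional edges. -/
def flowPolytope (edge : E → SignedEdge V) (s t : V) : Set (E → ℝ) :=
  {x | (∀ v : V, (∑ e : E, if (edge e).lo = v then x e else 0)
          - (∑ e : E, if (edge e).hi = v then x e else 0)
          = (if v = s then 1 else 0) - (if v = t then 1 else 0)) ∧
       (∀ e, (edge e).kind = .forward → 0 ≤ x e) ∧
       (∀ e, (edge e).kind = .backward → x e ≤ 0)}

/-- A route: a directed path from the source to the sink, as its list of vertices. -/
def IsRoute (edge : E → SignedEdge V) (s t : V) (l : List V) : Prop :=
  l.head? = some s ∧ l.getLast? = some t ∧ l.Nodup ∧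
    l.IsChain (fun u v => ∃ e, (edge e).Allows u v)

/-- The signed characteristic vector of a route (in a graph without parallel edges): `1` on edges
traversed upwards, `-1` on edges traversed downwards, `0` on the other edges. -/
def routeVector (edge : E → SignedEdge V) (l : List V) : E → ℝ := fun e =>
  if [(edge e).lo, (edge e).hi] <:+: l then 1
  else if [(edge e).hi, (edge e).lo] <:+: l then -1 else 0

end Flow

/-! ### Polytopes, subdivisions, integral equivalence -/

section Polytopes

variable {ι κ : Type} [Fintype ι] [Fintype κ]

/-- The points of the lattice `ℤ^ι` in `ℝ^ι`. -/
def latticePoints (ι : Type) : Set (ι → ℝ) := {x | ∀ i, ∃ z : ℤ, x i = z}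

/-- The affine map `φ` is an integral equivalence from `P` to `Q`. -/
def IsIntegralEquivalence (φ : (ι → ℝ) →ᵃ[ℝ] (κ → ℝ)) (P : Set (ι → ℝ)) (Q : Set (κ → ℝ)) :
    Prop :=
  BijOn φ P Q ∧
    BijOn φ (latticePoints ι ∩ (affineSpan ℝ P : Set (ι → ℝ)))
      (latticePoints κ ∩ (affineSpan ℝ Q : Set (κ → ℝ)))

/-- `P ≡ Q`. -/
def IntegrallyEquivalent (P : Set (ι → ℝ)) (Q : Set (κ → ℝ)) : Prop :=
  ∃ φ : (ι → ℝ) →ᵃ[ℝ] (κ → ℝ), IsIntegralEquivalence φ P Q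

/-- A (nonempty) polytope: the convex hull of a nonempty finite set. -/
def IsPolytope (P : Set (κ → ℝ)) : Prop :=
  ∃ T : Finset (κ → ℝ), T.Nonempty ∧ P = convexHull ℝ (T : Set (κ → ℝ))

/-- A polytopal subdivision of `P`: a finite collection of nonempty polytopes with union `P`,
closed under taking nonempty faces, any two of which meet in a common (possibly empty) face. -/
structure IsSubdivision (P : Set (κ → ℝ)) (𝒮 : Set (Set (κ → ℝ))) : Prop where
  finite : 𝒮.Finite
  polytope : ∀ C ∈ 𝒮, IsPolytope C
  face_mem : ∀ C ∈ 𝒮, ∀ F, F.Nonempty → IsExposed ℝ C F → F ∈ 𝒮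
  inter_face : ∀ C ∈ 𝒮, ∀ D ∈ 𝒮, IsExposed ℝ C (C ∩ D)
  sUnion_eq : ⋃₀ 𝒮 = P

/-- Every cell of `𝒮'` is contained in a cell of `𝒮`. -/
def Refines (𝒮' 𝒮 : Set (Set (κ → ℝ))) : Prop := ∀ C ∈ 𝒮', ∃ D ∈ 𝒮, C ⊆ D

/-- The inner faces of a subdivision `𝒮` of `P`: the cells not contained in the relative boundary
of `P`. -/
def innerFaces (P : Set (κ → ℝ)) (𝒮 : Set (Set (κ → ℝ))) : Set (Set (κ → ℝ)) :=
  {C ∈ 𝒮 | ¬ C ⊆ intrinsicFrontier ℝ P}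

/-- The codimension in `P` of a subset `C` of `P`. -/
noncomputable def codim (P C : Set (κ → ℝ)) : ℕ :=
  Module.finrank ℝ (vectorSpan ℝ P) - Module.finrank ℝ (vectorSpan ℝ C)

end Polytopes

/-- The product of simplices `Δ_a × Δ_b` in `ℝ^(a+1) × ℝ^(b+1)`. -/
def simplexProduct (a b : ℕ) : Set (Fin (a + 1) ⊕ Fin (b + 1) → ℝ) :=
  {z | z ∘ Sum.inl ∈ stdSimplex ℝ (Fin (a + 1)) ∧ z ∘ Sum.inr ∈ stdSimplex ℝ (Fin (b + 1))}

/-! ### The extended subdivision algebra -/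

section Algebra

variable {V : Type}

/-- The index set of the generators `x_ij`, `i ≠ j`. -/
abbrev Gen (V : Type) : Type := {p : V × V // p.1 ≠ p.2}

/-- Polynomials in the `x_ij` over `ℤ[β]`. -/
abbrev BetaPoly (V : Type) : Type := MvPolynomial (Gen V) (Polynomial ℤ)

/-- The element `β`. -/
noncomputable def betaElt : BetaPoly V := MvPolynomial.C Polynomial.X

/-- The generator `x_ij`. -/
noncomputable def xGen (i j : V) (h : i ≠ j) : BetaPoly V := MvPolynomial.X ⟨(i, j), h⟩

/-- The polynomial `x_ik x_ij + x_jk x_ik + β x_ik` that replaces `x_ij x_jk`. -/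
noncomputable def reductionRhs (i j k : V) (hij : i ≠ j) (hjk : j ≠ k) (hik : i ≠ k) :
    BetaPoly V :=
  xGen i k hik * xGen i j hij + xGen j k hjk * xGen i k hik + betaElt * xGen i k hik

/-- The ideal of the relations `x_ij x_jk = x_ik x_ij + x_jk x_ik + β x_ik`, `i ≠ k`. -/
noncomputable def subdivisionIdeal (V : Type) : Ideal (BetaPoly V) :=
  Ideal.span {r | ∃ (i j k : V) (hij : i ≠ j) (hjk : j ≠ k) (hik : i ≠ k),
    r = xGen i j hij * xGen j k hjk - reductionRhs i j k hij hjk hik}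

/-- The subdivision algebra `𝒮(β)`. -/
abbrev SubdivisionAlgebra (V : Type) : Type := BetaPoly V ⧸ subdivisionIdeal V

open Classical in
/-- The reduction of `P` at `i, j, k`: in every term of `P` that is divisible by `x_ij x_jk`, this
product is replaced by `x_ik x_ij + x_jk x_ik + β x_ik`; the other terms are kept. -/
noncomputable def reduction (i j k : V) (hij : i ≠ j) (hjk : j ≠ k) (hik : i ≠ k)
    (P : BetaPoly V) : BetaPoly V :=
  ∑ m ∈ P.support,
    if 1 ≤ m ⟨(i, j), hij⟩ ∧ 1 ≤ m ⟨(j, k), hjk⟩ then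
      MvPolynomial.monomial
        (m - Finsupp.single ⟨(i, j), hij⟩ 1 - Finsupp.single ⟨(j, k), hjk⟩ 1) (P.coeff m)
        * reductionRhs i j k hij hjk hik
    else MvPolynomial.monomial m (P.coeff m)

/-- `Q` is obtained from `P` by one reduction. -/
def ReducesInOneStep (P Q : BetaPoly V) : Prop :=
  ∃ (i j k : V) (hij : i ≠ j) (hjk : j ≠ k) (hik : i ≠ k), Q = reduction i j k hij hjk hik P

/-- `Q` is obtained from `P` by a finite sequence of reductions. -/
def Reduces (P Q : BetaPoly V) : Prop := Relation.ReflTransGen ReducesInOneStep P Q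

variable [LinearOrder V]

/-- The generator of a directed edge: `x_ij` for `(i, j, +)` and `x_ji` for `(i, j, -)`. -/
noncomputable def edgeGenerator (e : SignedEdge V) : BetaPoly V :=
  match e.kind with
  | .forward => xGen e.lo e.hi e.lt.ne
  | .backward => xGen e.hi e.lo e.lt.ne'
  | .bidirectional => 1

/-- The monomial `M(G)` of a graph with forward and backward edges. -/
noncomputable def graphMonomial (G : Finset (SignedEdge V)) : BetaPoly V :=
  ∏ e ∈ G, edgeGenerator e

end Algebra

/-! ### Lattice paths and their graphs -/

/-- East steps `(1, 0)` and north steps `(0, 1)`. -/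
inductive Step where
  | E
  | N
deriving DecidableEq

/-- The canonical indexing of a word, the first index being `k`: each letter gets the next
integer, except that an `N` directly after an `E` gets the index of that `E`. -/
def canonicalIndexing : ℕ → List Step → List (Step × ℕ)
  | _, [] => []
  | k, .E :: .N :: l => (.E, k) :: (.N, k) :: canonicalIndexing (k + 1) l
  | k, c :: l => (c, k) :: canonicalIndexing (k + 1) l

/-- The canonical indexing of the word `E ν N`, with indices `1, 2, …`. -/
def indexedWord (ν : List Step) : List (Step × ℕ) :=
  canonicalIndexing 1 (Step.E :: (ν ++ [Step.N]))

/-- The vertex set `[n]`: the indices in use. -/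
abbrev Vertex (ν : List Step) : Type :=
  {k : ℕ // k ∈ ((indexedWord ν).map Prod.snd).toFinset}

section NuGraphs

variable (ν : List Step)

/-- The set `I` of indices of `E` steps. -/
def indexI : Finset (Vertex ν) := Finset.univ.filter fun i => (Step.E, i.1) ∈ indexedWord ν

/-- The set `J` of indices of `N` steps. -/
def indexJ : Finset (Vertex ν) := Finset.univ.filter fun j => (Step.N, j.1) ∈ indexedWord ν

/-- The set `I ∩ J`, which indexes the valleys of `E ν N`. -/
def valleys : Finset (Vertex ν) := indexI ν ∩ indexJ ν

/-- The number `w` of valleys of `E ν N`. -/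
def numValleys : ℕ := (valleys ν).card

/-- The valleys in increasing order (numbered from `0`). -/
def valley (i : Fin (numValleys ν)) : Vertex ν := (valleys ν).orderEmbOfFin rfl i

/-- The bidirectional graph `G_B(ν)`: there is an edge `(i, j)`, `i < j`, when `E_i` and `N_j` are
letters of `E ν N` and the only valleys `E_k N_k` of the factor `E_i ⋯ N_j` (these are the valleys
with `i ≤ k ≤ j`) are those with `k = i` or `k = j`; the edge is bidirectional if `i` and `j` are
both in `I ∩ J`, and forward otherwise. -/
def graphGB : Finset (SignedEdge (Vertex ν)) :=
  Finset.univ.filter fun e =>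
    e.lo ∈ indexI ν ∧ e.hi ∈ indexJ ν ∧
    (∀ k ∈ valleys ν, e.lo ≤ k → k ≤ e.hi → k = e.lo ∨ k = e.hi) ∧
    e.kind = if e.lo ∈ valleys ν ∧ e.hi ∈ valleys ν then .bidirectional else .forward

/-- `e` is the edge of the cycle `C_ν` that begins at the `i`-th valley: the forward edge to the
next valley or, at the last valley, the backward edge to the first valley (for one valley there
is none). -/
def IsCycleEdge (i : Fin (numValleys ν)) (e : SignedEdge (Vertex ν)) : Prop :=
  (∃ h : i.1 + 1 < numValleys ν,
    e.lo = valley ν i ∧ e.hi = valley ν ⟨i.1 + 1, h⟩ ∧ e.kind = .forward) ∨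
  (i.1 + 1 = numValleys ν ∧
    e.lo = valley ν ⟨0, i.pos⟩ ∧ e.hi = valley ν i ∧ e.kind = .backward)

open Classical in
/-- `G(ν, i)`: the path of bidirectional edges of `G_B(ν)` is replaced by the cycle `C_ν` without
its edge that begins at the `i`-th valley. -/
noncomputable def graphG (i : Fin (numValleys ν)) : Finset (SignedEdge (Vertex ν)) :=
  Finset.univ.filter fun e =>
    (e ∈ graphGB ν ∧ e.kind ≠ .bidirectional) ∨ ∃ j, j ≠ i ∧ IsCycleEdge ν j e

open Classical in
/-- The intersection of the graphs `G(ν, i)` over `i ∈ S`. -/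
noncomputable def graphInter (S : Finset (Fin (numValleys ν))) :
    Finset (SignedEdge (Vertex ν)) :=
  Finset.univ.filter fun e => ∀ i ∈ S, e ∈ graphG ν i

/-- The polynomial `P_ν`. -/
noncomputable def polyP : BetaPoly (Vertex ν) :=
  ∑ S : Finset (Fin (numValleys ν)) with S.Nonempty,
    betaElt ^ (S.card - 1) * graphMonomial (graphInter ν S)

/-- The vertices of an augmented graph: the source is `⊥`, the sink is `⊤`. -/
abbrev AugVertex : Type := WithBot (WithTop (Vertex ν))

/-- An inner vertex as a vertex of the augmented graph. -/
def innerVertex (i : Vertex ν) : AugVertex ν := ((i : WithTop (Vertex ν)) : WithBot (WithTop (Vertex ν)))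

/-- The edges of the augmentation of `G`: those of `G`, one source edge for each `i ∈ I`, and one
sink edge for each `j ∈ J`. -/
abbrev AugEdge (G : Finset (SignedEdge (Vertex ν))) : Type :=
  G ⊕ ({i // i ∈ indexI ν} ⊕ {j // j ∈ indexJ ν})

/-- The augmented graph: `G` with the forward edges `(s, i)`, `i ∈ I`, and `(j, t)`, `j ∈ J`. -/
def augmentation (G : Finset (SignedEdge (Vertex ν))) : AugEdge ν G → SignedEdge (AugVertex ν)
  | .inl e => ⟨innerVertex ν e.1.lo, innerVertex ν e.1.hi,
      WithBot.coe_lt_coe.2 (WithTop.coe_lt_coe.2 e.1.lt), e.1.kind⟩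
  | .inr (.inl i) => ⟨⊥, innerVertex ν i.1, WithBot.bot_lt_coe _, .forward⟩
  | .inr (.inr j) => ⟨innerVertex ν j.1, ⊤, WithBot.coe_lt_coe.2 (WithTop.coe_lt_top _), .forward⟩

/-- The flow polytope of the augmentation of `G`. -/
def augFlow (G : Finset (SignedEdge (Vertex ν))) : Set (AugEdge ν G → ℝ) :=
  flowPolytope (augmentation ν G) ⊥ ⊤

/-- The flow polytope of the augmentation of `G_B(ν)`. -/
abbrev flowGB : Set (AugEdge ν (graphGB ν) → ℝ) := augFlow ν (graphGB ν)

/-- The polytopes `Q_i`. If `i` is not the last valley, `Q_i` is the convex hull of the routes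
that do not traverse `(v_i, v_{i+1})` upwards and that, if they traverse any edge downwards,
traverse `(v_i, v_{i+1})` downwards. For the last valley it consists of the flows without negative
entries, that is, of the flows on the augmentation of `G(ν)`. -/
def polytopeQ (i : Fin (numValleys ν)) : Set (AugEdge ν (graphGB ν) → ℝ) :=
  if h : i.1 + 1 < numValleys ν then
    convexHull ℝ {y | ∃ l : List (AugVertex ν),
      IsRoute (augmentation ν (graphGB ν)) ⊥ ⊤ l ∧
      ¬ [innerVertex ν (valley ν i), innerVertex ν (valley ν ⟨i.1 + 1, h⟩)] <:+: l ∧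
      ((∃ u v, v < u ∧ [u, v] <:+: l) →
        [innerVertex ν (valley ν ⟨i.1 + 1, h⟩), innerVertex ν (valley ν i)] <:+: l) ∧
      y = routeVector (augmentation ν (graphGB ν)) l}
  else {y ∈ flowGB ν | ∀ e, 0 ≤ y e}

/-- The simplex-subdivision: all nonempty faces of the polytopes `Q_i`. -/
def simplexSubdivision : Set (Set (AugEdge ν (graphGB ν) → ℝ)) :=
  {F | F.Nonempty ∧ ∃ i, IsExposed ℝ (polytopeQ ν i) F}

/-- The cell of a graph `G` on `[n]` with forward and backward edges: the flows on the augmentation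
of `G_B(ν)` whose values on the source and sink edges are those of a flow on the augmentation of
`G`. -/
def cell (G : Finset (SignedEdge (Vertex ν))) : Set (AugEdge ν (graphGB ν) → ℝ) :=
  {y ∈ flowGB ν | ∃ z ∈ augFlow ν G, ∀ e, y (Sum.inr e) = z (Sum.inr e)}

/-- The polynomial `R` encodes the subdivision `𝒮` of `P` (where `c G` is the subset of `P` that is
attached to a graph `G`): there is a finite set of graphs with forward and backward edges which
correspond bijectively, by `c`, to the inner faces of `𝒮`; each inner face is integrally equivalent
to the flow polytope of the augmentation of its graph; and `R` is the sum over the inner faces of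
`β ^ codimension` times the monomial of the graph. -/
def Encodes {κ : Type} [Fintype κ] (P : Set (κ → ℝ))
    (c : Finset (SignedEdge (Vertex ν)) → Set (κ → ℝ)) (R : BetaPoly (Vertex ν))
    (𝒮 : Set (Set (κ → ℝ))) : Prop :=
  ∃ 𝒢 : Finset (Finset (SignedEdge (Vertex ν))),
    (∀ G ∈ 𝒢, ∀ e ∈ G, e.kind ≠ .bidirectional) ∧
    BijOn c (𝒢 : Set (Finset (SignedEdge (Vertex ν)))) (innerFaces P 𝒮) ∧
    (∀ G ∈ 𝒢, IntegrallyEquivalent (augFlow ν G) (c G)) ∧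
    R = ∑ G ∈ 𝒢, betaElt ^ codim P (c G) * graphMonomial G

end NuGraphs

/-! Tree and cones. The undirected graph underlying G_B(ν) is a caterpillar: the valleys form the
spine, and every other vertex is a leaf, joined to the next valley on its right if it lies in I and
to the previous valley on its left if it lies in J. Since this is a tree, a flow on the augmentation
is determined by its values on the source and sink edges, and these range over the product of the
standard simplices on I and on J. Such a point x extends to a flow on the augmentation of a set A of
directed edges exactly when its net vector `netMap I J x` lies in the cone spanned by the vectors
e_i - e_j, (i, j) ∈ A. Subdivisions of the polytope are therefore pulled back from unimodular
simplicial fans of such cones (`IsFan`) in the space of vectors with sum zero.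

The starting fan. Close the spine to a directed cycle. The weights of the leaf edges are forced by
the net vector, and those of the cycle edges are its prefix sums along the spine, up to one common
constant. If the weights are to be nonnegative and at least one cycle edge is to have weight zero,
the constant must be the smallest prefix sum; the set S of cycle edges with weight zero consists of
the places where it is attained. This is the fan of the graphs indexed by nonempty S
(`Caterpillar.isFan_fan`). The value of a flow on the edge (v_k, v_{k+1}) is a prefix sum, so Q_i is
the region where the prefix sum at i is minimal; this is checked on vertices, which are routes
(`Caterpillar.exists_endsVertex`, `polytopeQ_eq`).

Reductions. From (e_i - e_j) + (e_j - e_k) = e_i - e_k, a reduction is a stellar subdivision of the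
fan: as much weight as possible is moved from the edges a = (i, j) and b = (j, k) to e = (i, k), and
the three terms record which of a, b survives, or that neither does (`IsFan.reduce`). The last cone
has one dimension less, which the extra β records. Uniqueness of weights shows that e is in no graph
of the fan as soon as a and b occur together, so monomials stay squarefree and no terms merge
(`reduction_fanPoly`).

Transfer. Open cones correspond to inner faces (`IsFan.bijOn_innerFaces`), the codimension is a rank
count (`IsFan.codim_coneFace`), and unimodularity gives the integral equivalences
(`integrallyEquivalent_coneFace`). The arguments for subdivisions use only a linear map f with a
left inverse g out of the space of end values, so they serve both for the flow polytope and for the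
product of simplices. -/

set_option linter.unusedSectionVars false

/-! ### Faces, vertices and relative boundary of polyhedra given by inequalities -/

section HalfSpaces

variable {E τ : Type*} [NormedAddCommGroup E] [NormedSpace ℝ E]

/-- The polyhedron cut out of an affine subspace by finitely many affine inequalities. -/
def hset (S : AffineSubspace ℝ E) (g : τ → E →ᵃ[ℝ] ℝ) : Set E := {x | x ∈ S ∧ ∀ t, 0 ≤ g t x}

variable {S : AffineSubspace ℝ E} {g : τ → E →ᵃ[ℝ] ℝ}

theorem convex_hset : Convex ℝ (hset S g) := by
  have : hset S g = (S : Set E) ∩ ⋂ t, (g t) ⁻¹' Ici 0 := by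
    ext x; simp [hset]
  rw [this]
  exact S.convex.inter (convex_iInter fun t => (convex_Ici 0).affine_preimage (g t))

theorem affine_apply_add_smul (h : E →ᵃ[ℝ] ℝ) (x d : E) (ε : ℝ) :
    h (x + ε • d) = h x + ε * h.linear d := by
  have := h.map_vadd x (ε • d)
  simp only [vadd_eq_add, map_smul, smul_eq_mul] at this
  rw [add_comm, this, add_comm]

theorem affine_linear_sub (h : E →ᵃ[ℝ] ℝ) (x y : E) : h.linear (x - y) = h x - h y := by
  simpa using h.linearMap_vsub x y

/-- An inequality that is tight at x has nonnegative slope along d, and one that is not tight stays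
positive for small ε; finitely many conditions hold simultaneously. -/
theorem exists_add_smul_mem_hset [Finite τ] {x d : E} (hx : x ∈ hset S g) (hd : d ∈ S.direction)
    (h : ∀ t, g t x = 0 → 0 ≤ (g t).linear d) : ∃ ε > (0 : ℝ), x + ε • d ∈ hset S g := by
  have key : ∀ t, ∀ᶠ ε : ℝ in nhdsWithin 0 (Ioi 0), 0 ≤ g t (x + ε • d) := by
    intro t
    simp only [affine_apply_add_smul]
    rcases (hx.2 t).eq_or_lt with h0 | h0
    · filter_upwards [self_mem_nhdsWithin] with ε hε
      rw [← h0, zero_add]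
      exact mul_nonneg (le_of_lt hε) (h t h0.symm)
    · have : ContinuousAt (fun ε : ℝ => g t x + ε * (g t).linear d) 0 := by fun_prop
      have h1 := this.eventually (lt_mem_nhds (a := 0) (by simpa using h0))
      filter_upwards [nhdsWithin_le_nhds h1] with ε hε using le_of_lt hε
  obtain ⟨ε, h1, h2⟩ := ((Filter.eventually_all.2 key).and self_mem_nhdsWithin).exists
  refine ⟨ε, h2, ?_, h1⟩
  rw [add_comm]
  exact AffineSubspace.vadd_mem_of_mem_direction (S.direction.smul_mem ε hd) hx.1

/-- The segment from y to x can be prolonged beyond x. This replaces the usual arguments with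
relative interiors. -/
theorem exists_extend_hset [Finite τ] {x y : E} (hx : x ∈ hset S g) (hy : y ∈ hset S g)
    (h : ∀ t, g t x = 0 → g t y = 0) : ∃ ε > (0 : ℝ), x + ε • (x - y) ∈ hset S g :=
  exists_add_smul_mem_hset hx (AffineSubspace.vsub_mem_direction hx.1 hy.1) fun t ht => by
    rw [affine_linear_sub, ht, h t ht, sub_zero]

/-- A nonnegative form vanishes at a midpoint only if it vanishes at both ends, so repeated
averaging yields a point with as few tight inequalities as possible. It plays the part of a relative
interior point of F. -/
theorem exists_maximal_support [Finite τ] {F : Set E} (hF : Convex ℝ F) (hne : F.Nonempty)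
    (hnn : ∀ x ∈ F, ∀ t, 0 ≤ g t x) :
    ∃ f ∈ F, ∀ t, g t f = 0 → ∀ x ∈ F, g t x = 0 := by
  classical
  cases nonempty_fintype τ
  suffices ∀ s : Finset τ, ∃ f ∈ F, ∀ t ∈ s, g t f = 0 → ∀ x ∈ F, g t x = 0 by
    simpa using this Finset.univ
  intro s
  induction s using Finset.induction_on with
  | empty => obtain ⟨f, hf⟩ := hne; exact ⟨f, hf, by simp⟩
  | insert a s _ ih =>
    obtain ⟨f, hf, h⟩ := ih
    by_cases hall : ∀ x ∈ F, g a x = 0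
    · exact ⟨f, hf, fun t ht => by
        rcases Finset.mem_insert.1 ht with rfl | ht
        · exact fun _ => hall
        · exact h t ht⟩
    · push Not at hall
      obtain ⟨y, hy, hya⟩ := hall
      have hm : f + (1 / 2 : ℝ) • (y - f) ∈ F := hF.add_smul_sub_mem hf hy (by norm_num)
      have hval : ∀ t, g t (f + (1 / 2 : ℝ) • (y - f)) = (g t f + g t y) / 2 := by
        intro t; rw [affine_apply_add_smul, affine_linear_sub]; ring
      refine ⟨_, hm, fun t ht h0 => ?_⟩
      rw [hval] at h0
      have h1 := hnn f hf t
      have h2 := hnn y hy t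
      rcases Finset.mem_insert.1 ht with rfl | ht
      · exact absurd (by linarith) hya
      · exact h t ht (by linarith)

/-- Let f be a point of F with fewest tight inequalities and x a point at which these are tight too.
The segment from x to f can be prolonged beyond f; a functional that is maximal at f cannot be
smaller at x, since it would then grow beyond f. -/
theorem IsExposed.eq_zero_set [Finite τ] {F : Set E} (hF : IsExposed ℝ (hset S g) F)
    (hne : F.Nonempty) :
    ∃ T : Set τ, F = {x ∈ hset S g | ∀ t ∈ T, g t x = 0} := by
  obtain ⟨f, hf, hmax⟩ := exists_maximal_support (g := g) (hF.convex convex_hset) hne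
    fun x hx => (hF.subset hx).2
  refine ⟨{t | g t f = 0}, Subset.antisymm (fun x hx => ⟨hF.subset hx, fun t ht => hmax t ht x hx⟩) ?_⟩
  rintro x ⟨hx, hx0⟩
  obtain ⟨l, hl⟩ := hF hne
  have hfC := hF.subset hf
  obtain ⟨ε, hε, hmem⟩ := exists_extend_hset hfC hx hx0
  rw [hl] at hf ⊢
  refine ⟨hx, fun y hy => (hf.2 y hy).trans ?_⟩
  have := hf.2 _ hmem
  simp only [map_add, map_smul, map_sub, smul_eq_mul] at this
  by_contra hlt
  nlinarith

theorem isExposed_zero_set [FiniteDimensional ℝ E] [Finite τ] (T : Set τ) :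
    IsExposed ℝ (hset S g) {x ∈ hset S g | ∀ t ∈ T, g t x = 0} := by
  classical
  cases nonempty_fintype τ
  rintro ⟨u, hu, hu0⟩
  -- Minus the sum of the forms in T, up to a constant: once T has a common zero in the polyhedron,
  -- the maximizers are exactly these common zeros.
  let l : E →ₗ[ℝ] ℝ := -∑ t with t ∈ T, (g t).linear
  have hval : ∀ x y, l x - l y = (∑ t with t ∈ T, g t y) - ∑ t with t ∈ T, g t x := by
    intro x y
    rw [← map_sub]
    simp only [l, LinearMap.neg_apply, LinearMap.sum_apply, affine_linear_sub,
      Finset.sum_sub_distrib]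
    ring
  have hu1 : ∑ t with t ∈ T, g t u = 0 :=
    Finset.sum_eq_zero fun t ht => hu0 t (Finset.mem_filter.1 ht).2
  refine ⟨LinearMap.toContinuousLinearMap l, ?_⟩
  ext x
  simp only [mem_ofPred_eq, LinearMap.coe_toContinuousLinearMap']
  refine and_congr_right fun hx => ⟨fun h y hy => ?_, fun h t ht => ?_⟩
  · have h1 := hval x y
    have h2 : ∑ t with t ∈ T, g t x = 0 :=
      Finset.sum_eq_zero fun t ht => h t (Finset.mem_filter.1 ht).2
    have h3 : 0 ≤ ∑ t with t ∈ T, g t y := Finset.sum_nonneg fun t _ => hy.2 t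
    linarith
  · have h1 := hval x u
    have h2 := h u hu
    have h3 : ∑ t with t ∈ T, g t x = 0 :=
      le_antisymm (by linarith) (Finset.sum_nonneg fun t _ => hx.2 t)
    exact (Finset.sum_eq_zero_iff_of_nonneg fun t _ => hx.2 t).1 h3 t (by simpa using ht)

theorem eq_of_mem_extremePoints_hset [Finite τ] {x y : E} (hx : x ∈ (hset S g).extremePoints ℝ)
    (hy : y ∈ hset S g) (h : ∀ t, g t x = 0 → g t y = 0) : y = x := by
  obtain ⟨ε, hε, hmem⟩ := exists_extend_hset hx.1 hy h
  refine hx.2 hy hmem ?_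
  -- The weights that write x as a convex combination of y and x + ε(x - y).
  refine ⟨ε / (1 + ε), 1 / (1 + ε), by positivity, by positivity, by field_simp; ring, ?_⟩
  have h1 : (1 + ε) ≠ 0 := by positivity
  have : ε / (1 + ε) = ε * (1 / (1 + ε)) := by ring
  have h2 : x = ((1 + ε) * (1 / (1 + ε))) • x := by rw [mul_one_div_cancel h1, one_smul]
  conv_rhs => rw [h2]
  rw [this]
  module

/-- An extreme point is determined by its set of tight inequalities, of which there are finitely
many. -/
theorem finite_extremePoints_hset [Finite τ] : ((hset S g).extremePoints ℝ).Finite := by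
  refine Set.Finite.of_injOn (f := fun x => {t | g t x = 0}) (t := (univ : Set (Set τ)))
    (fun _ _ => mem_univ _) ?_ (Set.toFinite _)
  intro x hx y hy h
  refine eq_of_mem_extremePoints_hset hy hx.1 fun t ht => ?_
  have : t ∈ {t | g t x = 0} := by rw [show {t | g t x = 0} = {t | g t y = 0} from h]; exact ht
  exact this

theorem convexHull_extremePoints_hset [FiniteDimensional ℝ E] [Finite τ]
    (hc : IsCompact (hset S g)) : convexHull ℝ ((hset S g).extremePoints ℝ) = hset S g := by
  have h := closure_convexHull_extremePoints hc convex_hset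
  rwa [((finite_extremePoints_hset (S := S) (g := g)).isCompact_convexHull ℝ).isClosed.closure_eq] at h

theorem isClosed_hset [FiniteDimensional ℝ E] : IsClosed (hset S g) := by
  have : hset S g = (S : Set E) ∩ ⋂ t, (g t) ⁻¹' Ici 0 := by
    ext x; simp [hset]
  rw [this]
  exact S.closed_of_finiteDimensional.inter (isClosed_iInter fun t =>
    isClosed_Ici.preimage (g t).continuous_of_finiteDimensional)

/-- Where all forms are positive, a whole neighbourhood in the affine span satisfies the
inequalities. Where one vanishes, moving slightly away from the strictly positive point u violates
it. -/
theorem mem_intrinsicFrontier_hset [FiniteDimensional ℝ E] [Finite τ] {u x : E}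
    (hu : u ∈ hset S g) (hupos : ∀ t, 0 < g t u) (hx : x ∈ hset S g) :
    x ∈ intrinsicFrontier ℝ (hset S g) ↔ ∃ t, g t x = 0 := by
  have hxs : x ∈ affineSpan ℝ (hset S g) := subset_affineSpan ℝ _ hx
  have hfr : x ∈ intrinsicFrontier ℝ (hset S g) ↔ x ∉ intrinsicInterior ℝ (hset S g) := by
    rw [← intrinsicClosure_sdiff_intrinsicInterior, mem_sdiff, and_iff_right (subset_intrinsicClosure hx)]
  rw [hfr, not_iff_comm]
  push Not
  constructor
  · intro hne
    rw [mem_intrinsicInterior]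
    refine ⟨⟨x, hxs⟩, ?_, rfl⟩
    have hopen : IsOpen {y : affineSpan ℝ (hset S g) | ∀ t, 0 < g t y} := by
      rw [ofPred_forall]
      exact isOpen_iInter_of_finite fun t => isOpen_lt continuous_const
        ((g t).continuous_of_finiteDimensional.comp continuous_subtype_val)
    refine mem_interior.2 ⟨_, ?_, hopen, fun t => (hx.2 t).lt_of_ne' (hne t)⟩
    intro y hy
    have hyS : (y : E) ∈ S := (affineSpan_le.2 fun z hz => hz.1) y.2
    exact ⟨hyS, fun t => (hy t).le⟩
  · intro hint t h0
    rw [mem_intrinsicInterior] at hint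
    obtain ⟨y, hy, rfl⟩ := hint
    have hline : ∀ ε : ℝ, (y : E) + ε • (u - y) ∈ affineSpan ℝ (hset S g) := fun ε => by
      have := AffineMap.lineMap_mem ε y.2 (subset_affineSpan ℝ _ hu)
      rwa [AffineMap.lineMap_apply, vsub_eq_sub, vadd_eq_add, add_comm] at this
    have hcont : Continuous fun ε : ℝ => (⟨(y : E) + ε • (u - y), hline ε⟩ : affineSpan ℝ (hset S g)) :=
      Continuous.subtype_mk (by fun_prop) _
    have h1 : ∀ᶠ ε : ℝ in nhds 0, (⟨(y : E) + ε • (u - y), hline ε⟩ : affineSpan ℝ (hset S g)) ∈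
        interior (((↑) : affineSpan ℝ (hset S g) → E) ⁻¹' hset S g) := by
      refine hcont.continuousAt.eventually (IsOpen.mem_nhds isOpen_interior ?_)
      simpa using hy
    -- A negative ε moves from the given point in the direction opposite to u.
    obtain ⟨ε, h2, h3⟩ := ((h1.filter_mono nhdsWithin_le_nhds).and
      (self_mem_nhdsWithin (s := Iio (0 : ℝ)))).exists
    have h4 : 0 ≤ g t ((y : E) + ε • (u - y)) := (mem_preimage.1 (interior_subset h2)).2 t
    rw [affine_apply_add_smul, affine_linear_sub, h0] at h4
    have := hupos t
    have h6 : ε < 0 := h3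
    nlinarith

end HalfSpaces

/-! ### Fans of graph cones and their stellar subdivisions -/

section Fans

variable {V : Type} [Fintype V] [DecidableEq V]

/-- The net vector `∑ c_ij (e_i - e_j)` of a weighting of the directed edges. -/
noncomputable def boundary : (Gen V → ℝ) →ₗ[ℝ] (V → ℝ) where
  toFun c v := ∑ g : Gen V, c g * ((if g.1.1 = v then 1 else 0) - if g.1.2 = v then 1 else 0)
  map_add' c c' := by ext v; simp [add_mul, Finset.sum_add_distrib]
  map_smul' r c := by ext v; simp [mul_assoc, Finset.mul_sum]

theorem boundary_apply (c : Gen V → ℝ) (v : V) :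
    boundary c v = ∑ g : Gen V, c g * ((if g.1.1 = v then 1 else 0) - if g.1.2 = v then 1 else 0) :=
  rfl

/-- Summation by parts. It is applied with F constant and with F the indicator of an initial part of
the spine, where only edges across the cut survive. -/
theorem sum_mul_boundary (F : V → ℝ) (c : Gen V → ℝ) :
    ∑ v, F v * boundary c v = ∑ g : Gen V, c g * (F g.1.1 - F g.1.2) := by
  simp only [boundary_apply, Finset.mul_sum]
  rw [Finset.sum_comm]
  refine Finset.sum_congr rfl fun g _ => ?_
  simp only [mul_sub, mul_ite, mul_one, mul_zero, Finset.sum_sub_distrib, Finset.sum_ite_eq,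
    Finset.mem_univ, if_true, mul_comm]

theorem sum_boundary (c : Gen V → ℝ) : ∑ v, boundary c v = 0 := by
  simpa using sum_mul_boundary (fun _ => 1) c

/-- Weightings of directed edges supported in `A`. -/
def supportedIn (A : Finset (Gen V)) : Submodule ℝ (Gen V → ℝ) where
  carrier := {c | ∀ g ∉ A, c g = 0}
  add_mem' := fun h h' g hg => by simp [h g hg, h' g hg]
  zero_mem' := fun _ _ => rfl
  smul_mem' := fun r c h g hg => by simp [h g hg]

theorem supportedIn_mono {A B : Finset (Gen V)} (h : A ⊆ B) : supportedIn A ≤ supportedIn B :=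
  fun _ hc g hg => hc g fun h' => hg (h h')

/-- The cones spanned by the graphs of `𝒜` form a unimodular simplicial fan: `W` is the disjoint
union of the open cones and `W'` is covered by the closed ones. -/
structure IsFan (W W' : Set (V → ℝ)) (N : ℕ) (𝒜 : Finset (Finset (Gen V))) : Prop where
  inj : ∀ A ∈ 𝒜, ∀ B ∈ 𝒜, ∀ c ∈ supportedIn A, ∀ c' ∈ supportedIn B, 0 ≤ c → 0 ≤ c' →
    boundary c = boundary c' → c = c'
  pos : ∀ A ∈ 𝒜, ∀ c ∈ supportedIn A, (∀ g ∈ A, 0 < c g) → boundary c ∈ W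
  covers : ∀ d ∈ W', ∃ A ∈ 𝒜, ∃ c ∈ supportedIn A, 0 ≤ c ∧ boundary c = d
  covers_open : ∀ d ∈ W, ∃ A ∈ 𝒜, ∃ c ∈ supportedIn A, (∀ g ∈ A, 0 < c g) ∧ boundary c = d
  integral : ∀ A ∈ 𝒜, ∀ c ∈ supportedIn A, (∀ v, ∃ z : ℤ, boundary c v = z) →
    ∀ g, ∃ z : ℤ, c g = z
  card_le : ∀ A ∈ 𝒜, A.card ≤ N

variable {W W' : Set (V → ℝ)} {N : ℕ} {𝒜 : Finset (Finset (Gen V))}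

/-- Uniqueness of nonnegative weights, applied to the positive and negative parts of c, gives linear
independence of the edge vectors of A. -/
theorem IsFan.indep (h : IsFan W W' N 𝒜) {A : Finset (Gen V)} (hA : A ∈ 𝒜) {c : Gen V → ℝ}
    (hc : c ∈ supportedIn A) (h0 : boundary c = 0) : c = 0 := by
  have h1 : (fun g => max (c g) 0) ∈ supportedIn A := fun g hg => by simp [hc g hg]
  have h2 : (fun g => max (-c g) 0) ∈ supportedIn A := fun g hg => by simp [hc g hg]
  have h3 : c = (fun g => max (c g) 0) - fun g => max (-c g) 0 := by
    ext g
    rcases le_total 0 (c g) with h | h <;> simp [h]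
  have h4 := h.inj A hA A hA _ h1 _ h2 (fun g => le_max_right _ _) (fun g => le_max_right _ _) (by
    rw [← sub_eq_zero, ← map_sub, ← h3, h0])
  rw [h3, h4, sub_self]

/-- The family obtained from `𝒜` by a reduction which replaces `a, b` by `e` and one or none of
`a, b`. -/
def fanReduce (a b e : Gen V) (𝒜 : Finset (Finset (Gen V))) : Finset (Finset (Gen V)) :=
  𝒜.filter (fun A => ¬ (a ∈ A ∧ b ∈ A)) ∪
    ((𝒜.filter fun A => a ∈ A ∧ b ∈ A).image (fun A => insert e (A.erase b)) ∪
      ((𝒜.filter fun A => a ∈ A ∧ b ∈ A).image (fun A => insert e (A.erase a)) ∪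
        (𝒜.filter fun A => a ∈ A ∧ b ∈ A).image (fun A => insert e ((A.erase a).erase b))))

theorem mem_fanReduce {a b e : Gen V} {A' : Finset (Gen V)} :
    A' ∈ fanReduce a b e 𝒜 ↔ (A' ∈ 𝒜 ∧ ¬ (a ∈ A' ∧ b ∈ A')) ∨
      ∃ A ∈ 𝒜, (a ∈ A ∧ b ∈ A) ∧ (A' = insert e (A.erase b) ∨ A' = insert e (A.erase a) ∨
        A' = insert e ((A.erase a).erase b)) := by
  simp only [fanReduce, Finset.mem_union, Finset.mem_filter, Finset.mem_image]
  grind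

theorem fanReduce_of_forall_not {a b e : Gen V} (h : ∀ A ∈ 𝒜, ¬ (a ∈ A ∧ b ∈ A)) :
    fanReduce a b e 𝒜 = 𝒜 := by
  ext A'
  rw [mem_fanReduce]
  grind

/-- Moves the weight of `e` to `a` and to `b`. -/
def moveWeight (a b e : Gen V) (c : Gen V → ℝ) : Gen V → ℝ := fun g =>
  if g = a then c a + c e else if g = b then c b + c e else if g = e then 0 else c g

/-- The linear relation (e_i - e_j) + (e_j - e_k) = e_i - e_k behind the relations of the
subdivision algebra. -/
theorem boundary_triangle {i j k : V} (hij : i ≠ j) (hjk : j ≠ k) (hik : i ≠ k) :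
    boundary (Pi.single (⟨(i, j), hij⟩ : Gen V) (1 : ℝ)) + boundary (Pi.single ⟨(j, k), hjk⟩ 1)
      = boundary (Pi.single ⟨(i, k), hik⟩ 1) := by
  ext v
  simp [boundary_apply, Pi.single_apply, ite_mul]

variable {a b e : Gen V}

theorem boundary_moveWeight (hab : a ≠ b) (hae : a ≠ e) (hbe : b ≠ e)
    (hrel : boundary (Pi.single a (1 : ℝ)) + boundary (Pi.single b 1) = boundary (Pi.single e 1))
    (c : Gen V → ℝ) : boundary (moveWeight a b e c) = boundary c := by
  have : moveWeight a b e c = c + c e • (Pi.single a 1 + Pi.single b 1 - Pi.single e 1) := by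
    ext g
    simp only [moveWeight, Pi.add_apply, Pi.smul_apply, Pi.sub_apply, smul_eq_mul, Pi.single_apply]
    by_cases h1 : g = a <;> by_cases h2 : g = b <;> by_cases h3 : g = e <;> simp_all
  rw [this, map_add, map_smul, map_sub, map_add, hrel, sub_self, smul_zero, add_zero]

/-- Otherwise the vector of e would have two nonnegative expressions in the fan, by e alone and by a
and b. Hence a reduction that changes something always introduces a new ray. -/
theorem IsFan.not_mem (h : IsFan W W' N 𝒜) (hae : a ≠ e) (hbe : b ≠ e)
    (hrel : boundary (Pi.single a (1 : ℝ)) + boundary (Pi.single b 1) = boundary (Pi.single e 1))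
    {A : Finset (Gen V)} (hA : A ∈ 𝒜) (haA : a ∈ A) (hbA : b ∈ A) {B : Finset (Gen V)}
    (hB : B ∈ 𝒜) : e ∉ B := by
  intro he
  have h1 := h.inj B hB A hA (Pi.single e 1) (fun g hg => by grind)
    (Pi.single a 1 + Pi.single b 1) (fun g hg => by
      simp only [Pi.add_apply]; grind)
    (by intro g; simp only [Pi.single_apply]; split_ifs <;> simp)
    (by intro g; simp only [Pi.add_apply, Pi.single_apply]; split_ifs <;> simp) (by rw [map_add, hrel])
  have := congrFun h1 e
  simp [hae.symm, hbe.symm] at this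

/-- Each new graph has a parent in the old family whose cone contains its cone, with open cones
going into open cones. The last conjunct says that a and b no longer occur together, which makes
moving weights invertible. -/
theorem moveWeight_mem (he : ∀ B ∈ 𝒜, e ∉ B) {A' : Finset (Gen V)}
    (hA' : A' ∈ fanReduce a b e 𝒜) :
    ∃ A ∈ 𝒜, (∀ c ∈ supportedIn A', moveWeight a b e c ∈ supportedIn A) ∧
      (∀ c ∈ supportedIn A', (∀ g ∈ A', 0 < c g) → ∀ g ∈ A, 0 < moveWeight a b e c g) ∧
      A'.card ≤ A.card ∧ ¬ (a ∈ A' ∧ b ∈ A') := by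
  rcases mem_fanReduce.1 hA' with ⟨h1, h2⟩ | ⟨A, hA, ⟨haA, hbA⟩, h⟩
  · refine ⟨A', h1, fun c hc g hg => ?_, fun c hc hp g hg => ?_, le_rfl, h2⟩
    · have := hc e (he _ h1)
      simp only [moveWeight]
      have := hc g hg
      split_ifs <;> grind
    · have := hc e (he _ h1)
      have := he _ h1
      have := hp g hg
      simp only [moveWeight]
      split_ifs <;> grind
  · have heA := he A hA
    refine ⟨A, hA, fun c hc g hg => ?_, fun c hc hp g hg => ?_, ?_, ?_⟩
    · have : c g = 0 ∨ g = e := by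
        by_cases hge : g = e
        · exact Or.inr hge
        · exact Or.inl (hc g (by grind))
      simp only [moveWeight]
      split_ifs <;> grind
    · have hpe : 0 < c e := hp e (by grind)
      have hca : 0 ≤ c a := by
        by_cases h : a ∈ A'
        · exact (hp a h).le
        · exact (hc a h).ge
      have hcb : 0 ≤ c b := by
        by_cases h : b ∈ A'
        · exact (hp b h).le
        · exact (hc b h).ge
      simp only [moveWeight]
      split_ifs with h1 h2 h3
      · linarith
      · linarith
      · grind
      · exact hp g (by grind)
    · have h1 := Finset.card_erase_of_mem haA
      have h2 := Finset.card_erase_of_mem hbA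
      have h3 := Finset.card_pos.2 ⟨a, haA⟩
      have h5 := Finset.card_le_card (Finset.erase_subset b (A.erase a))
      rcases h with rfl | rfl | rfl
      · have := Finset.card_insert_le e (A.erase b); omega
      · have := Finset.card_insert_le e (A.erase a); omega
      · have := Finset.card_insert_le e ((A.erase a).erase b); omega
    · grind

theorem moveWeight_nonneg {c : Gen V → ℝ} (hc : 0 ≤ c) : 0 ≤ moveWeight a b e c := by
  intro g
  have h1 := hc a; have h2 := hc b; have h3 := hc e; have h4 := hc g
  simp only [Pi.zero_apply] at *
  simp only [moveWeight]
  split_ifs <;> linarith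

/-- The inverse of `moveWeight` on nonnegative weightings: moves as much weight as possible. -/
noncomputable def splitWeight (a b e : Gen V) (c : Gen V → ℝ) : Gen V → ℝ := fun g =>
  if g = a then c a - min (c a) (c b) else if g = b then c b - min (c a) (c b)
    else if g = e then min (c a) (c b) else c g

theorem moveWeight_splitWeight (hab : a ≠ b) (hae : a ≠ e) (hbe : b ≠ e) {c : Gen V → ℝ}
    (hc : c e = 0) : moveWeight a b e (splitWeight a b e c) = c := by
  ext g
  simp only [moveWeight, splitWeight]
  grind

theorem splitWeight_nonneg {c : Gen V → ℝ} (hc : 0 ≤ c) : 0 ≤ splitWeight a b e c := by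
  intro g
  have h1 := hc a; have h2 := hc b; have h4 := hc g
  simp only [Pi.zero_apply] at *
  simp only [splitWeight]
  split_ifs <;> grind

/-- If c a or c b is zero, the smaller of c a + c e and c b + c e is c e, so the weight of e can be
recovered. -/
theorem splitWeight_moveWeight (hab : a ≠ b) {c : Gen V → ℝ}
    (hc : 0 ≤ c) (h : c a = 0 ∨ c b = 0) : splitWeight a b e (moveWeight a b e c) = c := by
  have h1 := hc a; have h2 := hc b; have h3 := hc e
  simp only [Pi.zero_apply] at *
  ext g
  simp only [moveWeight, splitWeight]
  grind

/-- Stellar subdivision at the ray of e. Every axiom is pulled back along `moveWeight`, which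
preserves net vectors, and `splitWeight` inverts it; which of the new cones is hit depends on the
comparison of c a with c b. -/
theorem IsFan.reduce (h : IsFan W W' N 𝒜) (hab : a ≠ b) (hae : a ≠ e) (hbe : b ≠ e)
    (hrel : boundary (Pi.single a (1 : ℝ)) + boundary (Pi.single b 1) = boundary (Pi.single e 1)) :
    IsFan W W' N (fanReduce a b e 𝒜) := by
  -- If no graph contains both a and b, then e may already occur in the family, but nothing changes.
  by_cases hex : ∀ A ∈ 𝒜, ¬ (a ∈ A ∧ b ∈ A)
  · rwa [fanReduce_of_forall_not hex]
  push Not at hex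
  obtain ⟨A₀, hA₀, ha₀, hb₀⟩ := hex
  have he : ∀ B ∈ 𝒜, e ∉ B := fun B hB => h.not_mem hae hbe hrel hA₀ ha₀ hb₀ hB
  have hbd := boundary_moveWeight hab hae hbe hrel
  have hzero : ∀ A' : Finset (Gen V), ¬ (a ∈ A' ∧ b ∈ A') → ∀ c ∈ supportedIn A', c a = 0 ∨ c b = 0 := by
    intro A' hA' c hc
    by_cases ha : a ∈ A'
    · exact Or.inr (hc b fun hb => hA' ⟨ha, hb⟩)
    · exact Or.inl (hc a ha)
  refine ⟨?_, ?_, ?_, ?_, ?_, ?_⟩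
  · intro A' hA' B' hB' c hc c' hc' h0 h0' hcc
    obtain ⟨A, hA, hA1, -, -, hA2⟩ := moveWeight_mem he hA'
    obtain ⟨B, hB, hB1, -, -, hB2⟩ := moveWeight_mem he hB'
    have := h.inj A hA B hB _ (hA1 c hc) _ (hB1 c' hc') (moveWeight_nonneg h0)
      (moveWeight_nonneg h0') (by rw [hbd, hbd, hcc])
    rw [← splitWeight_moveWeight hab h0 (hzero _ hA2 c hc), this,
      splitWeight_moveWeight hab h0' (hzero _ hB2 c' hc')]
  · intro A' hA' c hc hp
    obtain ⟨A, hA, hA1, hA3, -, -⟩ := moveWeight_mem he hA'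
    rw [← hbd]
    exact h.pos A hA _ (hA1 c hc) (hA3 c hc hp)
  · intro d hd
    obtain ⟨A, hA, c, hc, h0, hcd⟩ := h.covers d hd
    have hce := hc e (he A hA)
    by_cases hAab : a ∈ A ∧ b ∈ A
    · rcases le_total (c a) (c b) with hle | hle
      · refine ⟨insert e (A.erase a), mem_fanReduce.2 (Or.inr ⟨A, hA, hAab, by simp⟩),
          splitWeight a b e c, fun g hg => ?_, splitWeight_nonneg h0, ?_⟩
        · have := fun h => hc g h
          simp only [splitWeight]
          grind
        · rw [← hbd, moveWeight_splitWeight hab hae hbe hce, hcd]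
      · refine ⟨insert e (A.erase b), mem_fanReduce.2 (Or.inr ⟨A, hA, hAab, by simp⟩),
          splitWeight a b e c, fun g hg => ?_, splitWeight_nonneg h0, ?_⟩
        · have := fun h => hc g h
          simp only [splitWeight]
          grind
        · rw [← hbd, moveWeight_splitWeight hab hae hbe hce, hcd]
    · exact ⟨A, mem_fanReduce.2 (Or.inl ⟨hA, hAab⟩), c, hc, h0, hcd⟩
  · intro d hd
    obtain ⟨A, hA, c, hc, h0, hcd⟩ := h.covers_open d hd
    have hce := hc e (he A hA)
    by_cases hAab : a ∈ A ∧ b ∈ A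
    · have hpa := h0 a hAab.1
      have hpb := h0 b hAab.2
      -- For open cones equality is a case of its own: both edges lose all their weight.
      rcases lt_trichotomy (c a) (c b) with hle | hle | hle
      · refine ⟨insert e (A.erase a), mem_fanReduce.2 (Or.inr ⟨A, hA, hAab, by simp⟩),
          splitWeight a b e c, fun g hg => ?_, fun g hg => ?_, ?_⟩
        · have := fun h => hc g h
          simp only [splitWeight]
          grind
        · have := fun h => h0 g h
          simp only [splitWeight]
          grind
        · rw [← hbd, moveWeight_splitWeight hab hae hbe hce, hcd]
      · refine ⟨insert e ((A.erase a).erase b), mem_fanReduce.2 (Or.inr ⟨A, hA, hAab, by simp⟩),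
          splitWeight a b e c, fun g hg => ?_, fun g hg => ?_, ?_⟩
        · have := fun h => hc g h
          simp only [splitWeight]
          grind
        · have := fun h => h0 g h
          simp only [splitWeight]
          grind
        · rw [← hbd, moveWeight_splitWeight hab hae hbe hce, hcd]
      · refine ⟨insert e (A.erase b), mem_fanReduce.2 (Or.inr ⟨A, hA, hAab, by simp⟩),
          splitWeight a b e c, fun g hg => ?_, fun g hg => ?_, ?_⟩
        · have := fun h => hc g h
          simp only [splitWeight]
          grind
        · have := fun h => h0 g h
          simp only [splitWeight]
          grind
        · rw [← hbd, moveWeight_splitWeight hab hae hbe hce, hcd]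
    · exact ⟨A, mem_fanReduce.2 (Or.inl ⟨hA, hAab⟩), c, hc, h0, hcd⟩
  · intro A' hA' c hc hint
    obtain ⟨A, hA, hA1, -, -, hA2⟩ := moveWeight_mem he hA'
    have key := h.integral A hA _ (hA1 c hc) (by rwa [hbd])
    have hca : ∃ z : ℤ, c a + c e = z := by simpa [moveWeight] using key a
    have hcb : ∃ z : ℤ, c b + c e = z := by simpa [moveWeight, hab.symm] using key b
    -- The integers c a + c e and c b + c e determine c e, because c a or c b is zero.
    have hce : ∃ z : ℤ, c e = z := by
      rcases hzero A' hA2 c hc with h0 | h0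
      · simpa [h0] using hca
      · simpa [h0] using hcb
    intro g
    obtain ⟨z, hz⟩ := hce
    by_cases h1 : g = a
    · obtain ⟨y, hy⟩ := hca
      exact ⟨y - z, by rw [h1]; push_cast; linarith⟩
    by_cases h2 : g = b
    · obtain ⟨y, hy⟩ := hcb
      exact ⟨y - z, by rw [h2]; push_cast; linarith⟩
    by_cases h3 : g = e
    · exact ⟨z, by rw [h3, hz]⟩
    simpa [moveWeight, h1, h2, h3] using key g
  · intro A' hA'
    obtain ⟨A, hA, -, -, h1, -⟩ := moveWeight_mem he hA'
    exact h1.trans (h.card_le A hA)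

/-- Every closed cone of the reduced family is contained in one of the original family. -/
theorem IsFan.reduce_cone (h : IsFan W W' N 𝒜) (hab : a ≠ b) (hae : a ≠ e) (hbe : b ≠ e)
    (hrel : boundary (Pi.single a (1 : ℝ)) + boundary (Pi.single b 1) = boundary (Pi.single e 1))
    {A' : Finset (Gen V)} (hA' : A' ∈ fanReduce a b e 𝒜) :
    ∃ A ∈ 𝒜, ∀ c ∈ supportedIn A', 0 ≤ c → ∃ c' ∈ supportedIn A, 0 ≤ c' ∧ boundary c' = boundary c := by
  by_cases hex : ∀ A ∈ 𝒜, ¬ (a ∈ A ∧ b ∈ A)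
  · rw [fanReduce_of_forall_not hex] at hA'
    exact ⟨A', hA', fun c hc h0 => ⟨c, hc, h0, rfl⟩⟩
  push Not at hex
  obtain ⟨A₀, hA₀, ha₀, hb₀⟩ := hex
  have he : ∀ B ∈ 𝒜, e ∉ B := fun B hB => h.not_mem hae hbe hrel hA₀ ha₀ hb₀ hB
  obtain ⟨A, hA, hA1, -, -, -⟩ := moveWeight_mem he hA'
  exact ⟨A, hA, fun c hc h0 => ⟨_, hA1 c hc, moveWeight_nonneg h0,
    boundary_moveWeight hab hae hbe hrel c⟩⟩

end Fans

/-! ### Reductions of polynomials and of families of graphs -/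

section Reductions

variable {V : Type} [Fintype V] [DecidableEq V]

/-- The exponent of the squarefree monomial with support `A`. -/
noncomputable def graphExponent (A : Finset (Gen V)) : Gen V →₀ ℕ :=
  Finsupp.indicator A fun _ _ => 1

theorem graphExponent_apply (A : Finset (Gen V)) (g : Gen V) :
    graphExponent A g = if g ∈ A then 1 else 0 := by
  simp [graphExponent, Finsupp.indicator_apply]

theorem graphExponent_injective :
    Function.Injective (graphExponent : Finset (Gen V) → Gen V →₀ ℕ) := by
  intro A B h
  ext g
  have := DFunLike.congr_fun h g
  rw [graphExponent_apply, graphExponent_apply] at this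
  grind

theorem monomial_graphExponent (A : Finset (Gen V)) (r : Polynomial ℤ) :
    MvPolynomial.monomial (graphExponent A) r
      = MvPolynomial.C r * ∏ g ∈ A, (MvPolynomial.X g : BetaPoly V) := by
  induction A using Finset.induction_on with
  | empty =>
    have : graphExponent (∅ : Finset (Gen V)) = 0 := by ext; simp [graphExponent_apply]
    rw [this, Finset.prod_empty, mul_one, MvPolynomial.C_apply]
  | insert a A ha ih =>
    have : graphExponent (insert a A) = graphExponent A + Finsupp.single a 1 := by
      ext g
      rw [Finsupp.add_apply, graphExponent_apply, graphExponent_apply, Finsupp.single_apply]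
      grind
    rw [this, MvPolynomial.monomial_add_single, ih, Finset.prod_insert ha]
    ring

/-- The sum over `𝒜` of `β ^ codimension` times the monomial of the graph. -/
noncomputable def fanPoly (N : ℕ) (𝒜 : Finset (Finset (Gen V))) : BetaPoly V :=
  ∑ A ∈ 𝒜, betaElt ^ (N - A.card) * ∏ g ∈ A, MvPolynomial.X g

theorem fanPoly_eq_sum_monomial (N : ℕ) (𝒜 : Finset (Finset (Gen V))) :
    fanPoly N 𝒜
      = ∑ A ∈ 𝒜, MvPolynomial.monomial (graphExponent A) (Polynomial.X ^ (N - A.card)) := by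
  refine Finset.sum_congr rfl fun A _ => ?_
  rw [monomial_graphExponent, betaElt, map_pow]

/-- Distinct graphs have distinct monomials and their coefficients are powers of β, hence nonzero.
The family, and with it the subdivision, can be read off the polynomial. -/
theorem graphExponent_mem_support_fanPoly {N : ℕ} {𝒜 : Finset (Finset (Gen V))}
    {A : Finset (Gen V)} : graphExponent A ∈ (fanPoly N 𝒜).support ↔ A ∈ 𝒜 := by
  classical
  rw [MvPolynomial.mem_support_iff, fanPoly_eq_sum_monomial, MvPolynomial.coeff_sum]
  simp only [MvPolynomial.coeff_monomial, graphExponent_injective.eq_iff]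
  rw [Finset.sum_ite_eq']
  by_cases h : A ∈ 𝒜 <;> simp [h]

variable {i j k : V} {hij : i ≠ j} {hjk : j ≠ k} {hik : i ≠ k}

open Classical in
/-- The reduction of a single term. -/
noncomputable def reduceTerm (i j k : V) (hij : i ≠ j) (hjk : j ≠ k) (hik : i ≠ k)
    (m : Gen V →₀ ℕ) (r : Polynomial ℤ) : BetaPoly V :=
  if 1 ≤ m ⟨(i, j), hij⟩ ∧ 1 ≤ m ⟨(j, k), hjk⟩ then
    MvPolynomial.monomial
      (m - Finsupp.single ⟨(i, j), hij⟩ 1 - Finsupp.single ⟨(j, k), hjk⟩ 1) r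
      * reductionRhs i j k hij hjk hik
  else MvPolynomial.monomial m r

theorem reduceTerm_zero (m : Gen V →₀ ℕ) : reduceTerm i j k hij hjk hik m 0 = 0 := by
  simp [reduceTerm]

theorem reduceTerm_add (m : Gen V →₀ ℕ) (r s : Polynomial ℤ) :
    reduceTerm i j k hij hjk hik m (r + s)
      = reduceTerm i j k hij hjk hik m r + reduceTerm i j k hij hjk hik m s := by
  unfold reduceTerm
  split_ifs <;> simp [add_mul]

theorem reduction_eq_sum {P : BetaPoly V} {s : Finset (Gen V →₀ ℕ)} (hs : P.support ⊆ s) :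
    reduction i j k hij hjk hik P = ∑ m ∈ s, reduceTerm i j k hij hjk hik m (P.coeff m) := by
  refine Finset.sum_subset hs fun m _ hm => ?_
  rw [MvPolynomial.notMem_support_iff.1 hm]
  exact reduceTerm_zero m

/-- Terms may cancel in P + Q, so all three sums are taken over one common finite set of exponents,
the additional ones contributing zero. -/
theorem reduction_add (P Q : BetaPoly V) : reduction i j k hij hjk hik (P + Q)
    = reduction i j k hij hjk hik P + reduction i j k hij hjk hik Q := by
  rw [reduction_eq_sum (P := P + Q) (s := P.support ∪ Q.support) MvPolynomial.support_add,
    reduction_eq_sum (P := P) (Finset.subset_union_left (s₂ := Q.support)),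
    reduction_eq_sum (P := Q) (Finset.subset_union_right (s₁ := P.support)),
    ← Finset.sum_add_distrib]
  exact Finset.sum_congr rfl fun m _ => by rw [MvPolynomial.coeff_add, reduceTerm_add]

theorem reduction_zero : reduction i j k hij hjk hik (0 : BetaPoly V) = 0 := by
  simp [reduction]

theorem reduction_sum {ι : Type*} (s : Finset ι) (f : ι → BetaPoly V) :
    reduction i j k hij hjk hik (∑ x ∈ s, f x) = ∑ x ∈ s, reduction i j k hij hjk hik (f x) := by
  classical
  induction s using Finset.induction_on with
  | empty => simp [reduction_zero]
  | insert a s ha ih => rw [Finset.sum_insert ha, Finset.sum_insert ha, reduction_add, ih]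

theorem reduction_monomial (m : Gen V →₀ ℕ) (r : Polynomial ℤ) :
    reduction i j k hij hjk hik (MvPolynomial.monomial m r)
      = reduceTerm i j k hij hjk hik m r := by
  rw [reduction_eq_sum (MvPolynomial.support_monomial_subset), Finset.sum_singleton,
    MvPolynomial.coeff_monomial, if_pos rfl]

theorem monomial_sub_mul {m : Gen V →₀ ℕ} (h : 1 ≤ m ⟨(i, j), hij⟩ ∧ 1 ≤ m ⟨(j, k), hjk⟩)
    (r : Polynomial ℤ) :
    MvPolynomial.monomial (m - Finsupp.single ⟨(i, j), hij⟩ 1 - Finsupp.single ⟨(j, k), hjk⟩ 1) r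
      * (xGen i j hij * xGen j k hjk) = MvPolynomial.monomial m r := by
  have hne : (⟨(i, j), hij⟩ : Gen V) ≠ ⟨(j, k), hjk⟩ := by
    intro h; simp only [Subtype.mk.injEq, Prod.mk.injEq] at h; exact hij h.1
  have : m = m - Finsupp.single ⟨(i, j), hij⟩ 1 - Finsupp.single ⟨(j, k), hjk⟩ 1
      + Finsupp.single ⟨(i, j), hij⟩ 1 + Finsupp.single ⟨(j, k), hjk⟩ 1 := by
    ext g
    simp only [Finsupp.add_apply, Finsupp.tsub_apply, Finsupp.single_apply]
    grind
  conv_rhs => rw [this, MvPolynomial.monomial_add_single, MvPolynomial.monomial_add_single]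
  simp only [xGen]
  ring

theorem mk_reduction (P : BetaPoly V) :
    Ideal.Quotient.mk (subdivisionIdeal V) (reduction i j k hij hjk hik P)
      = Ideal.Quotient.mk (subdivisionIdeal V) P := by
  conv_rhs => rw [MvPolynomial.as_sum P]
  rw [reduction_eq_sum (le_refl _), map_sum, map_sum]
  refine Finset.sum_congr rfl fun m _ => ?_
  unfold reduceTerm
  split_ifs with h
  · conv_rhs => rw [← monomial_sub_mul h]
    rw [map_mul, map_mul]
    congr 1
    symm
    rw [Ideal.Quotient.eq]
    exact Ideal.subset_span ⟨i, j, k, hij, hjk, hik, rfl⟩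
  · rfl

/-- Removing one of a, b and adding e keeps the number of edges; removing both lowers it by one,
which is matched by the additional factor β. -/
theorem reduceTerm_graphExponent {N : ℕ} {A : Finset (Gen V)} (hN : A.card ≤ N)
    (ha : (⟨(i, j), hij⟩ : Gen V) ∈ A) (hb : (⟨(j, k), hjk⟩ : Gen V) ∈ A)
    (he : (⟨(i, k), hik⟩ : Gen V) ∉ A) :
    reduceTerm i j k hij hjk hik (graphExponent A) (Polynomial.X ^ (N - A.card))
      = ∑ A' ∈ {insert ⟨(i, k), hik⟩ (A.erase ⟨(j, k), hjk⟩),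
          insert ⟨(i, k), hik⟩ (A.erase ⟨(i, j), hij⟩),
          insert ⟨(i, k), hik⟩ ((A.erase ⟨(i, j), hij⟩).erase ⟨(j, k), hjk⟩)},
        betaElt ^ (N - A'.card) * ∏ g ∈ A', (MvPolynomial.X g : BetaPoly V) := by
  set a : Gen V := ⟨(i, j), hij⟩ with ha_def
  set b : Gen V := ⟨(j, k), hjk⟩ with hb_def
  set e : Gen V := ⟨(i, k), hik⟩ with he_def
  have hab : a ≠ b := by
    intro h; simp only [a, b, Subtype.mk.injEq, Prod.mk.injEq] at h; exact hij h.1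
  have hB : graphExponent A - Finsupp.single a 1 - Finsupp.single b 1
      = graphExponent ((A.erase a).erase b) := by
    ext g
    simp only [Finsupp.tsub_apply, Finsupp.single_apply, graphExponent_apply]
    grind
  have h1 : insert e (A.erase b) ∉ ({insert e (A.erase a), insert e ((A.erase a).erase b)} :
      Finset (Finset (Gen V))) := by
    intro h
    have : a ∈ insert e (A.erase b) := by grind
    simp only [Finset.mem_insert, Finset.mem_singleton] at h
    rcases h with h | h <;> rw [h] at this <;> grind
  have h2 : insert e (A.erase a) ∉ ({insert e ((A.erase a).erase b)} : Finset (Finset (Gen V))) := by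
    intro h
    have : b ∈ insert e (A.erase a) := by grind
    rw [Finset.mem_singleton.1 h] at this
    grind
  have hbA : b ∈ A.erase a := by grind
  have haA : a ∈ A.erase b := by grind
  have he1 : e ∉ A.erase b := by grind
  have he2 : e ∉ A.erase a := by grind
  have he3 : e ∉ (A.erase a).erase b := by grind
  have hca := Finset.card_erase_of_mem ha
  have hcb := Finset.card_erase_of_mem hb
  have hcab := Finset.card_erase_of_mem hbA
  have hpos := Finset.card_pos.2 ⟨a, haA⟩
  have n1 : N - (insert e (A.erase b)).card = N - A.card := by
    rw [Finset.card_insert_of_notMem he1]; omega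
  have n2 : N - (insert e (A.erase a)).card = N - A.card := by
    rw [Finset.card_insert_of_notMem he2]; omega
  -- The subtraction is truncated, so the bound `A.card ≤ N` is needed here.
  have n3 : N - (insert e ((A.erase a).erase b)).card = N - A.card + 1 := by
    rw [Finset.card_insert_of_notMem he3]; omega
  rw [Finset.sum_insert h1, Finset.sum_insert h2, Finset.sum_singleton, n1, n2, n3,
    Finset.prod_insert he1, Finset.prod_insert he2, Finset.prod_insert he3,
    ← Finset.mul_prod_erase _ _ hbA, ← Finset.mul_prod_erase _ _ haA,
    Finset.erase_right_comm (a := b) (b := a)]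
  have hcond : 1 ≤ graphExponent A a ∧ 1 ≤ graphExponent A b := by
    simp [graphExponent_apply, ha, hb]
  rw [reduceTerm, if_pos hcond, ← ha_def, ← hb_def, hB, monomial_graphExponent, map_pow]
  simp only [reductionRhs, xGen, betaElt, ← ha_def, ← hb_def, ← he_def]
  ring

/-- Since e is new, the graphs that contain e are separated from the untouched ones, and their
parents can be recovered; so no two terms of the result have the same monomial. -/
theorem reduction_fanPoly {N : ℕ} {𝒜 : Finset (Finset (Gen V))} (hN : ∀ A ∈ 𝒜, A.card ≤ N)
    (he : ∀ A ∈ 𝒜, (⟨(i, j), hij⟩ : Gen V) ∈ A → (⟨(j, k), hjk⟩ : Gen V) ∈ A →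
      ∀ B ∈ 𝒜, (⟨(i, k), hik⟩ : Gen V) ∉ B) :
    reduction i j k hij hjk hik (fanPoly N 𝒜)
      = fanPoly N (fanReduce ⟨(i, j), hij⟩ ⟨(j, k), hjk⟩ ⟨(i, k), hik⟩ 𝒜) := by
  rw [fanPoly_eq_sum_monomial, reduction_sum]
  simp only [reduction_monomial]
  set a : Gen V := ⟨(i, j), hij⟩ with ha_def
  set b : Gen V := ⟨(j, k), hjk⟩ with hb_def
  set e : Gen V := ⟨(i, k), hik⟩ with he_def
  have hab : a ≠ b := by
    intro h; simp only [a, b, Subtype.mk.injEq, Prod.mk.injEq] at h; exact hij h.1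
  rw [← Finset.sum_filter_add_sum_filter_not 𝒜 (fun A => ¬ (a ∈ A ∧ b ∈ A))]
  have hbi : fanReduce a b e 𝒜 = 𝒜.filter (fun A => ¬ (a ∈ A ∧ b ∈ A)) ∪
      (𝒜.filter fun A => ¬ ¬ (a ∈ A ∧ b ∈ A)).biUnion fun A => {insert e (A.erase b),
        insert e (A.erase a), insert e ((A.erase a).erase b)} := by
    ext A'
    rw [mem_fanReduce]
    simp only [Finset.mem_union, Finset.mem_filter, Finset.mem_biUnion, Finset.mem_insert,
      Finset.mem_singleton, not_not, and_assoc]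
  rw [hbi, fanPoly, Finset.sum_union, Finset.sum_biUnion]
  · congr 1
    · refine Finset.sum_congr rfl fun A hA => ?_
      have h1 := (Finset.mem_filter.1 hA).2
      have hcond : ¬ (1 ≤ graphExponent A a ∧ 1 ≤ graphExponent A b) := by
        simp only [graphExponent_apply]
        grind
      rw [reduceTerm, if_neg hcond, monomial_graphExponent, map_pow, betaElt]
    · refine Finset.sum_congr rfl fun A hA => ?_
      obtain ⟨hA1, hA2⟩ := Finset.mem_filter.1 hA
      rw [not_not] at hA2
      exact reduceTerm_graphExponent (hN A hA1) hA2.1 hA2.2 (he A hA1 hA2.1 hA2.2 A hA1)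
  -- The parent of a new graph C is obtained by deleting e and restoring a and b, so different
  -- parents have disjoint sets of children.
  · intro A hA B hB hne
    simp only [Finset.coe_filter, Set.mem_ofPred_eq, not_not] at hA hB
    have heA := he A hA.1 hA.2.1 hA.2.2 A hA.1
    have heB := he A hA.1 hA.2.1 hA.2.2 B hB.1
    rw [Function.onFun, Finset.disjoint_left]
    intro C hC hC'
    apply hne
    ext g
    simp only [Finset.mem_insert, Finset.mem_singleton] at hC hC'
    have key : ∀ g, g ≠ a → g ≠ b → g ≠ e → (g ∈ A ↔ g ∈ B) := by
      intro g h1 h2 h3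
      have hgA : g ∈ C ↔ g ∈ A := by rcases hC with rfl | rfl | rfl <;> grind
      have hgB : g ∈ C ↔ g ∈ B := by rcases hC' with rfl | rfl | rfl <;> grind
      rw [← hgA, hgB]
    by_cases h1 : g = a
    · grind
    by_cases h2 : g = b
    · grind
    by_cases h3 : g = e
    · grind
    exact key g h1 h2 h3
  · rw [Finset.disjoint_left]
    intro C hC hC'
    obtain ⟨A, hA, hCA⟩ := Finset.mem_biUnion.1 hC'
    obtain ⟨hA1, hA2⟩ := Finset.mem_filter.1 hA
    rw [not_not] at hA2
    have h1 := he A hA1 hA2.1 hA2.2 C (Finset.mem_filter.1 hC).1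
    simp only [Finset.mem_insert, Finset.mem_singleton] at hCA
    rcases hCA with rfl | rfl | rfl <;> exact h1 (Finset.mem_insert_self _ _)

theorem Reduces.mk_eq {P Q : BetaPoly V} (h : Reduces P Q) :
    Ideal.Quotient.mk (subdivisionIdeal V) Q = Ideal.Quotient.mk (subdivisionIdeal V) P := by
  induction h with
  | refl => rfl
  | tail _ h ih =>
    obtain ⟨i, j, k, hij, hjk, hik, rfl⟩ := h
    rw [mk_reduction, ih]

/-- Every reduction of the polynomial of a fan is the polynomial of a finer fan. -/
theorem Reduces.exists_fan {W W' : Set (V → ℝ)} {N : ℕ} {𝒜 : Finset (Finset (Gen V))}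
    (h𝒜 : IsFan W W' N 𝒜) {R : BetaPoly V} (h : Reduces (fanPoly N 𝒜) R) :
    ∃ ℬ, IsFan W W' N ℬ ∧ R = fanPoly N ℬ ∧ ∀ B ∈ ℬ, ∃ A ∈ 𝒜, ∀ c ∈ supportedIn B, 0 ≤ c →
      ∃ c' ∈ supportedIn A, 0 ≤ c' ∧ boundary c' = boundary c := by
  induction h with
  | refl => exact ⟨𝒜, h𝒜, rfl, fun B hB => ⟨B, hB, fun c hc h0 => ⟨c, hc, h0, rfl⟩⟩⟩
  | tail _ h ih =>
    obtain ⟨i, j, k, hij, hjk, hik, rfl⟩ := h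
    obtain ⟨ℬ, hℬ, rfl, hcone⟩ := ih
    have hab : (⟨(i, j), hij⟩ : Gen V) ≠ ⟨(j, k), hjk⟩ := by
      intro h; simp only [Subtype.mk.injEq, Prod.mk.injEq] at h; exact hij h.1
    have hae : (⟨(i, j), hij⟩ : Gen V) ≠ ⟨(i, k), hik⟩ := by
      intro h; simp only [Subtype.mk.injEq, Prod.mk.injEq] at h; exact hjk h.2
    have hbe : (⟨(j, k), hjk⟩ : Gen V) ≠ ⟨(i, k), hik⟩ := by
      intro h; simp only [Subtype.mk.injEq, Prod.mk.injEq] at h; exact hij h.1.symm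
    have hrel := boundary_triangle hij hjk hik
    refine ⟨_, hℬ.reduce hab hae hbe hrel, reduction_fanPoly hℬ.card_le
      fun A hA ha hb B hB => hℬ.not_mem hae hbe hrel hA ha hb hB, fun B hB => ?_⟩
    obtain ⟨A, hA, h1⟩ := hℬ.reduce_cone hab hae hbe hrel hB
    obtain ⟨A', hA', h2⟩ := hcone A hA
    refine ⟨A', hA', fun c hc h0 => ?_⟩
    obtain ⟨c', hc', h0', hb'⟩ := h1 c hc h0
    rw [← hb']
    exact h2 c' hc' h0'

end Reductions

theorem finrank_map_add_finrank_inf_ker {X Y : Type*} [AddCommGroup X] [Module ℝ X]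
    [FiniteDimensional ℝ X] [AddCommGroup Y] [Module ℝ Y] (f : X →ₗ[ℝ] Y) (p : Submodule ℝ X) :
    Module.finrank ℝ (p.map f) + Module.finrank ℝ (p ⊓ LinearMap.ker f : Submodule ℝ X)
      = Module.finrank ℝ p := by
  have h := LinearMap.finrank_range_add_finrank_ker (f.domRestrict p)
  rw [LinearMap.range_domRestrict, LinearMap.ker_domRestrict] at h
  rw [← h, ← Submodule.map_comap_subtype, Submodule.finrank_map_subtype_eq]

/-! ### End values, net vectors and the cells of a cone -/

section Ends

variable {V : Type} [Fintype V] [DecidableEq V] (I J : Finset V)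

/-- The index set of the source edges and of the sink edges. -/
abbrev Ends : Type := {i // i ∈ I} ⊕ {j // j ∈ J}

/-- The netflow at the inner vertices that is prescribed by the values on source and sink edges. -/
noncomputable def netMap : (Ends I J → ℝ) →ₗ[ℝ] (V → ℝ) where
  toFun x v := (if h : v ∈ I then x (.inl ⟨v, h⟩) else 0) - (if h : v ∈ J then x (.inr ⟨v, h⟩) else 0)
  map_add' x y := by ext v; by_cases h : v ∈ I <;> by_cases h' : v ∈ J <;> simp [h, h'] <;> ring
  map_smul' r x := by ext v; by_cases h : v ∈ I <;> by_cases h' : v ∈ J <;> simp [h, h', mul_sub]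

theorem netMap_apply (x : Ends I J → ℝ) (v : V) : netMap I J x v =
    (if h : v ∈ I then x (.inl ⟨v, h⟩) else 0) - (if h : v ∈ J then x (.inr ⟨v, h⟩) else 0) := rfl

theorem sum_dite_mem_mul (A : Finset V) (F : V → ℝ) (x : {i // i ∈ A} → ℝ) :
    ∑ v, F v * (if h : v ∈ A then x ⟨v, h⟩ else 0) = ∑ i, F i.1 * x i := by
  rw [← Finset.sum_subset (Finset.subset_univ A), ← Finset.sum_coe_sort]
  · exact Finset.sum_congr rfl fun i _ => by rw [dif_pos i.2]
  · intro v _ hv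
    rw [dif_neg hv, mul_zero]

theorem sum_mul_netMap (F : V → ℝ) (x : Ends I J → ℝ) : ∑ v, F v * netMap I J x v
    = ∑ i : {i // i ∈ I}, F i.1 * x (.inl i) - ∑ j : {j // j ∈ J}, F j.1 * x (.inr j) := by
  simp only [netMap_apply, mul_sub, Finset.sum_sub_distrib]
  rw [← sum_dite_mem_mul I F fun i => x (.inl i), ← sum_dite_mem_mul J F fun i => x (.inr i)]

theorem sum_netMap (x : Ends I J → ℝ) :
    ∑ v, netMap I J x v = ∑ i, x (.inl i) - ∑ j, x (.inr j) := by
  simpa using sum_mul_netMap I J (fun _ => 1) x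

/-- The product of the standard simplices on `I` and on `J`. -/
def endsPolytope : Set (Ends I J → ℝ) :=
  {x | (∀ k, 0 ≤ x k) ∧ ∑ i, x (.inl i) = 1 ∧ ∑ j, x (.inr j) = 1}

/-- The net vectors of interior points of multiples of `endsPolytope`. -/
def openNets : Set (V → ℝ) :=
  {d | ∑ v, d v = 0 ∧ (∀ v ∈ I, v ∉ J → 0 < d v) ∧ ∀ v ∈ J, v ∉ I → d v < 0}

/-- The net vectors of points of multiples of `endsPolytope`. -/
def closedNets : Set (V → ℝ) :=
  {d | ∑ v, d v = 0 ∧ (∀ v ∈ I, v ∉ J → 0 ≤ d v) ∧ ∀ v ∈ J, v ∉ I → d v ≤ 0}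

variable {I J}

theorem sum_netMap_of_mem {x : Ends I J → ℝ} (hx : x ∈ endsPolytope I J) :
    ∑ v, netMap I J x v = 0 := by
  rw [sum_netMap, hx.2.1, hx.2.2, sub_self]

theorem netMap_mem_closedNets {x : Ends I J → ℝ} (hx : x ∈ endsPolytope I J) :
    netMap I J x ∈ closedNets I J := by
  refine ⟨sum_netMap_of_mem hx, fun v hv hv' => ?_, fun v hv hv' => ?_⟩
  · simpa [netMap_apply, hv, hv'] using hx.1 _
  · simpa [netMap_apply, hv, hv'] using hx.1 _

theorem netMap_mem_openNets {x : Ends I J → ℝ} (hx : x ∈ endsPolytope I J) (hpos : ∀ k, 0 < x k) :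
    netMap I J x ∈ openNets I J := by
  refine ⟨sum_netMap_of_mem hx, fun v hv hv' => ?_, fun v hv hv' => ?_⟩
  · simpa [netMap_apply, hv, hv'] using hpos _
  · simpa [netMap_apply, hv, hv'] using hpos _

/-- The positive part of d is put on the source edges and its negative part on the sink edges. Both
have the same total; after scaling, the missing mass is added at the vertices of I ∩ J, where it
cancels in the net vector. -/
theorem exists_pos_mem_endsPolytope (hIJ : (I ∩ J).Nonempty) (hV : ∀ v, v ∈ I ∨ v ∈ J)
    {d : V → ℝ} (hd : d ∈ openNets I J) :
    ∃ x ∈ endsPolytope I J, (∀ k, 0 < x k) ∧ ∃ ε > (0 : ℝ), netMap I J x = ε • d := by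
  obtain ⟨h0, hI, hJ⟩ := hd
  set D : ℝ := ∑ v, max (d v) 0 with hD
  have hD0 : 0 ≤ D := Finset.sum_nonneg fun v _ => le_max_right _ _
  have hD' : ∑ v, max (-d v) 0 = D := by
    have : ∀ v, max (-d v) 0 = max (d v) 0 - d v := fun v => by
      rcases le_total 0 (d v) with h | h <;> simp [h]
    simp only [this, Finset.sum_sub_distrib, h0, sub_zero, hD]
  -- Chosen so that the missing mass 1 - εD equals ε and is therefore positive.
  set ε : ℝ := 1 / (1 + D) with hε
  have hε0 : 0 < ε := by positivity
  have hcard : (0 : ℝ) < (I ∩ J).card := by exact_mod_cast hIJ.card_pos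
  -- The share of each vertex of I ∩ J in the missing mass, used on its source edge and on its sink
  -- edge.
  set c : ℝ := (1 - ε * D) / (I ∩ J).card with hc
  have hc1 : 1 - ε * D = ε := by rw [hε]; field_simp; ring
  have hc0 : 0 < c := by rw [hc, hc1]; positivity
  have hcw : (I ∩ J).card * c = 1 - ε * D := by rw [hc]; field_simp
  have hDI : ∑ v ∈ I, max (d v) 0 = D := by
    refine Finset.sum_subset (Finset.subset_univ _) fun v _ hv => ?_
    exact max_eq_right (hJ v ((hV v).resolve_left hv) hv).le
  have hDJ : ∑ v ∈ J, max (-d v) 0 = D := by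
    rw [← hD']
    refine Finset.sum_subset (Finset.subset_univ _) fun v _ hv => ?_
    have := hI v ((hV v).resolve_right hv) hv
    exact max_eq_right (by linarith)
  have hsI : ∑ v ∈ I, (ε * max (d v) 0 + if v ∈ J then c else 0) = 1 := by
    rw [Finset.sum_add_distrib, ← Finset.mul_sum, hDI, ← Finset.sum_filter,
      Finset.filter_mem_eq_inter, Finset.sum_const, nsmul_eq_mul, hcw]
    ring
  have hsJ : ∑ v ∈ J, (ε * max (-d v) 0 + if v ∈ I then c else 0) = 1 := by
    rw [Finset.sum_add_distrib, ← Finset.mul_sum, hDJ, ← Finset.sum_filter,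
      Finset.filter_mem_eq_inter, Finset.inter_comm, Finset.sum_const, nsmul_eq_mul, hcw]
    ring
  have hpos : ∀ k : Ends I J, 0 < (Sum.elim (fun i : {i // i ∈ I} =>
      ε * max (d i) 0 + if i.1 ∈ J then c else 0) (fun j : {j // j ∈ J} =>
      ε * max (-d j) 0 + if j.1 ∈ I then c else 0) k : ℝ) := by
    rintro (⟨v, hv⟩ | ⟨v, hv⟩)
    · simp only [Sum.elim_inl]
      split_ifs with h
      · positivity
      · have := hI v hv h
        rw [max_eq_left this.le, add_zero]; positivity
    · simp only [Sum.elim_inr]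
      split_ifs with h
      · positivity
      · have := hJ v hv h
        rw [max_eq_left (by linarith), add_zero]
        exact mul_pos hε0 (by linarith)
  refine ⟨_, ⟨fun k => (hpos k).le, ?_, ?_⟩, hpos, ε, hε0, ?_⟩
  · simp only [Sum.elim_inl]
    rw [Finset.sum_coe_sort I fun v => ε * max (d v) 0 + if v ∈ J then c else 0, hsI]
  · simp only [Sum.elim_inr]
    rw [Finset.sum_coe_sort J fun v => ε * max (-d v) 0 + if v ∈ I then c else 0, hsJ]
  · ext v
    have hmax : max (d v) 0 - max (-d v) 0 = d v := by
      rcases le_total 0 (d v) with h | h <;> simp [h]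
    simp only [netMap_apply, Pi.smul_apply, smul_eq_mul, Sum.elim_inl, Sum.elim_inr]
    by_cases h1 : v ∈ I <;> by_cases h2 : v ∈ J
    · simp only [h1, h2, dif_pos, if_true]
      linear_combination ε * hmax
    · have := hI v h1 h2
      simp [h1, h2, max_eq_left this.le]
    · have := hJ v h2 h1
      simp [h1, h2, max_eq_left (show 0 ≤ -d v by linarith)]
    · exact absurd (hV v) (by tauto)

/-- Put d on I and -d on the rest of J, then correct both totals at one vertex u of I ∩ J, where
equal changes at source and sink cancel. -/
theorem exists_netMap_eq (hIJ : (I ∩ J).Nonempty) (hV : ∀ v, v ∈ I ∨ v ∈ J)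
    {d : V → ℝ} (hd : ∑ v, d v = 0) :
    ∃ x : Ends I J → ℝ, ∑ i, x (.inl i) = 0 ∧ ∑ j, x (.inr j) = 0 ∧ netMap I J x = d := by
  obtain ⟨u, hu⟩ := hIJ
  rw [Finset.mem_inter] at hu
  set s : ℝ := ∑ v ∈ I, d v with hs
  have hs' : ∑ v ∈ J, (if v ∈ I then 0 else -d v) = s := by
    have h1 : ∑ v ∈ J, (if v ∈ I then 0 else -d v) = ∑ v, (if v ∈ I then 0 else -d v) := by
      refine Finset.sum_subset (Finset.subset_univ _) fun v _ hv => ?_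
      rw [if_pos ((hV v).resolve_right hv)]
    have h2 : ∀ v, (if v ∈ I then 0 else -d v) = (if v ∈ I then d v else 0) - d v := fun v => by
      split_ifs <;> ring
    rw [h1]
    simp only [h2]
    rw [Finset.sum_sub_distrib, hd, sub_zero, ← Finset.sum_filter, hs]
    simp
  refine ⟨Sum.elim (fun i => d i - if i.1 = u then s else 0)
    (fun j => (if j.1 ∈ I then 0 else -d j) - if j.1 = u then s else 0), ?_, ?_, ?_⟩
  · simp only [Sum.elim_inl]
    rw [Finset.sum_coe_sort I fun v => d v - if v = u then s else 0, Finset.sum_sub_distrib,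
      Finset.sum_ite_eq', if_pos hu.1, sub_self]
  · simp only [Sum.elim_inr]
    rw [Finset.sum_coe_sort J fun v => (if v ∈ I then 0 else -d v) - if v = u then s else 0,
      Finset.sum_sub_distrib, Finset.sum_ite_eq', if_pos hu.2, hs', sub_self]
  · ext v
    have hJ : v ∉ J → v ≠ u := by rintro h rfl; exact h hu.2
    have hI : v ∉ I → v ≠ u := by rintro h rfl; exact h hu.1
    simp only [netMap_apply, Sum.elim_inl, Sum.elim_inr]
    by_cases h1 : v ∈ I <;> by_cases h2 : v ∈ J
    · simp [h1, h2]
    · simp [h1, h2, hJ h2]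
    · simp [h1, h2, hI h1]
    · exact absurd (hV v) (by tauto)

variable (I J)

/-- The points of `endsPolytope` whose net vector is a nonnegative combination of the edges in `A`,
with all coordinates in `T` equal to zero. -/
def coneFace (A : Finset (Gen V)) (T : Set (Ends I J ⊕ Gen V)) : Set (Ends I J → ℝ) :=
  {x ∈ endsPolytope I J | ∃ c ∈ supportedIn A, 0 ≤ c ∧ boundary c = netMap I J x ∧
    ∀ t ∈ T, Sum.elim x c t = 0}

variable {I J} {N : ℕ} {𝒜 : Finset (Finset (Gen V))} {W W' : Set (V → ℝ)}

theorem coneFace_mono {A : Finset (Gen V)} {T T' : Set (Ends I J ⊕ Gen V)} (h : T ⊆ T') :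
    coneFace I J A T' ⊆ coneFace I J A T := fun _ ⟨hx, c, hc, h0, hb, hT⟩ =>
  ⟨hx, c, hc, h0, hb, fun t ht => hT t (h ht)⟩

/-- By independence `boundary` has a linear left inverse on weightings supported in A, so the
weights become linear functions of the net vector. -/
theorem IsFan.exists_dual (h : IsFan W W' N 𝒜) {A : Finset (Gen V)} (hA : A ∈ 𝒜) :
    ∃ C : (V → ℝ) →ₗ[ℝ] (Gen V → ℝ), (∀ d, C d ∈ supportedIn A) ∧
      ∀ c ∈ supportedIn A, C (boundary c) = c := by
  obtain ⟨r, hr⟩ := LinearMap.exists_leftInverse_of_injective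
    ((boundary (V := V)).domRestrict (supportedIn A)) (by
      rw [LinearMap.ker_eq_bot']
      intro c hc
      exact Subtype.ext (h.indep hA c.2 hc))
  refine ⟨(supportedIn A).subtype ∘ₗ r, fun d => (r d).2, fun c hc => ?_⟩
  have := LinearMap.congr_fun hr ⟨c, hc⟩
  simpa using congrArg Subtype.val this

/-- The weights of a point are the same for A and for B, so they vanish outside both graphs: the
intersection is cut out of the first cell by additional zero conditions. -/
theorem IsFan.coneFace_inter (h : IsFan W W' N 𝒜) {A B : Finset (Gen V)} (hA : A ∈ 𝒜) (hB : B ∈ 𝒜)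
    (T T' : Set (Ends I J ⊕ Gen V)) :
    coneFace I J A T ∩ coneFace I J B T'
      = coneFace I J A (T ∪ (T' ∪ Sum.inr '' {g | g ∉ B})) := by
  ext x
  constructor
  · rintro ⟨⟨hx, c, hc, h0, hb, hT⟩, ⟨-, c', hc', h0', hb', hT'⟩⟩
    obtain rfl := h.inj A hA B hB c hc c' hc' h0 h0' (hb.trans hb'.symm)
    refine ⟨hx, c, hc, h0, hb, ?_⟩
    rintro t (ht | ht | ⟨g, hg, rfl⟩)
    · exact hT t ht
    · exact hT' t ht
    · exact hc' g hg
  · rintro ⟨hx, c, hc, h0, hb, hT⟩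
    exact ⟨⟨hx, c, hc, h0, hb, fun t ht => hT t (Or.inl ht)⟩, hx, c,
      fun g hg => hT (.inr g) (Or.inr (Or.inr ⟨g, hg, rfl⟩)), h0, hb,
      fun t ht => hT t (Or.inr (Or.inl ht))⟩

end Ends

/-! ### Subdivisions obtained from fans in a linear realization -/

section Realization

variable {V : Type} [Fintype V] [DecidableEq V] {I J : Finset V} {κ : Type} [Fintype κ]
  {N : ℕ} {𝒜 : Finset (Finset (Gen V))} {W W' : Set (V → ℝ)}

/-- The coordinates of a point of a realization: the values on source and sink edges and the
weights of the edges. -/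
noncomputable def coordMap (g : (κ → ℝ) →ₗ[ℝ] (Ends I J → ℝ)) (C : (V → ℝ) →ₗ[ℝ] (Gen V → ℝ)) :
    Ends I J ⊕ Gen V → (κ → ℝ) →ᵃ[ℝ] ℝ
  | .inl k => (LinearMap.proj k ∘ₗ g).toAffineMap
  | .inr e => (LinearMap.proj e ∘ₗ C ∘ₗ netMap I J ∘ₗ g).toAffineMap

theorem coordMap_apply (g : (κ → ℝ) →ₗ[ℝ] (Ends I J → ℝ)) (C : (V → ℝ) →ₗ[ℝ] (Gen V → ℝ))
    (t : Ends I J ⊕ Gen V) (y : κ → ℝ) :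
    coordMap g C t y = Sum.elim (g y) (C (netMap I J (g y))) t := by
  cases t <;> rfl

/-- The affine span of the realization of a cone face, cut out by the equations that define it. -/
noncomputable def faceSpace (f : (Ends I J → ℝ) →ₗ[ℝ] (κ → ℝ)) (g : (κ → ℝ) →ₗ[ℝ] (Ends I J → ℝ))
    (C : (V → ℝ) →ₗ[ℝ] (Gen V → ℝ)) (T : Set (Ends I J ⊕ Gen V)) : AffineSubspace ℝ (κ → ℝ) where
  carrier := {y | f (g y) = y ∧ ∑ i, g y (.inl i) = 1 ∧ ∑ j, g y (.inr j) = 1 ∧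
    boundary (C (netMap I J (g y))) = netMap I J (g y) ∧
    ∀ t ∈ T, Sum.elim (g y) (C (netMap I J (g y))) t = 0}
  smul_vsub_vadd_mem' := by
    rintro r x y z ⟨hx1, hx2, hx3, hx4, hx5⟩ ⟨hy1, hy2, hy3, hy4, hy5⟩ ⟨hz1, hz2, hz3, hz4, hz5⟩
    refine ⟨?_, ?_, ?_, ?_, fun t ht => ?_⟩
    · simp [hx1, hy1, hz1]
    · simp [-Finset.univ_eq_attach, Finset.sum_add_distrib, ← Finset.mul_sum, hx2, hy2, hz2]
    · simp [-Finset.univ_eq_attach, Finset.sum_add_distrib, ← Finset.mul_sum, hx3, hy3, hz3]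
    · simp [hx4, hy4, hz4]
    · have h1 := hx5 t ht
      have h2 := hy5 t ht
      have h3 := hz5 t ht
      cases t <;> simp only [Sum.elim_inl, Sum.elim_inr] at * <;> simp [h1, h2, h3]

variable {f : (Ends I J → ℝ) →ₗ[ℝ] (κ → ℝ)} {g : (κ → ℝ) →ₗ[ℝ] (Ends I J → ℝ)}

/-- The dual map `C` makes the weights linear functions of the point. This removes the existential
quantifier over c, so the results on polyhedra given by inequalities apply. -/
theorem image_coneFace (hgf : ∀ x, g (f x) = x) {A : Finset (Gen V)}
    {C : (V → ℝ) →ₗ[ℝ] (Gen V → ℝ)} (hC : ∀ d, C d ∈ supportedIn A)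
    (hC' : ∀ c ∈ supportedIn A, C (boundary c) = c) (T : Set (Ends I J ⊕ Gen V)) :
    f '' coneFace I J A T = hset (faceSpace f g C T) (coordMap g C) := by
  ext y
  constructor
  · rintro ⟨x, ⟨hx, c, hc, h0, hb, hT⟩, rfl⟩
    have h1 : C (netMap I J x) = c := by rw [← hb, hC' c hc]
    refine ⟨?_, fun t => ?_⟩
    · change _ ∧ _
      simp only [hgf, h1]
      exact ⟨trivial, hx.2.1, hx.2.2, hb, hT⟩
    · rw [coordMap_apply, hgf, h1]
      rcases t with k | e
      · exact hx.1 k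
      · exact h0 e
  · rintro ⟨⟨h1, h2, h3, h4, h5⟩, h6⟩
    simp only [coordMap_apply] at h6
    exact ⟨g y, ⟨⟨fun k => h6 (.inl k), h2, h3⟩, _, hC _, fun e => h6 (.inr e), h4, h5⟩, h1⟩

theorem image_coneFace_union (hgf : ∀ x, g (f x) = x) {A : Finset (Gen V)}
    {C : (V → ℝ) →ₗ[ℝ] (Gen V → ℝ)} (hC : ∀ d, C d ∈ supportedIn A)
    (hC' : ∀ c ∈ supportedIn A, C (boundary c) = c) (T T' : Set (Ends I J ⊕ Gen V)) :
    f '' coneFace I J A (T ∪ T') = {y ∈ hset (faceSpace f g C T) (coordMap g C) |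
      ∀ t ∈ T', coordMap g C t y = 0} := by
  rw [image_coneFace hgf hC hC']
  ext y
  simp only [hset, mem_ofPred_eq, coordMap_apply]
  constructor
  · rintro ⟨⟨h1, h2, h3, h4, h5⟩, h6⟩
    exact ⟨⟨⟨h1, h2, h3, h4, fun t ht => h5 t (Or.inl ht)⟩, h6⟩, fun t ht => h5 t (Or.inr ht)⟩
  · rintro ⟨⟨⟨h1, h2, h3, h4, h5⟩, h6⟩, h7⟩
    exact ⟨⟨h1, h2, h3, h4, fun t ht => ht.elim (h5 t) (h7 t)⟩, h6⟩

theorem IsFan.exposed_coneFace (h : IsFan W W' N 𝒜) (hgf : ∀ x, g (f x) = x) {A : Finset (Gen V)}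
    (hA : A ∈ 𝒜) {T : Set (Ends I J ⊕ Gen V)} {F : Set (κ → ℝ)}
    (hF : IsExposed ℝ (f '' coneFace I J A T) F) (hne : F.Nonempty) :
    ∃ T', F = f '' coneFace I J A (T ∪ T') := by
  obtain ⟨C, hC, hC'⟩ := h.exists_dual hA
  rw [image_coneFace hgf hC hC'] at hF
  obtain ⟨T', rfl⟩ := hF.eq_zero_set hne
  exact ⟨T', (image_coneFace_union hgf hC hC' T T').symm⟩

theorem IsFan.isExposed_coneFace (h : IsFan W W' N 𝒜) (hgf : ∀ x, g (f x) = x)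
    {A : Finset (Gen V)} (hA : A ∈ 𝒜) (T T' : Set (Ends I J ⊕ Gen V)) :
    IsExposed ℝ (f '' coneFace I J A T) (f '' coneFace I J A (T ∪ T')) := by
  obtain ⟨C, hC, hC'⟩ := h.exists_dual hA
  rw [image_coneFace_union hgf hC hC', image_coneFace hgf hC hC']
  exact isExposed_zero_set T'

theorem isCompact_endsPolytope : IsCompact (endsPolytope I J) := by
  refine Metric.isCompact_of_isClosed_isBounded ?_ ?_
  · have : endsPolytope I J = (⋂ k, {x | 0 ≤ x k}) ∩ ({x | ∑ i, x (.inl i) = 1} ∩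
        {x | ∑ j, x (.inr j) = 1}) := by
      ext x; simp [endsPolytope]
    rw [this]
    refine (isClosed_iInter fun k => isClosed_le continuous_const (continuous_apply k)).inter
      ((isClosed_eq (by fun_prop) continuous_const).inter (isClosed_eq (by fun_prop) continuous_const))
  · refine (Metric.isBounded_Icc (0 : Ends I J → ℝ) 1).subset fun x hx => ⟨hx.1, ?_⟩
    rintro (i | j)
    · rw [Pi.one_apply, ← hx.2.1]
      exact Finset.single_le_sum (f := fun i => x (.inl i)) (fun i _ => hx.1 _) (Finset.mem_univ i)
    · rw [Pi.one_apply, ← hx.2.2]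
      exact Finset.single_le_sum (f := fun i => x (.inr i)) (fun i _ => hx.1 _) (Finset.mem_univ j)

theorem isCompact_hset_faceSpace (hgf : ∀ x, g (f x) = x) {A : Finset (Gen V)}
    {C : (V → ℝ) →ₗ[ℝ] (Gen V → ℝ)} (hC : ∀ d, C d ∈ supportedIn A)
    (hC' : ∀ c ∈ supportedIn A, C (boundary c) = c) (T : Set (Ends I J ⊕ Gen V)) :
    IsCompact (hset (faceSpace f g C T) (coordMap g C)) := by
  refine (isCompact_endsPolytope.image f.continuous_of_finiteDimensional).of_isClosed_subset
    isClosed_hset ?_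
  rw [← image_coneFace hgf hC hC']
  exact image_mono fun x hx => hx.1

/-- The faces of the realizations of the cones of `𝒜`. -/
def fanFaces (f : (Ends I J → ℝ) →ₗ[ℝ] (κ → ℝ)) (𝒜 : Finset (Finset (Gen V))) :
    Set (Set (κ → ℝ)) :=
  {F | F.Nonempty ∧ ∃ A ∈ 𝒜, ∃ T, F = f '' coneFace I J A T}

theorem IsFan.fanFaces_eq (h : IsFan W W' N 𝒜) (hgf : ∀ x, g (f x) = x) :
    fanFaces f 𝒜 = {F | F.Nonempty ∧ ∃ A ∈ 𝒜, IsExposed ℝ (f '' coneFace I J A ∅) F} := by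
  ext F
  refine and_congr_right fun hne => exists_congr fun A => and_congr_right fun hA => ⟨?_, fun hF => ?_⟩
  · rintro ⟨T, rfl⟩
    simpa using h.isExposed_coneFace hgf hA ∅ T
  · obtain ⟨T, hT⟩ := h.exposed_coneFace hgf hA hF hne
    exact ⟨_, hT⟩

/-- Both faces and intersections of cells arise by adding coordinates to the zero set T, and
covering is the covering property of the closed cones. -/
theorem IsFan.isSubdivision (h : IsFan W (closedNets I J) N 𝒜) (hgf : ∀ x, g (f x) = x) :
    IsSubdivision (f '' endsPolytope I J) (fanFaces f 𝒜) where
  finite := by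
    refine (Set.toFinite (Set.image2 (fun A T => f '' coneFace I J A T) (𝒜 : Set (Finset (Gen V)))
      (univ : Set (Set (Ends I J ⊕ Gen V))))).subset ?_
    rintro F ⟨-, A, hA, T, rfl⟩
    exact ⟨A, hA, T, mem_univ _, rfl⟩
  polytope := by
    rintro F ⟨hne, A, hA, T, rfl⟩
    obtain ⟨C, hC, hC'⟩ := h.exists_dual hA
    rw [image_coneFace hgf hC hC'] at hne ⊢
    have hconv := convexHull_extremePoints_hset (isCompact_hset_faceSpace hgf hC hC' T)
    refine ⟨(finite_extremePoints_hset (S := faceSpace f g C T) (g := coordMap g C)).toFinset, ?_, ?_⟩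
    · rw [← hconv, convexHull_nonempty_iff] at hne
      simpa using hne
    · simp [hconv]
  face_mem := by
    rintro F ⟨-, A, hA, T, rfl⟩ F' hne hF'
    obtain ⟨T', rfl⟩ := h.exposed_coneFace hgf hA hF' hne
    exact ⟨hne, A, hA, _, rfl⟩
  inter_face := by
    rintro F ⟨-, A, hA, T, rfl⟩ F' ⟨-, B, hB, T', rfl⟩
    rw [← image_inter (Function.LeftInverse.injective hgf), h.coneFace_inter hA hB]
    exact h.isExposed_coneFace hgf hA _ _
  sUnion_eq := by
    refine Subset.antisymm (sUnion_subset ?_) ?_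
    · rintro F ⟨-, A, hA, T, rfl⟩
      exact image_mono fun x hx => hx.1
    · rintro _ ⟨x, hx, rfl⟩
      obtain ⟨A, hA, c, hc, h0, hb⟩ := h.covers _ (netMap_mem_closedNets hx)
      have hmem : x ∈ coneFace I J A ∅ := ⟨hx, c, hc, h0, hb, by simp⟩
      exact ⟨_, ⟨⟨_, mem_image_of_mem f hmem⟩, A, hA, ∅, rfl⟩, mem_image_of_mem f hmem⟩

/-- Weight 1 on every edge of A gives a net vector in the open region, which is then scaled into the
polytope. -/
theorem IsFan.exists_interior_point (h : IsFan (openNets I J) W' N 𝒜) (hIJ : (I ∩ J).Nonempty)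
    (hV : ∀ v, v ∈ I ∨ v ∈ J) {A : Finset (Gen V)} (hA : A ∈ 𝒜) :
    ∃ x ∈ endsPolytope I J, (∀ k, 0 < x k) ∧
      ∃ c ∈ supportedIn A, (∀ e ∈ A, 0 < c e) ∧ boundary c = netMap I J x := by
  classical
  have hc1 : (fun e => if e ∈ A then (1 : ℝ) else 0) ∈ supportedIn A := fun e he => if_neg he
  have hd := h.pos A hA _ hc1 fun e he => by simp [he]
  obtain ⟨x, hx, hpos, ε, hε, hnet⟩ := exists_pos_mem_endsPolytope hIJ hV hd
  refine ⟨x, hx, hpos, ε • _, (supportedIn A).smul_mem ε hc1, fun e he => ?_, ?_⟩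
  · simpa [he] using hε
  · rw [map_smul, hnet]

theorem supportedIn_nonneg {A : Finset (Gen V)} {c : Gen V → ℝ} (hc : c ∈ supportedIn A)
    (hp : ∀ e ∈ A, 0 < c e) : 0 ≤ c := fun e => by
  by_cases he : e ∈ A
  · exact (hp e he).le
  · exact (hc e he).ge

theorem image_endsPolytope (hgf : ∀ x, g (f x) = x) : ∃ S : AffineSubspace ℝ (κ → ℝ),
    f '' endsPolytope I J
      = hset S fun k : Ends I J => (LinearMap.proj k ∘ₗ g : (κ → ℝ) →ₗ[ℝ] ℝ).toAffineMap := by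
  refine ⟨{ carrier := {y | f (g y) = y ∧ ∑ i, g y (.inl i) = 1 ∧ ∑ j, g y (.inr j) = 1}
            smul_vsub_vadd_mem' := ?_ }, ?_⟩
  · rintro r x y z ⟨hx1, hx2, hx3⟩ ⟨hy1, hy2, hy3⟩ ⟨hz1, hz2, hz3⟩
    refine ⟨?_, ?_, ?_⟩
    · simp [hx1, hy1, hz1]
    · simp [-Finset.univ_eq_attach, Finset.sum_add_distrib, ← Finset.mul_sum, hx2, hy2, hz2]
    · simp [-Finset.univ_eq_attach, Finset.sum_add_distrib, ← Finset.mul_sum, hx3, hy3, hz3]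
  · ext y
    constructor
    · rintro ⟨x, hx, rfl⟩
      refine ⟨?_, fun k => ?_⟩
      · change _ ∧ _
        rw [hgf]
        exact ⟨rfl, hx.2⟩
      · change 0 ≤ g (f x) k
        rw [hgf]
        exact hx.1 k
    · rintro ⟨⟨h1, h2⟩, h3⟩
      exact ⟨g y, ⟨h3, h2⟩, h1⟩

theorem mem_intrinsicFrontier_image (hgf : ∀ x, g (f x) = x) {u x : Ends I J → ℝ}
    (hu : u ∈ endsPolytope I J) (hupos : ∀ k, 0 < u k) (hx : x ∈ endsPolytope I J) :
    f x ∈ intrinsicFrontier ℝ (f '' endsPolytope I J) ↔ ∃ k, x k = 0 := by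
  obtain ⟨S, hS⟩ := image_endsPolytope (I := I) (J := J) hgf
  have hu' := mem_image_of_mem f hu
  have hx' := mem_image_of_mem f hx
  rw [hS] at hu' hx' ⊢
  rw [mem_intrinsicFrontier_hset hu' (fun k => ?_) hx']
  · refine exists_congr fun k => ?_
    change g (f x) k = 0 ↔ _
    rw [hgf]
  · change 0 < g (f u) k
    rw [hgf]
    exact hupos k

/-- A face outside the relative boundary contains a point with positive end values and fewest zero
coordinates. The net vector of that point lies in one open cone, and the face is the whole cell of
this cone. -/
theorem IsFan.bijOn_innerFaces (h : IsFan (openNets I J) (closedNets I J) N 𝒜)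
    (hIJ : (I ∩ J).Nonempty) (hV : ∀ v, v ∈ I ∨ v ∈ J) (hgf : ∀ x, g (f x) = x) :
    BijOn (fun A => f '' coneFace I J A ∅) (𝒜 : Set (Finset (Gen V)))
      (innerFaces (f '' endsPolytope I J) (fanFaces f 𝒜)) := by
  have hinj : Function.Injective f := Function.LeftInverse.injective hgf
  refine ⟨fun A hA => ?_, fun A hA B hB hAB => ?_, ?_⟩
  · obtain ⟨x, hx, hpos, c, hc, hcpos, hb⟩ := h.exists_interior_point hIJ hV hA
    have hmem : f x ∈ f '' coneFace I J A ∅ :=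
      mem_image_of_mem f ⟨hx, c, hc, supportedIn_nonneg hc hcpos, hb, by simp⟩
    refine ⟨⟨⟨_, hmem⟩, A, hA, ∅, rfl⟩, fun hsub => ?_⟩
    obtain ⟨k, hk⟩ := (mem_intrinsicFrontier_image hgf hx hpos hx).1 (hsub hmem)
    exact (hpos k).ne' hk
  · have key : ∀ A ∈ 𝒜, ∀ B ∈ 𝒜, f '' coneFace I J A ∅ = f '' coneFace I J B ∅ → A ⊆ B := by
      intro A hA B hB hAB e he
      obtain ⟨x, hx, hpos, c, hc, hcpos, hb⟩ := h.exists_interior_point hIJ hV hA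
      have hmem : f x ∈ f '' coneFace I J A ∅ :=
        mem_image_of_mem f ⟨hx, c, hc, supportedIn_nonneg hc hcpos, hb, by simp⟩
      rw [hAB, hinj.mem_set_image] at hmem
      obtain ⟨-, c', hc', h0', hb', -⟩ := hmem
      obtain rfl := h.inj A hA B hB c hc c' hc' (supportedIn_nonneg hc hcpos) h0' (hb.trans hb'.symm)
      by_contra hne
      exact (hcpos e he).ne' (hc' e hne)
    exact Finset.Subset.antisymm (key A hA B hB hAB) (key B hB A hA hAB.symm)
  · rintro F ⟨⟨hne, A, hA, T, rfl⟩, hfr⟩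
    obtain ⟨C, hC, hC'⟩ := h.exists_dual hA
    obtain ⟨u, hu, hupos, -⟩ := h.exists_interior_point hIJ hV hA
    obtain ⟨_, ⟨x, ⟨hx, c, hc, h0, hb, hT⟩, rfl⟩, hmax⟩ :=
      exists_maximal_support (g := coordMap g C) (F := f '' coneFace I J A T)
        (by rw [image_coneFace hgf hC hC']; exact convex_hset) hne
        (by rw [image_coneFace hgf hC hC']; exact fun y hy => hy.2)
    simp only [coordMap_apply, hgf, forall_mem_image] at hmax
    have hCx : C (netMap I J x) = c := by rw [← hb, hC' c hc]
    rw [hCx] at hmax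
    -- An end value that vanishes at x vanishes on the whole face, which would then lie in the
    -- relative boundary.
    have hxpos : ∀ k, 0 < x k := by
      intro k
      refine (hx.1 k).lt_of_ne' fun hk => hfr ?_
      rintro _ ⟨y, hy, rfl⟩
      exact (mem_intrinsicFrontier_image hgf hu hupos hy.1).2 ⟨k, hmax (.inl k) hk hy⟩
    -- By uniqueness of weights, the graph B of the open cone through the net vector of x is the
    -- support of c.
    obtain ⟨B, hB, c', hc', hcpos', hb'⟩ := h.covers_open _ (netMap_mem_openNets hx hxpos)
    obtain rfl := h.inj A hA B hB c hc c' hc' h0 (supportedIn_nonneg hc' hcpos') (hb.trans hb'.symm)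
    have hBA : B ⊆ A := fun e he => by
      by_contra hne
      exact (hcpos' e he).ne' (hc e hne)
    refine ⟨B, hB, ?_⟩
    change f '' _ = f '' _
    congr 1
    ext y
    constructor
    · rintro ⟨hy, cy, hcy, hy0, hby, -⟩
      refine ⟨hy, cy, supportedIn_mono hBA hcy, hy0, hby, ?_⟩
      rintro (k | e) ht
      · exact absurd (hT _ ht) (hxpos k).ne'
      · exact hcy e fun he => (hcpos' e he).ne' (hT _ ht)
    · rintro ⟨hy, cy, hcy, hy0, hby, hTy⟩
      refine ⟨hy, cy, fun e he => ?_, hy0, hby, by simp⟩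
      have := hmax (.inr e) (hc' e he) ⟨hy, cy, hcy, hy0, hby, hTy⟩
      rwa [← hby, hC' cy hcy] at this

theorem IsFan.fanFaces_refines {ℬ : Finset (Finset (Gen V))} (hℬ : ∀ B ∈ ℬ, ∃ A ∈ 𝒜,
    ∀ c ∈ supportedIn B, 0 ≤ c → ∃ c' ∈ supportedIn A, 0 ≤ c' ∧ boundary c' = boundary c) :
    Refines (fanFaces f ℬ) (fanFaces f 𝒜) := by
  rintro F ⟨hne, B, hB, T, rfl⟩
  obtain ⟨A, hA, hcone⟩ := hℬ B hB
  have hsub : f '' coneFace I J B T ⊆ f '' coneFace I J A ∅ := by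
    refine image_mono ?_
    rintro x ⟨hx, c, hc, h0, hb, -⟩
    obtain ⟨c', hc', h0', hb'⟩ := hcone c hc h0
    exact ⟨hx, c', hc', h0', hb'.trans hb, by simp⟩
  exact ⟨_, ⟨hne.mono hsub, A, hA, ∅, rfl⟩, hsub⟩

end Realization

/-! ### Dimensions and codimensions of cells -/

section Dimension

variable {V : Type} [Fintype V] [DecidableEq V] (I J : Finset V)

/-- The direction of the affine span of `endsPolytope`. -/
def endsDirection : Submodule ℝ (Ends I J → ℝ) where
  carrier := {x | ∑ i, x (.inl i) = 0 ∧ ∑ j, x (.inr j) = 0}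
  add_mem' := fun ⟨h1, h2⟩ ⟨h3, h4⟩ => by simp [-Finset.univ_eq_attach, Finset.sum_add_distrib, h1, h2, h3, h4]
  zero_mem' := by simp
  smul_mem' := fun r x ⟨h1, h2⟩ => by simp [-Finset.univ_eq_attach, ← Finset.mul_sum, h1, h2]

variable {I J}

theorem exists_nonneg_add_mul {τ : Type*} [Finite τ] {a b : τ → ℝ} (h : ∀ t, 0 ≤ a t)
    (hb : ∀ t, a t = 0 → 0 ≤ b t) : ∃ ε > (0 : ℝ), ∀ t, 0 ≤ a t + ε * b t := by
  have key : ∀ t, ∀ᶠ ε : ℝ in nhdsWithin 0 (Ioi 0), 0 ≤ a t + ε * b t := by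
    intro t
    rcases (h t).eq_or_lt with h0 | h0
    · filter_upwards [self_mem_nhdsWithin] with ε hε
      rw [← h0, zero_add]
      exact mul_nonneg (le_of_lt hε) (hb t h0.symm)
    · have : ContinuousAt (fun ε : ℝ => a t + ε * b t) 0 := by fun_prop
      have h1 := this.eventually (lt_mem_nhds (a := 0) (by simpa using h0))
      filter_upwards [nhdsWithin_le_nhds h1] with ε hε using le_of_lt hε
  obtain ⟨ε, h1, h2⟩ := ((Filter.eventually_all.2 key).and self_mem_nhdsWithin).exists
  exact ⟨ε, h2, h1⟩

theorem vectorSpan_endsPolytope {u : Ends I J → ℝ} (hu : u ∈ endsPolytope I J)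
    (hpos : ∀ k, 0 < u k) : vectorSpan ℝ (endsPolytope I J) = endsDirection I J := by
  refine le_antisymm ?_ fun d hd => ?_
  · rw [vectorSpan_def, Submodule.span_le]
    rintro _ ⟨x, hx, y, hy, rfl⟩
    exact ⟨by simp [-Finset.univ_eq_attach, hx.2.1, hy.2.1], by simp [-Finset.univ_eq_attach, hx.2.2, hy.2.2]⟩
  · obtain ⟨ε, hε, h⟩ := exists_nonneg_add_mul (fun k => (hpos k).le)
      (b := d) fun k hk => absurd hk (hpos k).ne'
    have hmem : u + ε • d ∈ endsPolytope I J := by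
      refine ⟨h, ?_, ?_⟩
      · simp [-Finset.univ_eq_attach, Finset.sum_add_distrib, ← Finset.mul_sum, hu.2.1, hd.1]
      · simp [-Finset.univ_eq_attach, Finset.sum_add_distrib, ← Finset.mul_sum, hu.2.2, hd.2]
    have := (vectorSpan ℝ (endsPolytope I J)).smul_mem ε⁻¹ (vsub_mem_vectorSpan ℝ hmem hu)
    simpa [smul_smul, hε.ne'] using this

/-- At u all end values and all weights on A are positive, so every direction compatible with the
linear equations can be followed for a short while inside the cell. -/
theorem vectorSpan_coneFace {A : Finset (Gen V)} {u : Ends I J → ℝ} (hu : u ∈ endsPolytope I J)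
    (hpos : ∀ k, 0 < u k) {c : Gen V → ℝ} (hc : c ∈ supportedIn A) (hcpos : ∀ e ∈ A, 0 < c e)
    (hb : boundary c = netMap I J u) : vectorSpan ℝ (coneFace I J A ∅)
      = endsDirection I J ⊓ ((supportedIn A).map boundary).comap (netMap I J) := by
  refine le_antisymm ?_ ?_
  · rw [vectorSpan_def, Submodule.span_le]
    rintro _ ⟨x, ⟨hx, cx, hcx, -, hbx, -⟩, y, ⟨hy, cy, hcy, -, hby, -⟩, rfl⟩
    refine ⟨⟨by simp [-Finset.univ_eq_attach, hx.2.1, hy.2.1], by simp [-Finset.univ_eq_attach, hx.2.2, hy.2.2]⟩, ?_⟩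
    exact ⟨cx - cy, (supportedIn A).sub_mem hcx hcy, by simp [hbx, hby]⟩
  · rintro d ⟨hd, cd, hcd, hbd⟩
    obtain ⟨ε, hε, h⟩ := exists_nonneg_add_mul (τ := Ends I J ⊕ Gen V) (a := Sum.elim u c)
      (b := Sum.elim d cd) (by
        rintro (k | e)
        · exact (hpos k).le
        · exact supportedIn_nonneg hc hcpos e) (by
        rintro (k | e) h0
        · exact absurd h0 (hpos k).ne'
        · by_cases he : e ∈ A
          · exact absurd h0 (hcpos e he).ne'
          · exact (hcd e he).ge)
    have hmem : u + ε • d ∈ coneFace I J A ∅ := by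
      refine ⟨⟨fun k => h (.inl k), ?_, ?_⟩, c + ε • cd,
        (supportedIn A).add_mem hc ((supportedIn A).smul_mem ε hcd), fun e => h (.inr e), ?_, by simp⟩
      · simp [-Finset.univ_eq_attach, Finset.sum_add_distrib, ← Finset.mul_sum, hu.2.1, hd.1]
      · simp [-Finset.univ_eq_attach, Finset.sum_add_distrib, ← Finset.mul_sum, hu.2.2, hd.2]
      · rw [map_add, map_smul, map_add, map_smul, hb, hbd]
    have humem : u ∈ coneFace I J A ∅ :=
      ⟨hu, c, hc, supportedIn_nonneg hc hcpos, hb, by simp⟩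
    have := (vectorSpan ℝ (coneFace I J A ∅)).smul_mem ε⁻¹ (vsub_mem_vectorSpan ℝ hmem humem)
    simpa [smul_smul, hε.ne'] using this

/-- Vectors with sum zero. -/
def sumZero (V : Type) [Fintype V] : Submodule ℝ (V → ℝ) where
  carrier := {d | ∑ v, d v = 0}
  add_mem' := fun {x y} (h1 : ∑ v, x v = 0) (h2 : ∑ v, y v = 0) => by
    simp [Finset.sum_add_distrib, h1, h2]
  zero_mem' := by simp
  smul_mem' := fun r x (h : ∑ v, x v = 0) => by simp [← Finset.mul_sum, h]

theorem finrank_sumZero (V : Type) [Fintype V] [Nonempty V] :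
    Module.finrank ℝ (sumZero V) + 1 = Fintype.card V := by
  classical
  let l : (V → ℝ) →ₗ[ℝ] ℝ := ∑ v, LinearMap.proj v
  have hl : ∀ d, l d = ∑ v, d v := fun d => by simp [l]
  have hker : LinearMap.ker l = sumZero V := by
    ext d; rw [LinearMap.mem_ker, hl]; rfl
  have hr : LinearMap.range l = ⊤ := by
    rw [LinearMap.range_eq_top]
    intro r
    obtain ⟨v⟩ := ‹Nonempty V›
    exact ⟨Pi.single v r, by rw [hl]; simp⟩
  have := l.finrank_range_add_finrank_ker
  rw [hker, hr, finrank_top, Module.finrank_self, Module.finrank_fintype_fun_eq_card] at this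
  omega

theorem finrank_supportedIn (A : Finset (Gen V)) : Module.finrank ℝ (supportedIn A) = A.card := by
  classical
  let e : supportedIn A ≃ₗ[ℝ] ({g // g ∈ A} → ℝ) :=
    { toFun := fun c g => c.1 g.1
      map_add' := fun _ _ => rfl
      map_smul' := fun _ _ => rfl
      invFun := fun c => ⟨fun g => if h : g ∈ A then c ⟨g, h⟩ else 0, fun g hg => dif_neg hg⟩
      left_inv := fun c => by
        ext g
        by_cases h : g ∈ A
        · simp [h]
        · simp [h, c.2 g h]
      right_inv := fun c => by ext g; simp }
  rw [e.finrank_eq, Module.finrank_fintype_fun_eq_card, Fintype.card_coe]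

/-- Under `netMap` the directions of the polytope map onto the vectors with sum zero, of dimension
|V| - 1, and those of the cell onto the span of A, of dimension |A| by independence. The kernels
agree, so they cancel. -/
theorem IsFan.codim_coneFace {N : ℕ} {𝒜 : Finset (Finset (Gen V))} {W' : Set (V → ℝ)} {κ : Type}
    [Fintype κ] {f : (Ends I J → ℝ) →ₗ[ℝ] (κ → ℝ)} (hf : Function.Injective f)
    (h : IsFan (openNets I J) W' N 𝒜) (hIJ : (I ∩ J).Nonempty) (hV : ∀ v, v ∈ I ∨ v ∈ J)
    {A : Finset (Gen V)} (hA : A ∈ 𝒜) :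
    codim (f '' endsPolytope I J) (f '' coneFace I J A ∅) = Fintype.card V - 1 - A.card := by
  obtain ⟨u, hu, hpos, c, hc, hcpos, hb⟩ := h.exists_interior_point hIJ hV hA
  have hne : Nonempty V := ⟨hIJ.choose⟩
  have himg : ∀ s : Set (Ends I J → ℝ), Module.finrank ℝ (vectorSpan ℝ (f '' s))
      = Module.finrank ℝ (vectorSpan ℝ s) := by
    intro s
    have := f.toAffineMap.map_vectorSpan (s := s)
    rw [← LinearMap.coe_toAffineMap, ← this]
    exact (Submodule.equivMapOfInjective f hf _).finrank_eq.symm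
  rw [codim, himg, himg, vectorSpan_endsPolytope hu hpos, vectorSpan_coneFace hu hpos hc hcpos hb]
  have h1 := finrank_map_add_finrank_inf_ker (netMap I J) (endsDirection I J)
  have h2 := finrank_map_add_finrank_inf_ker (netMap I J)
    (endsDirection I J ⊓ ((supportedIn A).map boundary).comap (netMap I J))
  have hm1 : (endsDirection I J).map (netMap I J) = sumZero V := by
    ext d
    constructor
    · rintro ⟨x, hx, rfl⟩
      change ∑ v, _ = _
      rw [sum_netMap, hx.1, hx.2, sub_zero]
    · intro hd
      obtain ⟨x, hx1, hx2, hx3⟩ := exists_netMap_eq hIJ hV hd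
      exact ⟨x, ⟨hx1, hx2⟩, hx3⟩
  have hm2 : (endsDirection I J ⊓ ((supportedIn A).map boundary).comap (netMap I J)).map
      (netMap I J) = (supportedIn A).map boundary := by
    refine le_antisymm ?_ ?_
    · rintro _ ⟨x, hx, rfl⟩
      exact hx.2
    · rintro _ ⟨c', hc', rfl⟩
      obtain ⟨x, hx1, hx2, hx3⟩ := exists_netMap_eq hIJ hV (sum_boundary c')
      exact ⟨x, ⟨⟨hx1, hx2⟩, c', hc', hx3.symm⟩, hx3⟩
  -- A direction with net vector zero satisfies the condition imposed by A automatically.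
  have hk : endsDirection I J ⊓ ((supportedIn A).map boundary).comap (netMap I J)
      ⊓ LinearMap.ker (netMap I J) = endsDirection I J ⊓ LinearMap.ker (netMap I J) := by
    rw [inf_assoc]
    congr 1
    refine inf_eq_right.2 fun x hx => ?_
    rw [Submodule.mem_comap, LinearMap.mem_ker.1 hx]
    exact Submodule.zero_mem _
  have hm3 : Module.finrank ℝ ((supportedIn A).map boundary) = A.card := by
    rw [← finrank_supportedIn A, ← LinearMap.range_domRestrict]
    refine LinearMap.finrank_range_of_inj ?_
    rw [← LinearMap.ker_eq_bot, LinearMap.ker_eq_bot']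
    intro c hc
    exact Subtype.ext (h.indep hA c.2 hc)
  rw [hm1] at h1
  rw [hm2, hk, hm3] at h2
  have := finrank_sumZero V
  omega

end Dimension

/-! ### The fan of a caterpillar whose spine is closed to a cycle -/

/-- A caterpillar: the vertices in `I ∩ J` form a spine `valley 0, valley 1, …`, and every other
vertex `v` is a leaf attached to the spine vertex `valley (index v)`. -/
structure Caterpillar {V : Type} [DecidableEq V] (I J : Finset V) where
  w : ℕ
  valley : Fin w → V
  valley_injective : Function.Injective valley
  valley_mem : ∀ k, valley k ∈ I ∧ valley k ∈ J
  exists_valley : ∀ v, v ∈ I → v ∈ J → ∃ k, valley k = v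
  index : V → Fin w
  index_valley : ∀ k, index (valley k) = k
  mem_or_mem : ∀ v, v ∈ I ∨ v ∈ J

namespace Caterpillar

variable {V : Type} [Fintype V] [DecidableEq V] {I J : Finset V} (Γ : Caterpillar I J)

/-- The cyclic successor. -/
def next (k : Fin Γ.w) : Fin Γ.w := if h : k.1 + 1 < Γ.w then ⟨k.1 + 1, h⟩ else ⟨0, k.pos⟩

/-- The leaf edges together with the edges of the spine, closed to a cycle, that do not begin
at a spine vertex in `S`. -/
def graph (S : Finset (Fin Γ.w)) : Finset (Gen V) := Finset.univ.filter fun g =>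
  (g.1.1 ∈ I ∧ g.1.1 ∉ J ∧ g.1.2 = Γ.valley (Γ.index g.1.1)) ∨
  (g.1.2 ∈ J ∧ g.1.2 ∉ I ∧ g.1.1 = Γ.valley (Γ.index g.1.2)) ∨
  ∃ k ∉ S, g.1.1 = Γ.valley k ∧ g.1.2 = Γ.valley (Γ.next k)

theorem mem_graph {S : Finset (Fin Γ.w)} {g : Gen V} : g ∈ Γ.graph S ↔
    (g.1.1 ∈ I ∧ g.1.1 ∉ J ∧ g.1.2 = Γ.valley (Γ.index g.1.1)) ∨
    (g.1.2 ∈ J ∧ g.1.2 ∉ I ∧ g.1.1 = Γ.valley (Γ.index g.1.2)) ∨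
    ∃ k ∉ S, g.1.1 = Γ.valley k ∧ g.1.2 = Γ.valley (Γ.next k) := by
  simp [graph]

theorem graph_subset {S T : Finset (Fin Γ.w)} (h : T ⊆ S) : Γ.graph S ⊆ Γ.graph T := by
  intro g
  rw [mem_graph, mem_graph]
  rintro (h1 | h1 | ⟨k, hk, h1⟩)
  · exact Or.inl h1
  · exact Or.inr (Or.inl h1)
  · exact Or.inr (Or.inr ⟨k, fun hT => hk (h hT), h1⟩)

/-- The sum of the coordinates at the first `m` spine vertices and their leaves. -/
def prefixSum (m : ℕ) (d : V → ℝ) : ℝ := ∑ v, (if (Γ.index v).1 < m then 1 else 0) * d v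

/-- The weight of the edge `(x, y)`. -/
def weight (c : Gen V → ℝ) (x y : V) : ℝ := if h : x ≠ y then c ⟨(x, y), h⟩ else 0

omit [Fintype V] in
theorem weight_eq (c : Gen V → ℝ) (g : Gen V) : weight c g.1.1 g.1.2 = c g := dif_pos g.2

/-- The weight of the spine edge that begins at the `k`-th spine vertex. -/
def spineWeight (c : Gen V → ℝ) (k : Fin Γ.w) : ℝ := weight c (Γ.valley k) (Γ.valley (Γ.next k))

theorem spineWeight_eq_zero {S : Finset (Fin Γ.w)} {c : Gen V → ℝ}
    (hc : c ∈ supportedIn (Γ.graph S)) {k : Fin Γ.w} (hk : k ∈ S) : Γ.spineWeight c k = 0 := by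
  unfold spineWeight weight
  split_ifs with h
  · refine hc _ fun hmem => ?_
    rcases Γ.mem_graph.1 hmem with h1 | h1 | ⟨l, hl, h1, -⟩
    · exact h1.2.1 (Γ.valley_mem k).2
    · exact h1.2.1 (Γ.valley_mem _).1
    · exact hl (Γ.valley_injective h1 ▸ hk)
  -- Here `next k = k`, which happens only for a spine with one vertex; the default value of
  -- `weight` is zero.
  · rfl

/-- A leaf meets a single edge of the graph, so its net value is the weight of that edge. -/
theorem boundary_apply_source {S : Finset (Fin Γ.w)} {c : Gen V → ℝ}
    (hc : c ∈ supportedIn (Γ.graph S)) {v : V} (hI : v ∈ I) (hJ : v ∉ J) :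
    boundary c v = weight c v (Γ.valley (Γ.index v)) := by
  have hne : v ≠ Γ.valley (Γ.index v) := fun h => hJ (h ▸ (Γ.valley_mem _).2)
  rw [boundary_apply, weight, dif_pos hne, Finset.sum_eq_single ⟨(v, _), hne⟩]
  · simp [hne.symm]
  · intro g _ hg
    by_cases hmem : g ∈ Γ.graph S
    · have h1 : g.1.1 ≠ v := by
        rintro rfl
        rcases Γ.mem_graph.1 hmem with h1 | h1 | ⟨l, hl, h1, -⟩
        · exact hg (Subtype.ext (Prod.ext rfl h1.2.2))
        · exact hJ (h1.2.2 ▸ (Γ.valley_mem _).2)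
        · exact hJ (h1 ▸ (Γ.valley_mem _).2)
      have h2 : g.1.2 ≠ v := by
        rintro rfl
        rcases Γ.mem_graph.1 hmem with h1 | h1 | ⟨l, hl, -, h1⟩
        · exact hJ (h1.2.2 ▸ (Γ.valley_mem _).2)
        · exact hJ h1.1
        · exact hJ (h1 ▸ (Γ.valley_mem _).2)
      simp [h1, h2]
    · rw [hc g hmem, zero_mul]
  · simp

theorem boundary_apply_sink {S : Finset (Fin Γ.w)} {c : Gen V → ℝ}
    (hc : c ∈ supportedIn (Γ.graph S)) {v : V} (hJ : v ∈ J) (hI : v ∉ I) :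
    boundary c v = -weight c (Γ.valley (Γ.index v)) v := by
  have hne : Γ.valley (Γ.index v) ≠ v := fun h => hI (h ▸ (Γ.valley_mem _).1)
  rw [boundary_apply, weight, dif_pos hne, Finset.sum_eq_single ⟨(_, v), hne⟩]
  · simp [hne]
  · intro g _ hg
    by_cases hmem : g ∈ Γ.graph S
    · have h1 : g.1.2 ≠ v := by
        rintro rfl
        rcases Γ.mem_graph.1 hmem with h1 | h1 | ⟨l, hl, -, h1⟩
        · exact hI (h1.2.2 ▸ (Γ.valley_mem _).1)
        · exact hg (Subtype.ext (Prod.ext h1.2.2 rfl))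
        · exact hI (h1 ▸ (Γ.valley_mem _).1)
      have h2 : g.1.1 ≠ v := by
        rintro rfl
        rcases Γ.mem_graph.1 hmem with h1 | h1 | ⟨l, hl, h1, -⟩
        · exact hI h1.1
        · exact hI (h1.2.2 ▸ (Γ.valley_mem _).1)
        · exact hI (h1 ▸ (Γ.valley_mem _).1)
      simp [h1, h2]
    · rw [hc g hmem, zero_mul]
  · simp

/-- The last spine vertex. -/
def last [Nonempty V] : Fin Γ.w :=
  ⟨Γ.w - 1, Nat.sub_lt (Γ.index (Classical.arbitrary V)).pos one_pos⟩

theorem prefixSum_w (d : V → ℝ) : Γ.prefixSum Γ.w d = ∑ v, d v := by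
  simp [prefixSum]

/-- A cut argument: leaf edges stay on one side of the cut after the k-th spine vertex. Only the
spine edge that begins at k leaves the initial part, and only the edge that closes the cycle enters
it. -/
theorem prefixSum_boundary [Nonempty V] {S : Finset (Fin Γ.w)} {c : Gen V → ℝ}
    (hc : c ∈ supportedIn (Γ.graph S)) (k : Fin Γ.w) :
    Γ.prefixSum (k + 1) (boundary c) = Γ.spineWeight c k - Γ.spineWeight c Γ.last := by
  by_cases hk : k = Γ.last
  · have : k.1 + 1 = Γ.w := by
      rw [hk, last]
      have := k.pos
      simp only
      omega
    rw [this, prefixSum_w, sum_boundary, hk, sub_self]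
  have hk1 : k.1 + 1 < Γ.w := by
    have h1 := k.2
    have h2 : k.1 ≠ Γ.w - 1 := fun h => hk (Fin.ext h)
    omega
  have hnext : Γ.next k = ⟨k.1 + 1, hk1⟩ := dif_pos hk1
  have hnl : Γ.next Γ.last = ⟨0, k.pos⟩ := dif_neg (by simp only [last]; omega)
  have hne : Γ.valley k ≠ Γ.valley (Γ.next k) := fun h => by
    have := congrArg Fin.val (Γ.valley_injective h)
    rw [hnext] at this
    simp at this
  have hnel : Γ.valley Γ.last ≠ Γ.valley (Γ.next Γ.last) := fun h => by
    have := congrArg Fin.val (Γ.valley_injective h)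
    rw [hnl] at this
    simp only [last] at this
    omega
  rw [prefixSum, sum_mul_boundary, spineWeight, spineWeight, weight, weight, dif_pos hne,
    dif_pos hnel, Finset.sum_eq_add ⟨(_, _), hne⟩ ⟨(_, _), hnel⟩]
  · have hlast : Γ.last.1 = Γ.w - 1 := rfl
    simp only [Γ.index_valley, hnext, hnl]
    rw [if_pos (by omega), if_neg (by omega), if_neg (by omega), if_pos (by omega)]
    ring
  · intro h
    simp only [Subtype.mk.injEq, Prod.mk.injEq] at h
    exact hk (Γ.valley_injective h.1)
  · rintro g - ⟨h1, h2⟩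
    by_cases hmem : g ∈ Γ.graph S
    · rcases Γ.mem_graph.1 hmem with h | h | ⟨l, hl, h, h'⟩
      · rw [h.2.2, Γ.index_valley, sub_self, mul_zero]
      · rw [h.2.2, Γ.index_valley, sub_self, mul_zero]
      · have hlk : l ≠ k := by
          rintro rfl
          exact h1 (Subtype.ext (Prod.ext h h'))
        have hll : l ≠ Γ.last := by
          rintro rfl
          exact h2 (Subtype.ext (Prod.ext h h'))
        have hl1 : l.1 + 1 < Γ.w := by
          have h1 := l.2
          have h2 : l.1 ≠ Γ.w - 1 := fun h => hll (Fin.ext h)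
          omega
        have hnl : Γ.next l = ⟨l.1 + 1, hl1⟩ := dif_pos hl1
        have hlk' : l.1 ≠ k.1 := fun h => hlk (Fin.ext h)
        rw [h, h', Γ.index_valley, Γ.index_valley, hnl]
        have : (l.1 < k.1 + 1) ↔ l.1 + 1 < k.1 + 1 := by omega
        simp only [this, sub_self, mul_zero]
    · rw [hc g hmem, zero_mul]
  · simp
  · simp

/-- The difference vector vanishes on leaves, so consecutive prefix sums of it differ by its value
at one spine vertex. -/
theorem eq_of_prefixSum_eq {d d' : V → ℝ} (hI : ∀ v ∈ I, v ∉ J → d v = d' v)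
    (hJ : ∀ v ∈ J, v ∉ I → d v = d' v)
    (hY : ∀ k : Fin Γ.w, Γ.prefixSum (k + 1) d = Γ.prefixSum (k + 1) d') : d = d' := by
  have hY0 : ∀ m ≤ Γ.w, Γ.prefixSum m (d - d') = 0 := by
    intro m hm
    have hsub : Γ.prefixSum m (d - d') = Γ.prefixSum m d - Γ.prefixSum m d' := by
      simp [prefixSum, mul_sub]
    rcases Nat.eq_zero_or_pos m with rfl | hpos
    · simp [prefixSum]
    · have := hY ⟨m - 1, by omega⟩
      simp only [Nat.sub_add_cancel hpos] at this
      rw [hsub, this, sub_self]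
  ext v
  by_cases h1 : v ∈ I <;> by_cases h2 : v ∈ J
  · obtain ⟨k, rfl⟩ := Γ.exists_valley v h1 h2
    have hdiff : Γ.prefixSum (k + 1) (d - d') - Γ.prefixSum k (d - d') = (d - d') (Γ.valley k) := by
      rw [prefixSum, prefixSum, ← Finset.sum_sub_distrib, Finset.sum_eq_single (Γ.valley k)]
      · rw [Γ.index_valley, if_pos (by omega), if_neg (by omega)]
        ring
      · intro u _ hu
        by_cases hu1 : u ∈ I <;> by_cases hu2 : u ∈ J
        · obtain ⟨l, rfl⟩ := Γ.exists_valley u hu1 hu2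
          have hlk : l.1 ≠ k.1 := fun h => hu (by rw [Fin.ext h])
          have : (l.1 < k.1 + 1) ↔ l.1 < k.1 := by omega
          simp only [Γ.index_valley, this, sub_self]
        · simp [hI u hu1 hu2]
        · simp [hJ u hu2 hu1]
        · exact absurd (Γ.mem_or_mem u) (by tauto)
      · simp
    rw [hY0 _ k.2, hY0 _ k.2.le, sub_zero, Pi.sub_apply] at hdiff
    linarith
  · exact hI v h1 h2
  · exact hJ v h2 h1
  · exact absurd (Γ.mem_or_mem v) (by tauto)

/-- The weighting with net vector `d` whose spine weights are the prefix sums of `d` minus `m`. -/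
def lift (d : V → ℝ) (m : ℝ) : Gen V → ℝ := fun g =>
  if g ∈ Γ.graph ∅ then
    if g.1.1 ∉ J then d g.1.1 else if g.1.2 ∉ I then -d g.1.2
    else Γ.prefixSum (Γ.index g.1.1 + 1) d - m
  else 0

theorem lift_mem (d : V → ℝ) (m : ℝ) : Γ.lift d m ∈ supportedIn (Γ.graph ∅) :=
  fun _ hg => if_neg hg

theorem lift_spine {d : V → ℝ} {m : ℝ} {g : Gen V} {k : Fin Γ.w} (h1 : g.1.1 = Γ.valley k)
    (h2 : g.1.2 = Γ.valley (Γ.next k)) : Γ.lift d m g = Γ.prefixSum (k + 1) d - m := by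
  rw [lift, if_pos (Γ.mem_graph.2 (Or.inr (Or.inr ⟨k, by simp, h1, h2⟩))),
    if_neg (by rw [h1, not_not]; exact (Γ.valley_mem _).2),
    if_neg (by rw [h2, not_not]; exact (Γ.valley_mem _).1), h1, Γ.index_valley]

theorem lift_mem_graph {S : Finset (Fin Γ.w)} {d : V → ℝ} {m : ℝ}
    (h : ∀ k ∈ S, Γ.prefixSum (k + 1) d = m) : Γ.lift d m ∈ supportedIn (Γ.graph S) := by
  intro g hg
  by_cases hmem : g ∈ Γ.graph ∅
  · have := hmem
    rw [mem_graph] at hg this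
    push Not at hg
    rcases this with h1 | h1 | ⟨k, -, h1, h2⟩
    · exact absurd h1.2.2 (hg.1 h1.1 h1.2.1)
    · exact absurd h1.2.2 (hg.2.1 h1.1 h1.2.1)
    · have hk : k ∈ S := by
        by_contra hk
        exact hg.2.2 k hk h1 h2
      rw [Γ.lift_spine h1 h2, h k hk, sub_self]
  · exact Γ.lift_mem d m g hmem

/-- The constant m circulates around the cycle and does not affect net vectors; it drops out of the
difference with the closing edge, whose prefix sum is the total 0. -/
theorem boundary_lift [Nonempty V] {d : V → ℝ} (hd : ∑ v, d v = 0) (m : ℝ) :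
    boundary (Γ.lift d m) = d := by
  refine Γ.eq_of_prefixSum_eq (fun v h1 h2 => ?_) (fun v h1 h2 => ?_) fun k => ?_
  · have hne : v ≠ Γ.valley (Γ.index v) := fun h => h2 (h ▸ (Γ.valley_mem _).2)
    rw [Γ.boundary_apply_source (Γ.lift_mem d m) h1 h2, weight, dif_pos hne, lift,
      if_pos (Γ.mem_graph.2 (Or.inl ⟨h1, h2, rfl⟩)), if_pos h2]
  · have hne : Γ.valley (Γ.index v) ≠ v := fun h => h2 (h ▸ (Γ.valley_mem _).1)
    rw [Γ.boundary_apply_sink (Γ.lift_mem d m) h1 h2, weight, dif_pos hne, lift,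
      if_pos (Γ.mem_graph.2 (Or.inr (Or.inl ⟨h1, h2, rfl⟩))),
      if_neg (not_not.2 (Γ.valley_mem _).2), if_pos h2, neg_neg]
  · rw [Γ.prefixSum_boundary (Γ.lift_mem d m)]
    have hw : Γ.last.1 + 1 = Γ.w := by
      have := k.pos
      simp only [last]
      omega
    by_cases hk : k = Γ.last
    · rw [hk, sub_self, hw, prefixSum_w, hd]
    have hk1 : k.1 + 1 < Γ.w := by
      have h1 := k.2
      have h2 : k.1 ≠ Γ.last.1 := fun h => hk (Fin.ext h)
      omega
    have hne : Γ.valley k ≠ Γ.valley (Γ.next k) := fun h => by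
      have := congrArg Fin.val (Γ.valley_injective h)
      rw [next, dif_pos hk1] at this
      simp at this
    have hnel : Γ.valley Γ.last ≠ Γ.valley (Γ.next Γ.last) := fun h => by
      have := congrArg Fin.val (Γ.valley_injective h)
      rw [next, dif_neg (by omega)] at this
      simp only at this
      omega
    rw [spineWeight, spineWeight, weight, weight, dif_pos hne, dif_pos hnel,
      Γ.lift_spine rfl rfl, Γ.lift_spine rfl rfl, hw, prefixSum_w, hd]
    ring

theorem eq_of_weights_eq {S T : Finset (Fin Γ.w)} {c c' : Gen V → ℝ}
    (hc : c ∈ supportedIn (Γ.graph S)) (hc' : c' ∈ supportedIn (Γ.graph T))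
    (hb : boundary c = boundary c') (hs : ∀ k, Γ.spineWeight c k = Γ.spineWeight c' k) :
    c = c' := by
  have h1 := supportedIn_mono (Γ.graph_subset (Finset.empty_subset S)) hc
  have h2 := supportedIn_mono (Γ.graph_subset (Finset.empty_subset T)) hc'
  ext g
  by_cases hmem : g ∈ Γ.graph ∅
  · rcases Γ.mem_graph.1 hmem with h | h | ⟨k, -, h, h'⟩
    · have := Γ.boundary_apply_source hc h.1 h.2.1
      rw [hb, Γ.boundary_apply_source hc' h.1 h.2.1, ← h.2.2, weight_eq, weight_eq] at this
      exact this.symm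
    · have := Γ.boundary_apply_sink hc h.1 h.2.1
      rw [hb, Γ.boundary_apply_sink hc' h.1 h.2.1, ← h.2.2, weight_eq, weight_eq] at this
      linarith
    · have := hs k
      rwa [spineWeight, spineWeight, ← h, ← h', weight_eq, weight_eq] at this
  · rw [h1 g hmem, h2 g hmem]

theorem spineWeight_nonneg {c : Gen V → ℝ} (h : 0 ≤ c) (k : Fin Γ.w) : 0 ≤ Γ.spineWeight c k := by
  unfold spineWeight weight
  split_ifs
  · exact h _
  · exact le_rfl

theorem ne_next {S : Finset (Fin Γ.w)} (hS : S.Nonempty) {k : Fin Γ.w} (hk : k ∉ S) :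
    k ≠ Γ.next k := by
  intro h
  obtain ⟨l, hl⟩ := hS
  have hkl : k.1 ≠ l.1 := fun h => hk (Fin.ext h ▸ hl)
  have := congrArg Fin.val h
  unfold next at this
  split_ifs at this with h2
  · simp at this
  · simp only at this
    have := l.2
    omega

/-- Each vertex other than the spine vertices in S owns exactly one edge: a leaf owns its leaf edge,
a spine vertex the spine edge that begins there. -/
theorem card_graph {S : Finset (Fin Γ.w)} (hS : S.Nonempty) :
    (Γ.graph S).card + S.card = Fintype.card V := by
  have h1 : (S.image Γ.valley).card = S.card := Finset.card_image_of_injective _ Γ.valley_injective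
  rw [← h1, ← Finset.card_univ, ← Finset.card_sdiff_add_card_eq_card (Finset.subset_univ (S.image Γ.valley))]
  congr 1
  symm
  have hnext : ∀ k ∉ S, k ≠ Γ.next k := fun k => Γ.ne_next hS
  have hvS : ∀ v ∈ Finset.univ \ S.image Γ.valley, v ∈ I → v ∈ J → Γ.index v ∉ S := by
    intro v hv h1 h2 h3
    obtain ⟨k, rfl⟩ := Γ.exists_valley v h1 h2
    rw [Γ.index_valley] at h3
    simp only [Finset.mem_sdiff, Finset.mem_univ, true_and] at hv
    exact hv (Finset.mem_image_of_mem _ h3)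
  have hv : ∀ v, v ∈ I → v ∈ J → v = Γ.valley (Γ.index v) := by
    intro v h1 h2
    obtain ⟨k, rfl⟩ := Γ.exists_valley v h1 h2
    rw [Γ.index_valley]
  have hmemI := fun k => (Γ.valley_mem k).1
  have hmemJ := fun k => (Γ.valley_mem k).2
  refine Finset.card_bij (fun v hv' => (⟨if v ∉ J then (v, Γ.valley (Γ.index v))
    else if v ∉ I then (Γ.valley (Γ.index v), v) else (v, Γ.valley (Γ.next (Γ.index v))), ?_⟩ : Gen V))
    ?_ ?_ ?_
  · by_cases h1 : v ∈ I <;> by_cases h2 : v ∈ J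
    · simp only [h1, h2, not_true_eq_false, if_false]
      intro h
      have h3 := hnext _ (hvS v hv' h1 h2)
      rw [hv v h1 h2, Γ.index_valley] at h
      exact h3 (Γ.valley_injective h)
    · simp only [h2, not_false_eq_true, if_true]
      exact fun h => h2 (h ▸ hmemJ _)
    · simp only [h1, h2, not_true_eq_false, not_false_eq_true, if_true, if_false]
      exact fun h => h1 (h ▸ hmemI _)
    · exact absurd (Γ.mem_or_mem v) (by tauto)
  · intro v hv'
    rw [mem_graph]
    by_cases h1 : v ∈ I <;> by_cases h2 : v ∈ J
    · simp only [h1, h2, not_true_eq_false, if_false]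
      exact Or.inr (Or.inr ⟨_, hvS v hv' h1 h2, hv v h1 h2, rfl⟩)
    · simp [h1, h2]
    · simp [h1, h2]
    · exact absurd (Γ.mem_or_mem v) (by tauto)
  · intro v _ u _ h
    have h := congrArg Subtype.val h
    simp only at h
    have hnI : ∀ v, v ∉ I → v ∈ J := fun v hv => (Γ.mem_or_mem v).resolve_left hv
    split_ifs at h <;> simp only [Prod.mk.injEq] at h <;> grind
  · intro g hg
    rcases Γ.mem_graph.1 hg with h | h | ⟨k, hk, h, h'⟩
    · refine ⟨g.1.1, ?_, Subtype.ext (Prod.ext ?_ ?_)⟩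
      · simp only [Finset.mem_sdiff, Finset.mem_univ, true_and, Finset.mem_image, not_exists, not_and]
        rintro k - hk
        exact h.2.1 (hk ▸ hmemJ k)
      · simp [h.2.1]
      · simp [h.2.1, h.2.2]
    · refine ⟨g.1.2, ?_, Subtype.ext (Prod.ext ?_ ?_)⟩
      · simp only [Finset.mem_sdiff, Finset.mem_univ, true_and, Finset.mem_image, not_exists, not_and]
        rintro k - hk
        exact h.2.1 (hk ▸ hmemI k)
      · simp [h.2.1, h.2.2, h.1]
      · simp [h.2.1, h.1]
    · refine ⟨Γ.valley k, ?_, Subtype.ext (Prod.ext ?_ ?_)⟩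
      · simp only [Finset.mem_sdiff, Finset.mem_univ, true_and, Finset.mem_image, not_exists, not_and]
        rintro l hl hlk
        exact hk (Γ.valley_injective hlk ▸ hl)
      · simp [hmemI, hmemJ, h]
      · simp [hmemI, hmemJ, h', Γ.index_valley]

/-- The graphs `graph S`, `S ≠ ∅`. -/
def fan : Finset (Finset (Gen V)) := (Finset.univ.filter Finset.Nonempty).image Γ.graph

theorem mem_fan {A : Finset (Gen V)} : A ∈ Γ.fan ↔ ∃ S, S.Nonempty ∧ Γ.graph S = A := by
  simp [fan]

theorem exists_prefixSum_eq_inf [Nonempty V] (d : V → ℝ) :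
    ∃ l : Fin Γ.w, ∀ k : Fin Γ.w, Γ.prefixSum (l + 1) d ≤ Γ.prefixSum (k + 1) d := by
  have : Nonempty (Fin Γ.w) := ⟨Γ.last⟩
  exact Finite.exists_min fun k : Fin Γ.w => Γ.prefixSum (k + 1) d

theorem lift_nonneg {d : V → ℝ} (hd : d ∈ closedNets I J) {m : ℝ}
    (hm : ∀ k : Fin Γ.w, m ≤ Γ.prefixSum (k + 1) d) : 0 ≤ Γ.lift d m := by
  intro g
  rw [Pi.zero_apply]
  by_cases hg : g ∈ Γ.graph ∅
  · rcases Γ.mem_graph.1 hg with h | h | ⟨k, hk, h, h'⟩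
    · rw [lift, if_pos hg, if_pos h.2.1]
      exact hd.2.1 _ h.1 h.2.1
    · rw [lift, if_pos hg, if_neg (not_not.2 (h.2.2 ▸ (Γ.valley_mem _).2)), if_pos h.2.1]
      exact neg_nonneg.2 (hd.2.2 _ h.1 h.2.1)
    · rw [Γ.lift_spine h h']
      exact sub_nonneg.2 (hm k)
  · exact (if_neg hg).ge

/-- Weightings with the same net vector agree on the leaf edges and differ by a constant on the
cycle. Nonnegativity together with a zero on the cycle fixes this constant as the smallest prefix
sum. -/
theorem isFan_fan [Nonempty V] :
    IsFan (openNets I J) (closedNets I J) (Fintype.card V - 1) Γ.fan := by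
  refine ⟨?_, ?_, ?_, ?_, ?_, ?_⟩
  · intro A hA B hB c hc c' hc' h0 h0' hb
    obtain ⟨S, ⟨k, hk⟩, rfl⟩ := Γ.mem_fan.1 hA
    obtain ⟨T, ⟨l, hl⟩, rfl⟩ := Γ.mem_fan.1 hB
    refine Γ.eq_of_weights_eq hc hc' hb fun m => ?_
    have h1 : ∀ m, Γ.spineWeight c m - Γ.spineWeight c Γ.last
        = Γ.spineWeight c' m - Γ.spineWeight c' Γ.last := fun m => by
      rw [← Γ.prefixSum_boundary hc, ← Γ.prefixSum_boundary hc', hb]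
    have h2 := Γ.spineWeight_eq_zero hc hk
    have h3 := Γ.spineWeight_eq_zero hc' hl
    have h4 := Γ.spineWeight_nonneg h0' k
    have h5 := Γ.spineWeight_nonneg h0 l
    -- The constant by which c' exceeds c on the cycle is nonnegative at k, where c vanishes, and
    -- nonpositive at l, where c' vanishes.
    linarith [h1 m, h1 k, h1 l]
  · intro A hA c hc hpos
    obtain ⟨S, -, rfl⟩ := Γ.mem_fan.1 hA
    refine ⟨sum_boundary c, fun v h1 h2 => ?_, fun v h1 h2 => ?_⟩
    · have hne : v ≠ Γ.valley (Γ.index v) := fun h => h2 (h ▸ (Γ.valley_mem _).2)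
      rw [Γ.boundary_apply_source hc h1 h2, weight, dif_pos hne]
      exact hpos _ (Γ.mem_graph.2 (Or.inl ⟨h1, h2, rfl⟩))
    · have hne : Γ.valley (Γ.index v) ≠ v := fun h => h2 (h ▸ (Γ.valley_mem _).1)
      rw [Γ.boundary_apply_sink hc h1 h2, weight, dif_pos hne, neg_lt_zero]
      exact hpos _ (Γ.mem_graph.2 (Or.inr (Or.inl ⟨h1, h2, rfl⟩)))
  · intro d hd
    -- Subtracting the smallest prefix sum leaves nonnegative spine weights, with a zero at l.
    obtain ⟨l, hl⟩ := Γ.exists_prefixSum_eq_inf d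
    exact ⟨Γ.graph {l}, Γ.mem_fan.2 ⟨_, by simp, rfl⟩, Γ.lift d (Γ.prefixSum (l + 1) d),
      Γ.lift_mem_graph (by simp), Γ.lift_nonneg hd hl, Γ.boundary_lift hd.1 _⟩
  · intro d hd
    obtain ⟨l, hl⟩ := Γ.exists_prefixSum_eq_inf d
    -- For positive weights S has to contain every place where the minimum is attained.
    refine ⟨Γ.graph (Finset.univ.filter fun k => Γ.prefixSum (k + 1) d = Γ.prefixSum (l + 1) d),
      Γ.mem_fan.2 ⟨_, ⟨l, by simp⟩, rfl⟩, Γ.lift d (Γ.prefixSum (l + 1) d),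
      Γ.lift_mem_graph (by simp), fun g hgS => ?_, Γ.boundary_lift hd.1 _⟩
    have hg := Γ.graph_subset (Finset.empty_subset _) hgS
    rcases Γ.mem_graph.1 hgS with h | h | ⟨k, hk, h, h'⟩
    · rw [lift, if_pos hg, if_pos h.2.1]
      exact hd.2.1 _ h.1 h.2.1
    · rw [lift, if_pos hg, if_neg (not_not.2 (h.2.2 ▸ (Γ.valley_mem _).2)), if_pos h.2.1]
      exact neg_pos.2 (hd.2.2 _ h.1 h.2.1)
    · rw [Γ.lift_spine h h']
      exact sub_pos.2 ((hl k).lt_of_ne' (by simpa using hk))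
  · intro A hA c hc hint g
    obtain ⟨S, ⟨l, hl⟩, rfl⟩ := Γ.mem_fan.1 hA
    by_cases hg : g ∈ Γ.graph S
    · rcases Γ.mem_graph.1 hg with h | h | ⟨k, hk, h, h'⟩
      · obtain ⟨z, hz⟩ := hint g.1.1
        rw [Γ.boundary_apply_source hc h.1 h.2.1, ← h.2.2, weight_eq] at hz
        exact ⟨z, hz⟩
      · obtain ⟨z, hz⟩ := hint g.1.2
        rw [Γ.boundary_apply_sink hc h.1 h.2.1, ← h.2.2, weight_eq] at hz
        exact ⟨-z, by push_cast; linarith⟩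
      -- As the weight at l ∈ S is zero, the weight at k is the difference of two prefix sums of an
      -- integral vector.
      · choose z hz using hint
        have hY : ∀ m : ℕ, Γ.prefixSum m (boundary c)
            = ((∑ v, (if (Γ.index v).1 < m then 1 else 0) * z v : ℤ) : ℝ) := by
          intro m
          push_cast
          exact Finset.sum_congr rfl fun v _ => by rw [hz]
        have h1 := Γ.prefixSum_boundary hc k
        have h2 := Γ.prefixSum_boundary hc l
        rw [Γ.spineWeight_eq_zero hc hl] at h2
        rw [spineWeight, ← h, ← h', weight_eq] at h1
        obtain ⟨a, ha⟩ : ∃ a : ℤ, Γ.prefixSum (k + 1) (boundary c) = a := ⟨_, hY _⟩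
        obtain ⟨b, hb⟩ : ∃ b : ℤ, Γ.prefixSum (l + 1) (boundary c) = b := ⟨_, hY _⟩
        exact ⟨a - b, by rw [Int.cast_sub, ← ha, ← hb, h1, h2]; ring⟩
    · exact ⟨0, by rw [hc g hg]; simp⟩
  · intro A hA
    obtain ⟨S, hS, rfl⟩ := Γ.mem_fan.1 hA
    have := Γ.card_graph hS
    have := hS.card_pos
    omega

end Caterpillar

/-! ### The indexed word and the caterpillar structure of G_B(ν) -/

section Words

theorem le_of_mem_canonicalIndexing {k : ℕ} {l : List Step} {p : Step × ℕ}
    (hp : p ∈ canonicalIndexing k l) : k ≤ p.2 := by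
  induction k, l using canonicalIndexing.induct with
  | case1 => simp [canonicalIndexing] at hp
  | case2 k l ih =>
    simp only [canonicalIndexing, List.mem_cons] at hp
    rcases hp with rfl | rfl | hp
    · exact le_rfl
    · exact le_rfl
    · exact (Nat.le_succ k).trans (ih hp)
  | case3 k c l h ih =>
    rw [canonicalIndexing.eq_3 _ _ _ h, List.mem_cons] at hp
    rcases hp with rfl | hp
    · exact le_rfl
    · exact (Nat.le_succ k).trans (ih hp)

theorem map_fst_canonicalIndexing (k : ℕ) (l : List Step) :
    (canonicalIndexing k l).map Prod.fst = l := by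
  induction k, l using canonicalIndexing.induct with
  | case1 => simp [canonicalIndexing]
  | case2 k l ih => simp [canonicalIndexing, ih]
  | case3 k c l h ih => rw [canonicalIndexing.eq_3 _ _ _ h, List.map_cons, ih]

theorem nodup_canonicalIndexing (k : ℕ) (l : List Step) : (canonicalIndexing k l).Nodup := by
  induction k, l using canonicalIndexing.induct with
  | case1 => simp [canonicalIndexing]
  | case2 k l ih =>
    have h1 : ∀ c, (c, k) ∉ canonicalIndexing (k + 1) l := fun c hc => by
      have := le_of_mem_canonicalIndexing hc
      simp at this
    simp [canonicalIndexing, ih, h1]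
  | case3 k c l h ih =>
    have h1 : ∀ c, (c, k) ∉ canonicalIndexing (k + 1) l := fun c hc => by
      have := le_of_mem_canonicalIndexing hc
      simp at this
    rw [canonicalIndexing.eq_3 _ _ _ h, List.nodup_cons]
    exact ⟨h1 c, ih⟩

/-- Between an `E` and a later `N` there is a valley. -/
theorem exists_valley_canonicalIndexing {k : ℕ} {l : List Step} {i j : ℕ}
    (hi : (Step.E, i) ∈ canonicalIndexing k l) (hj : (Step.N, j) ∈ canonicalIndexing k l)
    (hij : i ≤ j) : ∃ m, (Step.E, m) ∈ canonicalIndexing k l ∧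
      (Step.N, m) ∈ canonicalIndexing k l ∧ i ≤ m ∧ m ≤ j := by
  induction k, l using canonicalIndexing.induct generalizing i with
  | case1 => simp [canonicalIndexing] at hi
  | case2 k l ih =>
    have hjk := le_of_mem_canonicalIndexing hj
    simp only [canonicalIndexing, List.mem_cons, Prod.mk.injEq, reduceCtorEq, true_and,
      false_and, false_or] at hi hj ⊢
    rcases hi with rfl | hi
    · exact ⟨i, Or.inl rfl, Or.inl rfl, le_rfl, hjk⟩
    · have hik := le_of_mem_canonicalIndexing hi
      simp only at hik
      rcases hj with rfl | hj
      · omega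
      · obtain ⟨m, h1, h2, h3⟩ := ih hi hj hij
        exact ⟨m, Or.inr h1, Or.inr h2, h3⟩
  | case3 k c l h ih =>
    rw [canonicalIndexing.eq_3 _ _ _ h, List.mem_cons, Prod.mk.injEq] at hi hj
    simp only [canonicalIndexing.eq_3 _ _ _ h, List.mem_cons, Prod.mk.injEq]
    have key : ∀ i, (Step.E, i) ∈ canonicalIndexing (k + 1) l → i ≤ j →
        ∃ m, ((Step.E = c ∧ m = k) ∨ (Step.E, m) ∈ canonicalIndexing (k + 1) l) ∧
          ((Step.N = c ∧ m = k) ∨ (Step.N, m) ∈ canonicalIndexing (k + 1) l) ∧ i ≤ m ∧ m ≤ j := by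
      intro i hi hij
      have hik := le_of_mem_canonicalIndexing hi
      simp only at hik
      rcases hj with ⟨-, rfl⟩ | hj
      · omega
      · obtain ⟨m, h1, h2, h3⟩ := ih hi hj hij
        exact ⟨m, Or.inr h1, Or.inr h2, h3⟩
    rcases hi with ⟨rfl, rfl⟩ | hi
    · rcases hj with ⟨hj, -⟩ | hj
      · simp at hj
      have hjk := le_of_mem_canonicalIndexing hj
      simp only at hjk
      match l, h with
      | [], _ => simp [canonicalIndexing] at hj
      | .N :: l, h => exact absurd rfl (h l rfl)
      | .E :: l, h =>
        -- Two consecutive E steps: the second one also comes before N_j, so it can take the place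
        -- of the first.
        have hmem : (Step.E, i + 1) ∈ canonicalIndexing (i + 1) (.E :: l) := by
          cases l with
          | nil => simp [canonicalIndexing]
          | cons d l => cases d <;> simp [canonicalIndexing]
        obtain ⟨m, h1, h2, h3, h4⟩ := key (i + 1) hmem hjk
        exact ⟨m, h1, h2, by omega, h4⟩
    · exact key i hi hij

theorem exists_le_north_canonicalIndexing {k : ℕ} {l : List Step}
    (hl : l.getLast? = some Step.N) {p : Step × ℕ} (hp : p ∈ canonicalIndexing k l) :
    ∃ j, (Step.N, j) ∈ canonicalIndexing k l ∧ p.2 ≤ j := by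
  induction k, l using canonicalIndexing.induct generalizing p with
  | case1 => simp at hl
  | case2 k l ih =>
    simp only [canonicalIndexing, List.mem_cons] at hp ⊢
    rcases hp with rfl | rfl | hp
    · exact ⟨k, by simp, le_rfl⟩
    · exact ⟨k, by simp, le_rfl⟩
    · cases l with
      | nil => simp [canonicalIndexing] at hp
      | cons c l =>
        obtain ⟨j, h1, h2⟩ := ih (by simpa using hl) hp
        exact ⟨j, Or.inr (Or.inr h1), h2⟩
  | case3 k c l h ih =>
    rw [canonicalIndexing.eq_3 _ _ _ h, List.mem_cons] at hp
    simp only [canonicalIndexing.eq_3 _ _ _ h, List.mem_cons]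
    cases l with
    | nil =>
      simp only [List.getLast?_singleton, Option.some.injEq] at hl
      subst hl
      rcases hp with rfl | hp
      · exact ⟨k, Or.inl rfl, le_rfl⟩
      · simp [canonicalIndexing] at hp
    | cons d l =>
      have hl' : (d :: l).getLast? = some Step.N := by simpa using hl
      rcases hp with rfl | hp
      · have hne : canonicalIndexing (k + 1) (d :: l) ≠ [] := fun h0 => by
          have := map_fst_canonicalIndexing (k + 1) (d :: l)
          rw [h0] at this
          simp at this
        obtain ⟨q, hq⟩ := List.exists_mem_of_ne_nil _ hne
        obtain ⟨j, h1, h2⟩ := ih hl' hq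
        have := le_of_mem_canonicalIndexing hq
        exact ⟨j, Or.inr h1, by simp only; omega⟩
      · obtain ⟨j, h1, h2⟩ := ih hl' hp
        exact ⟨j, Or.inr h1, h2⟩

variable (ν : List Step)

theorem mem_indexI {v : Vertex ν} : v ∈ indexI ν ↔ (Step.E, v.1) ∈ indexedWord ν := by
  simp [indexI]

theorem mem_indexJ {v : Vertex ν} : v ∈ indexJ ν ↔ (Step.N, v.1) ∈ indexedWord ν := by
  simp [indexJ]

/-- The vertex of a letter. -/
def letterVertex {p : Step × ℕ} (hp : p ∈ indexedWord ν) : Vertex ν :=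
  ⟨p.2, List.mem_toFinset.2 (List.mem_map_of_mem hp)⟩

theorem mem_indexI_or_mem_indexJ (v : Vertex ν) : v ∈ indexI ν ∨ v ∈ indexJ ν := by
  obtain ⟨⟨c, i⟩, hp, hv⟩ := List.mem_map.1 (List.mem_toFinset.1 v.2)
  simp only at hv
  rw [mem_indexI, mem_indexJ, ← hv]
  cases c
  · exact Or.inl hp
  · exact Or.inr hp

/-- Equal letters never share an index, so vertices with a given letter correspond to its
occurrences in the word. -/
theorem card_filter_letter (s : Step) (A : Finset (Vertex ν))
    (hA : ∀ v, v ∈ A ↔ (s, v.1) ∈ indexedWord ν) :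
    A.card = (Step.E :: (ν ++ [Step.N])).count s := by
  have h1 : (Step.E :: (ν ++ [Step.N])).count s
      = ((indexedWord ν).filter fun p => p.1 = s).toFinset.card := by
    have hnd : (indexedWord ν).Nodup := nodup_canonicalIndexing _ _
    rw [List.toFinset_card_of_nodup (hnd.filter _),
      ← map_fst_canonicalIndexing 1 (Step.E :: (ν ++ [Step.N])), List.count_eq_countP,
      List.countP_map, List.countP_eq_length_filter]
    rfl
  rw [h1]
  refine Finset.card_bij (fun v _ => (s, v.1)) (fun v hv => ?_) (fun v _ u _ h => ?_) ?_
  · simpa using (hA v).1 hv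
  · exact Subtype.ext (Prod.ext_iff.1 h).2
  · rintro ⟨c, i⟩ hp
    simp only [List.mem_toFinset, List.mem_filter, decide_eq_true_eq] at hp
    obtain ⟨hp, rfl⟩ := hp
    exact ⟨letterVertex ν hp, (hA _).2 hp, rfl⟩

theorem card_indexI : (indexI ν).card = ν.count Step.E + 1 := by
  rw [card_filter_letter ν Step.E _ fun v => mem_indexI ν]
  simp

theorem card_indexJ : (indexJ ν).card = ν.count Step.N + 1 := by
  rw [card_filter_letter ν Step.N _ fun v => mem_indexJ ν]
  simp

theorem exists_valley_between {i j : Vertex ν} (hi : i ∈ indexI ν) (hj : j ∈ indexJ ν)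
    (hij : i ≤ j) : ∃ k : Fin (numValleys ν), i ≤ valley ν k ∧ valley ν k ≤ j := by
  obtain ⟨m, h1, h2, h3, h4⟩ :=
    exists_valley_canonicalIndexing ((mem_indexI ν).1 hi) ((mem_indexJ ν).1 hj) hij
  have hm : letterVertex ν h1 ∈ valleys ν :=
    Finset.mem_inter.2 ⟨(mem_indexI ν).2 h1, (mem_indexJ ν).2 h2⟩
  have : letterVertex ν h1 ∈ Set.range ((valleys ν).orderEmbOfFin rfl) := by
    rw [Finset.range_orderEmbOfFin]; exact hm
  obtain ⟨k, hk⟩ := this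
  have hk' : valley ν k = letterVertex ν h1 := hk
  exact ⟨k, hk' ▸ h3, hk' ▸ h4⟩

theorem exists_indexJ_ge (v : Vertex ν) : ∃ j ∈ indexJ ν, v ≤ j := by
  obtain ⟨p, hp, hv⟩ := List.mem_map.1 (List.mem_toFinset.1 v.2)
  obtain ⟨j, h1, h2⟩ := exists_le_north_canonicalIndexing (by simp [List.getLast?_cons]) hp
  exact ⟨letterVertex ν h1, (mem_indexJ ν).2 h1, by change v.1 ≤ j; omega⟩

theorem exists_indexI_le (v : Vertex ν) : ∃ i ∈ indexI ν, i ≤ v := by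
  obtain ⟨p, hp, hv⟩ := List.mem_map.1 (List.mem_toFinset.1 v.2)
  have h1 : (Step.E, 1) ∈ indexedWord ν := by
    unfold indexedWord
    generalize ν ++ [Step.N] = l
    cases l with
    | nil => simp [canonicalIndexing]
    | cons d l => cases d <;> simp [canonicalIndexing]
  refine ⟨letterVertex ν h1, (mem_indexI ν).2 h1, ?_⟩
  change 1 ≤ v.1
  have := le_of_mem_canonicalIndexing hp
  omega

theorem valley_strictMono : StrictMono (valley ν) := ((valleys ν).orderEmbOfFin rfl).strictMono

theorem valley_mem_valleys (k : Fin (numValleys ν)) : valley ν k ∈ valleys ν :=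
  Finset.orderEmbOfFin_mem _ _ _

theorem exists_valley_eq {v : Vertex ν} (hv : v ∈ valleys ν) : ∃ k, valley ν k = v := by
  have : v ∈ Set.range ((valleys ν).orderEmbOfFin rfl) := by
    rw [Finset.range_orderEmbOfFin]; exact hv
  exact this

/-- The position of the valley next to `v`. -/
theorem exists_nearest_valley (v : Vertex ν) : ∃ k : Fin (numValleys ν),
    (v ∈ indexI ν → v ∈ indexJ ν → valley ν k = v) ∧
    (v ∈ indexI ν → v ∉ indexJ ν → v < valley ν k ∧ ∀ l, v < valley ν l → k ≤ l) ∧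
    (v ∈ indexJ ν → v ∉ indexI ν → valley ν k < v ∧ ∀ l, valley ν l < v → l ≤ k) := by
  have hval := fun k => Finset.mem_inter.1 (valley_mem_valleys ν k)
  by_cases hI : v ∈ indexI ν <;> by_cases hJ : v ∈ indexJ ν
  · obtain ⟨k, hk⟩ := exists_valley_eq ν (Finset.mem_inter.2 ⟨hI, hJ⟩)
    exact ⟨k, fun _ _ => hk, fun _ h => absurd hJ h, fun _ h => absurd hI h⟩
  · obtain ⟨j, hj, hvj⟩ := exists_indexJ_ge ν v
    obtain ⟨k₀, hk₀, -⟩ := exists_valley_between ν hI hj hvj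
    have hk₀' : v < valley ν k₀ := hk₀.lt_of_ne fun h => hJ (h ▸ (hval k₀).2)
    have hne : (Finset.univ.filter fun k => v < valley ν k).Nonempty := ⟨k₀, by simpa using hk₀'⟩
    refine ⟨_, fun _ h => absurd h hJ, fun _ _ => ⟨(Finset.mem_filter.1 (Finset.min'_mem _ hne)).2,
      fun l hl => Finset.min'_le _ _ (by simpa using hl)⟩, fun h => absurd h hJ⟩
  · obtain ⟨i, hi, hvi⟩ := exists_indexI_le ν v
    obtain ⟨k₀, -, hk₀⟩ := exists_valley_between ν hi hJ hvi
    have hk₀' : valley ν k₀ < v := hk₀.lt_of_ne fun h => hI (h ▸ (hval k₀).1)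
    have hne : (Finset.univ.filter fun k => valley ν k < v).Nonempty := ⟨k₀, by simpa using hk₀'⟩
    refine ⟨_, fun h => absurd h hI, fun h => absurd h hI,
      fun _ _ => ⟨(Finset.mem_filter.1 (Finset.max'_mem _ hne)).2,
      fun l hl => Finset.le_max' _ _ (by simpa using hl)⟩⟩
  · exact absurd (mem_indexI_or_mem_indexJ ν v) (by tauto)

/-- The caterpillar `G_B(ν)`. -/
noncomputable def pathCaterpillar : Caterpillar (indexI ν) (indexJ ν) where
  w := numValleys ν
  valley := valley ν
  valley_injective := (valley_strictMono ν).injective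
  valley_mem k := Finset.mem_inter.1 (valley_mem_valleys ν k)
  exists_valley v h1 h2 := exists_valley_eq ν (Finset.mem_inter.2 ⟨h1, h2⟩)
  index v := (exists_nearest_valley ν v).choose
  index_valley k := by
    have h := Finset.mem_inter.1 (valley_mem_valleys ν k)
    exact (valley_strictMono ν).injective
      ((exists_nearest_valley ν (valley ν k)).choose_spec.1 h.1 h.2)
  mem_or_mem := mem_indexI_or_mem_indexJ ν

variable {ν}

theorem index_source {v : Vertex ν} (hI : v ∈ indexI ν) (hJ : v ∉ indexJ ν) :
    v < valley ν ((pathCaterpillar ν).index v) ∧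
      ∀ l, v < valley ν l → (pathCaterpillar ν).index v ≤ l :=
  (exists_nearest_valley ν v).choose_spec.2.1 hI hJ

theorem index_sink {v : Vertex ν} (hJ : v ∈ indexJ ν) (hI : v ∉ indexI ν) :
    valley ν ((pathCaterpillar ν).index v) < v ∧
      ∀ l, valley ν l < v → l ≤ (pathCaterpillar ν).index v :=
  (exists_nearest_valley ν v).choose_spec.2.2 hJ hI

/-- Between E_i and a later N_j there is always a valley, so at least one end of an edge is a
valley. A leaf sees exactly one valley without another in between, and two valleys are joined only
if they are consecutive. -/
theorem mem_graphGB {e : SignedEdge (Vertex ν)} : e ∈ graphGB ν ↔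
    (e.lo ∈ indexI ν ∧ e.lo ∉ indexJ ν ∧ e.hi = valley ν ((pathCaterpillar ν).index e.lo) ∧
      e.kind = .forward) ∨
    (e.hi ∈ indexJ ν ∧ e.hi ∉ indexI ν ∧ e.lo = valley ν ((pathCaterpillar ν).index e.hi) ∧
      e.kind = .forward) ∨
    ∃ k, ∃ h : k.1 + 1 < numValleys ν, e.lo = valley ν k ∧ e.hi = valley ν ⟨k.1 + 1, h⟩ ∧
      e.kind = .bidirectional := by
  have hval := fun k => Finset.mem_inter.1 (valley_mem_valleys ν k)
  have hmono := valley_strictMono ν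
  simp only [graphGB, Finset.mem_filter, Finset.mem_univ, true_and]
  constructor
  · rintro ⟨hlo, hhi, hbetween, hkind⟩
    by_cases h1 : e.lo ∈ indexJ ν
    · have hlov : e.lo ∈ valleys ν := Finset.mem_inter.2 ⟨hlo, h1⟩
      obtain ⟨k, hk⟩ := exists_valley_eq ν hlov
      have hmax : ∀ l, valley ν l < e.hi → l ≤ k := by
        intro l hl
        by_contra hlt
        rw [not_le] at hlt
        rcases hbetween _ (valley_mem_valleys ν l) (hk ▸ (hmono hlt).le) hl.le with h | h
        · exact (hmono hlt).ne (hk.trans h.symm)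
        · exact hl.ne h
      by_cases h2 : e.hi ∈ indexI ν
      · have hhiv : e.hi ∈ valleys ν := Finset.mem_inter.2 ⟨h2, hhi⟩
        obtain ⟨m, hm⟩ := exists_valley_eq ν hhiv
        rw [if_pos ⟨hlov, hhiv⟩] at hkind
        have hkm : k < m := by
          rw [← hmono.lt_iff_lt, hk, hm]; exact e.lt
        have h : k.1 + 1 < numValleys ν := lt_of_le_of_lt hkm m.2
        have hmk : m = ⟨k.1 + 1, h⟩ := by
          by_contra hne
          have hlt : (⟨k.1 + 1, h⟩ : Fin (numValleys ν)) < m := by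
            refine lt_of_le_of_ne ?_ (Ne.symm hne)
            exact Nat.succ_le_of_lt hkm
          have := hmax ⟨k.1 + 1, h⟩ (hm ▸ hmono hlt)
          exact absurd (show k.1 + 1 ≤ k.1 from this) (by omega)
        exact Or.inr (Or.inr ⟨k, h, hk.symm, by rw [← hmk, hm], hkind⟩)
      · rw [if_neg fun h => h2 (Finset.mem_inter.1 h.2).1] at hkind
        have hs := index_sink hhi h2
        have : (pathCaterpillar ν).index e.hi = k := le_antisymm (hmax _ hs.1) (hs.2 k (hk ▸ e.lt))
        exact Or.inr (Or.inl ⟨hhi, h2, by rw [this, hk], hkind⟩)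
    · rw [if_neg fun h => h1 (Finset.mem_inter.1 h.1).2] at hkind
      -- The lower end is not a valley, so a valley on the way must be the upper end.
      obtain ⟨k, hk1, hk2⟩ := exists_valley_between ν hlo hhi e.lt.le
      have hk : valley ν k = e.hi := by
        rcases hbetween _ (valley_mem_valleys ν k) hk1 hk2 with h | h
        · exact absurd (h ▸ (hval k).2) h1
        · exact h
      have hs := index_source hlo h1
      have hidx : (pathCaterpillar ν).index e.lo ≤ k := hs.2 k (hk ▸ e.lt)
      have : valley ν ((pathCaterpillar ν).index e.lo) = e.hi := by
        rcases hbetween _ (valley_mem_valleys ν _) hs.1.le (hk ▸ hmono.monotone hidx) with h | h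
        · exact absurd h hs.1.ne'
        · exact h
      exact Or.inl ⟨hlo, h1, this.symm, hkind⟩
  · rintro (⟨h1, h2, h3, h4⟩ | ⟨h1, h2, h3, h4⟩ | ⟨k, h, h3, h4, h5⟩)
    · have hs := index_source h1 h2
      refine ⟨h1, h3 ▸ (hval _).2, fun k hk hk1 hk2 => Or.inr ?_, ?_⟩
      · obtain ⟨l, rfl⟩ := exists_valley_eq ν hk
        have hlt : e.lo < valley ν l := hk1.lt_of_ne fun h => h2 (h ▸ (hval l).2)
        exact le_antisymm hk2 (h3 ▸ hmono.monotone (hs.2 l hlt))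
      · rw [if_neg fun h => h2 (Finset.mem_inter.1 h.1).2, h4]
    · have hs := index_sink h1 h2
      refine ⟨h3 ▸ (hval _).1, h1, fun k hk hk1 hk2 => Or.inl ?_, ?_⟩
      · obtain ⟨l, rfl⟩ := exists_valley_eq ν hk
        have hlt : valley ν l < e.hi := hk2.lt_of_ne fun h => h2 (h ▸ (hval l).1)
        exact le_antisymm (h3 ▸ hmono.monotone (hs.2 l hlt)) hk1
      · rw [if_neg fun h => h2 (Finset.mem_inter.1 h.2).1, h4]
    · refine ⟨h3 ▸ (hval _).1, h4 ▸ (hval _).2, fun l hl hl1 hl2 => ?_, ?_⟩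
      · obtain ⟨m, rfl⟩ := exists_valley_eq ν hl
        rw [h3, hmono.le_iff_le] at hl1
        rw [h4, hmono.le_iff_le] at hl2
        rw [h3, h4, hmono.injective.eq_iff, hmono.injective.eq_iff]
        have h1 : k.1 ≤ m.1 := hl1
        have h2 : m.1 ≤ k.1 + 1 := hl2
        rcases Nat.eq_or_lt_of_le h1 with h | h
        · exact Or.inl (Fin.ext h.symm)
        · exact Or.inr (Fin.ext (by simp only; omega))
      · rw [h3, h4, if_pos ⟨valley_mem_valleys ν _, valley_mem_valleys ν _⟩, h5]

end Words

/-! ### A criterion for integral equivalence -/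

section Integral

variable {ι κ : Type} [Fintype ι] [Fintype κ]

/-- The image of the affine span is the span of the image, so only injectivity and the comparison of
lattice points on the span of P remain. -/
theorem isIntegralEquivalence_image {φ : (ι → ℝ) →ᵃ[ℝ] (κ → ℝ)} {P : Set (ι → ℝ)}
    (hinj : InjOn φ (affineSpan ℝ P))
    (hint : ∀ x ∈ affineSpan ℝ P, x ∈ latticePoints ι ↔ φ x ∈ latticePoints κ) :
    IsIntegralEquivalence φ P (φ '' P) := by
  refine ⟨(hinj.mono (subset_affineSpan ℝ P)).bijOn_image, ?_⟩
  have hspan : (affineSpan ℝ (φ '' P) : Set (κ → ℝ)) = φ '' (affineSpan ℝ P) := by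
    rw [← AffineSubspace.map_span, AffineSubspace.coe_map]
  rw [hspan]
  refine ⟨fun x hx => ⟨(hint x hx.2).1 hx.1, mem_image_of_mem φ hx.2⟩,
    hinj.mono inter_subset_right, ?_⟩
  rintro _ ⟨hy, x, hx, rfl⟩
  exact ⟨x, ⟨(hint x hx).2 hy, hx⟩, rfl⟩

end Integral

/-! ### Signed flows versus nonnegative weights of directed edges -/

section Orientation

variable {V : Type} [LinearOrder V]

/-- An orientation of the edges of `G` which identifies `G` with the set `A` of directed edges;
`sign e = 1` if `e` is oriented upwards. -/
structure EdgeOrientation (G : Finset (SignedEdge V)) (A : Finset (Gen V)) where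
  equiv : {e // e ∈ G} ≃ {g // g ∈ A}
  sign : {e // e ∈ G} → ℤ
  spec : ∀ e, (sign e = 1 ∧ (equiv e).1.1 = (e.1.lo, e.1.hi)) ∨
    (sign e = -1 ∧ (equiv e).1.1 = (e.1.hi, e.1.lo))

namespace EdgeOrientation

variable {G : Finset (SignedEdge V)} {A : Finset (Gen V)} (o : EdgeOrientation G A)

theorem sign_mul_sign (e : {e // e ∈ G}) : (o.sign e : ℝ) * o.sign e = 1 := by
  rcases o.spec e with ⟨h, -⟩ | ⟨h, -⟩ <;> simp [h]

/-- The weights of the directed edges that correspond to a signed flow. -/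
def weight : ({e // e ∈ G} → ℝ) →ₗ[ℝ] (Gen V → ℝ) where
  toFun z g := if h : g ∈ A then o.sign (o.equiv.symm ⟨g, h⟩) * z (o.equiv.symm ⟨g, h⟩) else 0
  map_add' z z' := by ext g; by_cases h : g ∈ A <;> simp [h, mul_add]
  map_smul' r z := by ext g; by_cases h : g ∈ A <;> simp [h, mul_left_comm]

/-- The signed flow that corresponds to weights of the directed edges. -/
def flow : (Gen V → ℝ) →ₗ[ℝ] ({e // e ∈ G} → ℝ) where
  toFun c e := o.sign e * c (o.equiv e).1
  map_add' c c' := by ext e; simp [mul_add]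
  map_smul' r c := by ext e; simp [mul_left_comm]

theorem flow_apply (c : Gen V → ℝ) (e : {e // e ∈ G}) : o.flow c e = o.sign e * c (o.equiv e).1 :=
  rfl

theorem weight_mem (z : {e // e ∈ G} → ℝ) : o.weight z ∈ supportedIn A := fun _ hg => dif_neg hg

theorem weight_equiv (z : {e // e ∈ G} → ℝ) (e : {e // e ∈ G}) :
    o.weight z (o.equiv e).1 = o.sign e * z e := by
  change (if h : (o.equiv e).1 ∈ A then _ else _) = _
  rw [dif_pos (o.equiv e).2]
  simp

theorem flow_weight (z : {e // e ∈ G} → ℝ) : o.flow (o.weight z) = z := by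
  ext e
  rw [flow_apply, weight_equiv, ← mul_assoc, sign_mul_sign, one_mul]

theorem weight_flow {c : Gen V → ℝ} (hc : c ∈ supportedIn A) : o.weight (o.flow c) = c := by
  ext g
  by_cases h : g ∈ A
  · obtain ⟨e, he⟩ := o.equiv.surjective ⟨g, h⟩
    have : g = (o.equiv e).1 := by rw [he]
    rw [this, weight_equiv, flow_apply, ← mul_assoc, sign_mul_sign, one_mul]
  · rw [hc g h, o.weight_mem _ g h]

/-- Reversing an edge changes the sign of its net vector and of its weight, so the contribution of
each edge to the netflow is unchanged. -/
theorem boundary_weight [Fintype V] [DecidableEq V] (z : {e // e ∈ G} → ℝ) (v : V) : boundary (o.weight z) v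
    = (∑ e, if e.1.lo = v then z e else 0) - ∑ e, if e.1.hi = v then z e else 0 := by
  rw [boundary_apply, ← Finset.sum_sub_distrib,
    ← Finset.sum_subset (Finset.subset_univ A) fun g _ hg => by rw [o.weight_mem z g hg, zero_mul],
    ← Finset.sum_coe_sort, ← o.equiv.sum_comp]
  refine Finset.sum_congr rfl fun e _ => ?_
  rw [weight_equiv]
  rcases o.spec e with ⟨h1, h2⟩ | ⟨h1, h2⟩ <;> rw [h1, h2] <;> simp only [Int.cast_one, Int.cast_neg] <;>
    split_ifs <;> ring

theorem int_flow {c : Gen V → ℝ} (hc : ∀ g, ∃ z : ℤ, c g = z) (e : {e // e ∈ G}) :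
    ∃ z : ℤ, o.flow c e = z := by
  obtain ⟨z, hz⟩ := hc (o.equiv e).1
  exact ⟨o.sign e * z, by rw [flow_apply, hz]; push_cast; ring⟩

end EdgeOrientation

/-- The signed edge of a directed edge. -/
def genEdge (g : Gen V) : SignedEdge V :=
  if h : g.1.1 < g.1.2 then ⟨g.1.1, g.1.2, h, .forward⟩
  else ⟨g.1.2, g.1.1, lt_of_le_of_ne (not_lt.1 h) g.2.symm, .backward⟩

theorem genEdge_of_lt {g : Gen V} (h : g.1.1 < g.1.2) :
    genEdge g = ⟨g.1.1, g.1.2, h, .forward⟩ := dif_pos h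

theorem genEdge_of_gt {g : Gen V} (h : g.1.2 < g.1.1) :
    genEdge g = ⟨g.1.2, g.1.1, h, .backward⟩ := dif_neg h.not_gt

theorem genEdge_kind_ne (g : Gen V) : (genEdge g).kind ≠ .bidirectional := by
  rcases lt_or_gt_of_ne g.2 with h | h
  · rw [genEdge_of_lt h]; simp
  · rw [genEdge_of_gt h]; simp

theorem genEdge_injective : Function.Injective (genEdge : Gen V → SignedEdge V) := by
  intro g g' hgg
  rcases lt_or_gt_of_ne g.2 with h | h <;> rcases lt_or_gt_of_ne g'.2 with h' | h'
  · rw [genEdge_of_lt h, genEdge_of_lt h', SignedEdge.mk.injEq] at hgg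
    exact Subtype.ext (Prod.ext hgg.1 hgg.2.1)
  · rw [genEdge_of_lt h, genEdge_of_gt h', SignedEdge.mk.injEq] at hgg
    simp at hgg
  · rw [genEdge_of_gt h, genEdge_of_lt h', SignedEdge.mk.injEq] at hgg
    simp at hgg
  · rw [genEdge_of_gt h, genEdge_of_gt h', SignedEdge.mk.injEq] at hgg
    exact Subtype.ext (Prod.ext hgg.2.1 hgg.1)

theorem edgeGenerator_genEdge (g : Gen V) : edgeGenerator (genEdge g) = MvPolynomial.X g := by
  rcases lt_or_gt_of_ne g.2 with h | h
  · rw [genEdge_of_lt h]; rfl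
  · rw [genEdge_of_gt h]; rfl

/-- The graph of a set of directed edges. -/
def toGraph (A : Finset (Gen V)) : Finset (SignedEdge V) := A.image genEdge

theorem toGraph_injective : Function.Injective (toGraph : Finset (Gen V) → Finset (SignedEdge V)) :=
  Finset.image_injective genEdge_injective

theorem kind_ne_of_mem_toGraph {A : Finset (Gen V)} {e : SignedEdge V} (he : e ∈ toGraph A) :
    e.kind ≠ .bidirectional := by
  obtain ⟨g, -, rfl⟩ := Finset.mem_image.1 he
  exact genEdge_kind_ne g

theorem graphMonomial_toGraph (A : Finset (Gen V)) :
    graphMonomial (toGraph A) = ∏ g ∈ A, MvPolynomial.X g := by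
  rw [graphMonomial, toGraph, Finset.prod_image genEdge_injective.injOn]
  exact Finset.prod_congr rfl fun g _ => edgeGenerator_genEdge g

theorem graphMonomial_sum (N : ℕ) [Fintype V] (𝒜 : Finset (Finset (Gen V))) : fanPoly N 𝒜
    = ∑ A ∈ 𝒜, betaElt ^ (N - A.card) * graphMonomial (toGraph A) :=
  Finset.sum_congr rfl fun A _ => by rw [graphMonomial_toGraph]

/-- The correspondence of directed edges and signed edges. -/
noncomputable def toGraphEquiv (A : Finset (Gen V)) : {g // g ∈ A} ≃ {e // e ∈ toGraph A} :=
  Equiv.ofBijective (fun g => ⟨genEdge g.1, Finset.mem_image_of_mem _ g.2⟩)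
    ⟨fun g g' h => Subtype.ext (genEdge_injective (congrArg Subtype.val h)), fun e => by
      obtain ⟨g, hg, he⟩ := Finset.mem_image.1 e.2
      exact ⟨⟨g, hg⟩, Subtype.ext he⟩⟩

/-- The tautological orientation of `toGraph A`. -/
noncomputable def toGraphOrientation (A : Finset (Gen V)) : EdgeOrientation (toGraph A) A where
  equiv := (toGraphEquiv A).symm
  sign e := if e.1.kind = .forward then 1 else -1
  spec e := by
    obtain ⟨g, rfl⟩ := (toGraphEquiv A).surjective e
    rw [Equiv.symm_apply_apply]
    have hg : (toGraphEquiv A g).1 = genEdge g.1 := rfl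
    rw [hg]
    rcases lt_or_gt_of_ne g.1.2 with h | h
    · rw [genEdge_of_lt h]
      exact Or.inl ⟨rfl, rfl⟩
    · rw [genEdge_of_gt h]
      exact Or.inr ⟨rfl, rfl⟩

/-- Backward edges carry nonpositive flow and sign -1, so both kinds of sign condition become
nonnegativity of the weight. -/
theorem toGraphOrientation_nonneg (A : Finset (Gen V)) (z : {e // e ∈ toGraph A} → ℝ) :
    0 ≤ (toGraphOrientation A).weight z ↔ (∀ e, e.1.kind = .forward → 0 ≤ z e) ∧
      ∀ e, e.1.kind = .backward → z e ≤ 0 := by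
  set o := toGraphOrientation A with ho
  have hsign : ∀ e, o.sign e = if e.1.kind = .forward then 1 else -1 := fun _ => rfl
  constructor
  · intro h
    constructor <;> intro e he <;> have := h (o.equiv e).1 <;>
      rw [o.weight_equiv, hsign, he] at this <;> simpa using this
  · rintro ⟨h1, h2⟩ g
    by_cases hg : g ∈ A
    · obtain ⟨e, he⟩ := o.equiv.surjective ⟨g, hg⟩
      have : g = (o.equiv e).1 := by rw [he]
      rw [this, o.weight_equiv, hsign]
      have hk := kind_ne_of_mem_toGraph e.2
      cases hkind : e.1.kind with
      | forward => simpa using h1 e hkind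
      | backward => simpa using h2 e hkind
      | bidirectional => exact absurd hkind hk
    · exact (o.weight_mem z g hg).ge

end Orientation

/-! ### Flow polytopes of augmentations as cells of cones -/

section AugFlow

variable {ν : List Step}

/-- Conservation at the source and at the sink normalizes the two families of end values; at an
inner vertex it equates the net vector of the weights with that of the end values. -/
theorem mem_augFlow {G : Finset (SignedEdge (Vertex ν))} {A : Finset (Gen (Vertex ν))}
    (o : EdgeOrientation G A) {z : AugEdge ν G → ℝ} : z ∈ augFlow ν G ↔
      (fun k => z (.inr k)) ∈ endsPolytope (indexI ν) (indexJ ν) ∧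
      boundary (o.weight fun e => z (.inl e)) = netMap (indexI ν) (indexJ ν) (fun k => z (.inr k)) ∧
      (∀ e : {e // e ∈ G}, e.1.kind = .forward → 0 ≤ z (.inl e)) ∧
      (∀ e : {e // e ∈ G}, e.1.kind = .backward → z (.inl e) ≤ 0) := by
  have hinner : ∀ u v : Vertex ν, innerVertex ν u = innerVertex ν v ↔ u = v := fun u v => by
    simp [innerVertex]
  have hbot : ∀ u : Vertex ν, innerVertex ν u ≠ ⊥ := fun u => by simp [innerVertex]
  have htop : ∀ u : Vertex ν, innerVertex ν u ≠ ⊤ := fun u h => by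
    have := WithBot.coe_eq_coe.1 (h : ((u : WithTop (Vertex ν)) : AugVertex ν) = ((⊤ : WithTop (Vertex ν)) : AugVertex ν))
    exact WithTop.coe_ne_top this
  have hbt : (⊥ : AugVertex ν) ≠ ⊤ := bot_ne_top
  have hnet : ∀ v : Vertex ν, netMap (indexI ν) (indexJ ν) (fun k => z (.inr k)) v
      = (∑ i : {i // i ∈ indexI ν}, if i.1 = v then z (.inr (.inl i)) else 0)
        - ∑ j : {j // j ∈ indexJ ν}, if j.1 = v then z (.inr (.inr j)) else 0 := by
    intro v
    have := sum_mul_netMap (indexI ν) (indexJ ν) (fun u => if u = v then 1 else 0) (fun k => z (.inr k))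
    simpa [-Finset.univ_eq_attach] using this
  have hcons : (∀ v : AugVertex ν, (∑ e : AugEdge ν G, if (augmentation ν G e).lo = v then z e else 0)
          - (∑ e : AugEdge ν G, if (augmentation ν G e).hi = v then z e else 0)
          = (if v = ⊥ then 1 else 0) - (if v = ⊤ then 1 else 0)) ↔
      (∑ i, z (.inr (.inl i)) = 1 ∧ ∑ j, z (.inr (.inr j)) = 1) ∧
      boundary (o.weight fun e => z (.inl e)) = netMap (indexI ν) (indexJ ν) (fun k => z (.inr k)) := by
    have e1 : ∀ v : AugVertex ν, (∑ e : AugEdge ν G, if (augmentation ν G e).lo = v then z e else 0)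
        = (∑ e : {e // e ∈ G}, if innerVertex ν e.1.lo = v then z (.inl e) else 0)
          + ((∑ i, if ⊥ = v then z (.inr (.inl i)) else 0)
            + ∑ j : {j // j ∈ indexJ ν}, if innerVertex ν j.1 = v then z (.inr (.inr j)) else 0) := by
      intro v
      rw [Fintype.sum_sum_type, Fintype.sum_sum_type]
      rfl
    have e2 : ∀ v : AugVertex ν, (∑ e : AugEdge ν G, if (augmentation ν G e).hi = v then z e else 0)
        = (∑ e : {e // e ∈ G}, if innerVertex ν e.1.hi = v then z (.inl e) else 0)
          + ((∑ i : {i // i ∈ indexI ν}, if innerVertex ν i.1 = v then z (.inr (.inl i)) else 0)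
            + ∑ j, if ⊤ = v then z (.inr (.inr j)) else 0) := by
      intro v
      rw [Fintype.sum_sum_type, Fintype.sum_sum_type]
      rfl
    simp only [e1, e2]
    constructor
    · intro h
      refine ⟨⟨?_, ?_⟩, ?_⟩
      · have := h ⊥
        simpa [-Finset.univ_eq_attach, hbot, hbt, hbt.symm] using this
      · have := h ⊤
        simpa [-Finset.univ_eq_attach, htop, hbt, hbt.symm] using this
      · ext v
        have := h (innerVertex ν v)
        simp only [hinner, hbot, htop, (hbot _).symm, (htop _).symm, if_false, Finset.sum_const_zero,
          zero_add, add_zero, sub_zero] at this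
        rw [o.boundary_weight, hnet]
        linarith
    · rintro ⟨⟨h1, h2⟩, h3⟩ v
      induction v using WithBot.recBotCoe with
      | bot => simpa [-Finset.univ_eq_attach, hbot, hbt, hbt.symm] using h1
      | coe v =>
        induction v using WithTop.recTopCoe with
        | top =>
          change _ - _ = (if (⊤ : AugVertex ν) = ⊥ then (1 : ℝ) else 0) - if (⊤ : AugVertex ν) = ⊤ then (1 : ℝ) else 0
          have hct : ((⊤ : WithTop (Vertex ν)) : AugVertex ν) = ⊤ := rfl
          simpa [-Finset.univ_eq_attach, htop, hbt, hbt.symm, hct] using h2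
        | coe v =>
          have hv : ((v : WithTop (Vertex ν)) : AugVertex ν) = innerVertex ν v := rfl
          have := congrFun h3 v
          rw [o.boundary_weight, hnet] at this
          simp only [hv, hinner, hbot, htop, (hbot _).symm, (htop _).symm, if_false,
            Finset.sum_const_zero, zero_add, add_zero, sub_zero]
          linarith
  unfold augFlow flowPolytope
  rw [mem_ofPred_eq]
  refine (and_congr_left' (Iff.trans (by congr!) hcons)).trans ?_
  constructor
  · rintro ⟨⟨h1, h2⟩, h3, h4⟩
    refine ⟨⟨?_, h1⟩, h2, fun e he => h3 (.inl e) he, fun e he => h4 (.inl e) he⟩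
    rintro (k | k)
    · exact h3 (.inr (.inl k)) rfl
    · exact h3 (.inr (.inr k)) rfl
  · rintro ⟨⟨h0, h1⟩, h2, h3, h4⟩
    refine ⟨⟨h1, h2⟩, ?_, ?_⟩
    · rintro (e | k | k) he
      · exact h3 e he
      · exact h0 (.inl k)
      · exact h0 (.inr k)
    · rintro (e | k | k) he
      · exact h4 e he
      · cases he
      · cases he

/-- The inner edges of a flow are exactly a choice of nonnegative weights with the prescribed net
vector. -/
theorem image_inr_augFlow (A : Finset (Gen (Vertex ν))) :
    (fun (z : AugEdge ν (toGraph A) → ℝ) k => z (.inr k)) '' augFlow ν (toGraph A)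
      = coneFace (indexI ν) (indexJ ν) A ∅ := by
  set o := toGraphOrientation A with ho
  ext x
  constructor
  · rintro ⟨z, hz, rfl⟩
    rw [mem_augFlow o, ← toGraphOrientation_nonneg] at hz
    exact ⟨hz.1, _, o.weight_mem _, hz.2.2, hz.2.1, by simp⟩
  · rintro ⟨hx, c, hc, h0, hb, -⟩
    refine ⟨Sum.elim (o.flow c) x, ?_, rfl⟩
    rw [mem_augFlow o, ← toGraphOrientation_nonneg]
    simp only [Sum.elim_inl, Sum.elim_inr]
    have : (o.weight fun e => o.flow c e) = c := o.weight_flow hc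
    rw [← ho, this]
    exact ⟨hx, hb, h0⟩

/-- Forgetting the inner edges loses nothing: independence of A determines their values, and
unimodularity makes them integral when the end values are. -/
theorem integrallyEquivalent_coneFace {W W' : Set (Vertex ν → ℝ)} {N : ℕ}
    {𝒜 : Finset (Finset (Gen (Vertex ν)))} (h : IsFan W W' N 𝒜) {A : Finset (Gen (Vertex ν))}
    (hA : A ∈ 𝒜) {κ : Type} [Fintype κ]
    {f : (Ends (indexI ν) (indexJ ν) → ℝ) →ₗ[ℝ] (κ → ℝ)} (hf : Function.Injective f)
    (hint : ∀ x : Ends (indexI ν) (indexJ ν) → ℝ, ∑ v, netMap (indexI ν) (indexJ ν) x v = 0 →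
      (x ∈ latticePoints _ ↔ f x ∈ latticePoints κ)) :
    IntegrallyEquivalent (augFlow ν (toGraph A)) (f '' coneFace (indexI ν) (indexJ ν) A ∅) := by
  set o := toGraphOrientation A with ho
  let r : (AugEdge ν (toGraph A) → ℝ) →ₗ[ℝ] (Ends (indexI ν) (indexJ ν) → ℝ) :=
    LinearMap.funLeft ℝ ℝ Sum.inr
  let l : (AugEdge ν (toGraph A) → ℝ) →ₗ[ℝ] ({e // e ∈ toGraph A} → ℝ) :=
    LinearMap.funLeft ℝ ℝ Sum.inl
  have hr : ∀ z, r z = fun k => z (.inr k) := fun _ => rfl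
  have hl : ∀ z, l z = fun e => z (.inl e) := fun _ => rfl
  -- Conservation is an affine equation, so it persists on the affine span.
  have hspan : ∀ z ∈ affineSpan ℝ (augFlow ν (toGraph A)),
      boundary (o.weight (l z)) = netMap (indexI ν) (indexJ ν) (r z) := by
    intro z hz
    exact AffineMap.eqOn_affineSpan (f := (boundary ∘ₗ o.weight ∘ₗ l).toAffineMap)
      (g := (netMap (indexI ν) (indexJ ν) ∘ₗ r).toAffineMap)
      (fun z hz => ((mem_augFlow o).1 hz).2.1) hz
  refine ⟨(f ∘ₗ r).toAffineMap, ?_⟩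
  have himg : f '' coneFace (indexI ν) (indexJ ν) A ∅
      = (f ∘ₗ r).toAffineMap '' augFlow ν (toGraph A) := by
    rw [← image_inr_augFlow, image_image]
    rfl
  rw [himg]
  refine isIntegralEquivalence_image (fun z hz z' hz' hzz => ?_) fun z hz => ?_
  · have h1 : r z = r z' := hf hzz
    have h2 : o.weight (l z) = o.weight (l z') := by
      rw [← sub_eq_zero]
      refine h.indep hA ((supportedIn A).sub_mem (o.weight_mem _) (o.weight_mem _)) ?_
      rw [map_sub, hspan z hz, hspan z' hz', h1, sub_self]
    have h3 : l z = l z' := by rw [← o.flow_weight (l z), h2, o.flow_weight]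
    ext (e | k)
    · exact congrFun h3 e
    · exact congrFun h1 k
  · have hb := hspan z hz
    have hsum : ∑ v, netMap (indexI ν) (indexJ ν) (r z) v = 0 := by rw [← hb, sum_boundary]
    change _ ↔ f (r z) ∈ _
    rw [← hint _ hsum]
    refine ⟨fun hz k => hz (.inr k), fun hrz => ?_⟩
    have hw := h.integral A hA _ (o.weight_mem (l z)) fun v => by
      rw [hb, netMap_apply]
      by_cases h1 : v ∈ indexI ν <;> by_cases h2 : v ∈ indexJ ν
      · obtain ⟨a, ha⟩ := hrz (.inl ⟨v, h1⟩)
        obtain ⟨b, hb⟩ := hrz (.inr ⟨v, h2⟩)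
        exact ⟨a - b, by simp [h1, h2, ha, hb]⟩
      · obtain ⟨a, ha⟩ := hrz (.inl ⟨v, h1⟩)
        exact ⟨a, by simp [h1, h2, ha]⟩
      · obtain ⟨b, hb⟩ := hrz (.inr ⟨v, h2⟩)
        exact ⟨-b, by simp [h1, h2, hb]⟩
      · exact ⟨0, by simp [h1, h2]⟩
    rintro (e | k)
    · have := o.int_flow hw e
      rwa [o.flow_weight] at this
    · exact hrz k

end AugFlow

/-! ### Intersections and monomials of the caterpillar graphs -/

namespace Caterpillar

variable {V : Type} [Fintype V] [DecidableEq V] {I J : Finset V} (Γ : Caterpillar I J)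

theorem mem_of_spine_mem_graph {S : Finset (Fin Γ.w)} {g : Gen V} (hg : g ∈ Γ.graph S)
    {k : Fin Γ.w} (h1 : g.1.1 = Γ.valley k) (h2 : g.1.2 = Γ.valley (Γ.next k)) : k ∉ S := by
  rcases Γ.mem_graph.1 hg with h | h | ⟨l, hl, h, -⟩
  · exact absurd (h1 ▸ (Γ.valley_mem k).2) h.2.1
  · exact absurd (h2 ▸ (Γ.valley_mem _).1) h.2.1
  · rwa [Γ.valley_injective (h1.symm.trans h)]

/-- The spine edge that begins at k tells whether k ∈ S. The empty set is excluded because for a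
spine with one vertex it gives the same graph as the full set. -/
theorem graph_injOn : Set.InjOn Γ.graph {S | S.Nonempty} := by
  have key : ∀ S T : Finset (Fin Γ.w), T.Nonempty → Γ.graph S = Γ.graph T → S ⊆ T := by
    intro S T hT h k hk
    by_contra hkT
    have hne : Γ.valley k ≠ Γ.valley (Γ.next k) := fun h =>
      Γ.ne_next hT hkT (Γ.valley_injective h)
    have hmem : (⟨(Γ.valley k, Γ.valley (Γ.next k)), hne⟩ : Gen V) ∈ Γ.graph T :=
      Γ.mem_graph.2 (Or.inr (Or.inr ⟨k, hkT, rfl, rfl⟩))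
    rw [← h] at hmem
    exact Γ.mem_of_spine_mem_graph hmem rfl rfl hk
  exact fun S hS T hT h => Finset.Subset.antisymm (key S T hT h) (key T S hS h.symm)

theorem mem_graph_of_forall {S : Finset (Fin Γ.w)} (hS : S.Nonempty) {g : Gen V}
    (hg : ∀ i ∈ S, g ∈ Γ.graph {i}) : g ∈ Γ.graph S := by
  obtain ⟨i, hi⟩ := hS
  rcases Γ.mem_graph.1 (hg i hi) with h | h | ⟨k, -, h1, h2⟩
  · exact Γ.mem_graph.2 (Or.inl h)
  · exact Γ.mem_graph.2 (Or.inr (Or.inl h))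
  · refine Γ.mem_graph.2 (Or.inr (Or.inr ⟨k, fun hk => ?_, h1, h2⟩))
    exact Γ.mem_of_spine_mem_graph (hg k hk) h1 h2 (Finset.mem_singleton_self k)

theorem fanPoly_fan [Nonempty V] : fanPoly (Fintype.card V - 1) Γ.fan
    = ∑ S : Finset (Fin Γ.w) with S.Nonempty,
      betaElt ^ (S.card - 1) * ∏ g ∈ Γ.graph S, MvPolynomial.X g := by
  rw [fanPoly, fan, Finset.sum_image fun S hS T hT h =>
    Γ.graph_injOn (by simpa using hS) (by simpa using hT) h]
  refine Finset.sum_congr rfl fun S hS => ?_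
  have hS' : S.Nonempty := by simpa using hS
  have h1 := Γ.card_graph hS'
  have h2 := hS'.card_pos
  -- By `card_graph` the exponent |V| - 1 - |graph S| is |S| - 1.
  congr 2
  omega

/-- Forcing more spine weights to vanish cuts a face out of the maximal cell of any i ∈ S; hence all
cells are faces of maximal cells. -/
theorem coneFace_graph {S : Finset (Fin Γ.w)} {i : Fin Γ.w} (hi : i ∈ S)
    (T : Set (Ends I J ⊕ Gen V)) : coneFace I J (Γ.graph S) T
      = coneFace I J (Γ.graph {i}) (T ∪ Sum.inr '' {g | g ∉ Γ.graph S}) := by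
  have hsub : Γ.graph S ⊆ Γ.graph {i} := Γ.graph_subset (Finset.singleton_subset_iff.2 hi)
  ext x
  constructor
  · rintro ⟨hx, c, hc, h0, hb, hT⟩
    refine ⟨hx, c, supportedIn_mono hsub hc, h0, hb, ?_⟩
    rintro t (ht | ⟨g, hg, rfl⟩)
    · exact hT t ht
    · exact hc g hg
  · rintro ⟨hx, c, hc, h0, hb, hT⟩
    exact ⟨hx, c, fun g hg => hT (.inr g) (Or.inr ⟨g, hg, rfl⟩), h0, hb,
      fun t ht => hT t (Or.inl ht)⟩

/-- A point common to the maximal cells has the same weights in each of them, so these weights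
vanish on all spine edges that begin in S. -/
theorem iInter_coneFace [Nonempty V] {S : Finset (Fin Γ.w)} (hS : S.Nonempty) :
    ⋂ i ∈ S, coneFace I J (Γ.graph {i}) ∅ = coneFace I J (Γ.graph S) ∅ := by
  have hfan := Γ.isFan_fan
  have hmem : ∀ i, Γ.graph {i} ∈ Γ.fan := fun i => Γ.mem_fan.2 ⟨_, by simp, rfl⟩
  refine Subset.antisymm (fun x hx => ?_) (subset_iInter₂ fun i hi => ?_)
  · obtain ⟨i, hi⟩ := hS
    obtain ⟨hxP, c, hc, h0, hb, -⟩ := mem_iInter₂.1 hx i hi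
    refine ⟨hxP, c, fun g hg => ?_, h0, hb, by simp⟩
    by_contra hne
    refine hg (Γ.mem_graph_of_forall ⟨i, hi⟩ fun l hl => ?_)
    obtain ⟨-, c', hc', h0', hb', -⟩ := mem_iInter₂.1 hx l hl
    obtain rfl := hfan.inj _ (hmem i) _ (hmem l) c hc c' hc' h0 h0' (hb.trans hb'.symm)
    by_contra h
    exact hne (hc' g h)
  · rw [Γ.coneFace_graph hi]
    exact coneFace_mono (empty_subset _)

theorem fanFaces_fan [Nonempty V] {κ : Type} [Fintype κ] {f : (Ends I J → ℝ) →ₗ[ℝ] (κ → ℝ)}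
    {g : (κ → ℝ) →ₗ[ℝ] (Ends I J → ℝ)} (hgf : ∀ x, g (f x) = x) : fanFaces f Γ.fan
      = {F | F.Nonempty ∧ ∃ i, IsExposed ℝ (f '' coneFace I J (Γ.graph {i}) ∅) F} := by
  have hfan := Γ.isFan_fan
  have hmem : ∀ i, Γ.graph {i} ∈ Γ.fan := fun i => Γ.mem_fan.2 ⟨_, by simp, rfl⟩
  ext F
  refine and_congr_right fun hne => ⟨?_, ?_⟩
  · rintro ⟨A, hA, T, rfl⟩
    obtain ⟨S, ⟨i, hi⟩, rfl⟩ := Γ.mem_fan.1 hA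
    refine ⟨i, ?_⟩
    rw [Γ.coneFace_graph hi]
    simpa using hfan.isExposed_coneFace hgf (hmem i) ∅ (T ∪ Sum.inr '' {g | g ∉ Γ.graph S})
  · rintro ⟨i, hF⟩
    obtain ⟨T, hT⟩ := hfan.exposed_coneFace hgf (hmem i) hF hne
    exact ⟨_, hmem i, _, hT⟩

end Caterpillar

/-! ### The graphs G(ν, i), the polynomial P_ν and flows on the tree G_B(ν) -/

section PathGraphs

variable {ν : List Step}

instance : Nonempty (Vertex ν) := by
  have hne : indexedWord ν ≠ [] := fun h => by
    have := map_fst_canonicalIndexing 1 (Step.E :: (ν ++ [Step.N]))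
    rw [show canonicalIndexing 1 (Step.E :: (ν ++ [Step.N])) = [] from h] at this
    simp at this
  obtain ⟨p, hp⟩ := List.exists_mem_of_ne_nil _ hne
  exact ⟨letterVertex ν hp⟩

theorem next_of_lt {k : Fin (numValleys ν)} (h : k.1 + 1 < numValleys ν) :
    (pathCaterpillar ν).next k = (⟨k.1 + 1, h⟩ : Fin (numValleys ν)) := dif_pos h

theorem next_of_eq {k : Fin (numValleys ν)} (h : k.1 + 1 = numValleys ν) :
    (pathCaterpillar ν).next k = (⟨0, k.pos⟩ : Fin (numValleys ν)) := dif_neg (by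
      change ¬ (k.1 + 1 < numValleys ν); omega)

/-- The edge that closes the cycle runs downwards and is therefore backward as a signed edge. With
one valley there is none on either side, since edges have distinct ends. -/
theorem isCycleEdge_iff {j : Fin (numValleys ν)} {e : SignedEdge (Vertex ν)} :
    IsCycleEdge ν j e ↔ ∃ g : Gen (Vertex ν), g.1.1 = valley ν j ∧
      g.1.2 = valley ν ((pathCaterpillar ν).next j) ∧ genEdge g = e := by
  have hmono := valley_strictMono ν
  constructor
  · rintro (⟨h, h1, h2, h3⟩ | ⟨h, h1, h2, h3⟩)
    · refine ⟨⟨(e.lo, e.hi), e.lt.ne⟩, h1, by rw [next_of_lt h]; exact h2, ?_⟩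
      rw [genEdge_of_lt (g := ⟨(e.lo, e.hi), e.lt.ne⟩) e.lt]
      cases e; simp_all
    · refine ⟨⟨(e.hi, e.lo), e.lt.ne'⟩, h2, by rw [next_of_eq h]; exact h1, ?_⟩
      rw [genEdge_of_gt (g := ⟨(e.hi, e.lo), e.lt.ne'⟩) e.lt]
      cases e; simp_all
  · rintro ⟨g, h1, h2, rfl⟩
    by_cases h : j.1 + 1 < numValleys ν
    · rw [next_of_lt h] at h2
      have hlt : g.1.1 < g.1.2 := by
        rw [h1, h2]; exact hmono (show j.1 < j.1 + 1 by omega)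
      rw [genEdge_of_lt hlt]
      exact Or.inl ⟨h, h1, h2, rfl⟩
    · have h : j.1 + 1 = numValleys ν := by have := j.2; omega
      rw [next_of_eq h] at h2
      have hlt : g.1.2 < g.1.1 := by
        refine lt_of_le_of_ne ?_ g.2.symm
        rw [h1, h2]
        exact hmono.monotone (Nat.zero_le _)
      rw [genEdge_of_gt hlt]
      exact Or.inr ⟨h, h2, h1, rfl⟩

theorem mem_graphGB_kind_ne {e : SignedEdge (Vertex ν)} :
    e ∈ graphGB ν ∧ e.kind ≠ .bidirectional ↔ ∃ g : Gen (Vertex ν), genEdge g = e ∧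
      ((g.1.1 ∈ indexI ν ∧ g.1.1 ∉ indexJ ν ∧ g.1.2 = valley ν ((pathCaterpillar ν).index g.1.1)) ∨
      (g.1.2 ∈ indexJ ν ∧ g.1.2 ∉ indexI ν ∧
        g.1.1 = valley ν ((pathCaterpillar ν).index g.1.2))) := by
  rw [mem_graphGB]
  constructor
  · have hgen : ∀ h : e.kind = .forward, genEdge ⟨(e.lo, e.hi), e.lt.ne⟩ = e := by
      intro h
      rw [genEdge_of_lt (g := ⟨(e.lo, e.hi), e.lt.ne⟩) e.lt]
      cases e; simp_all
    rintro ⟨⟨h1, h2, h3, h4⟩ | ⟨h1, h2, h3, h4⟩ | ⟨k, h, -, -, h5⟩, h6⟩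
    · exact ⟨_, hgen h4, Or.inl ⟨h1, h2, h3⟩⟩
    · exact ⟨_, hgen h4, Or.inr ⟨h1, h2, h3⟩⟩
    · exact absurd h5 h6
  · rintro ⟨g, rfl, h | h⟩
    · have hlt : g.1.1 < g.1.2 := by rw [h.2.2]; exact (index_source h.1 h.2.1).1
      rw [genEdge_of_lt hlt]
      exact ⟨Or.inl ⟨h.1, h.2.1, h.2.2, rfl⟩, by simp⟩
    · have hlt : g.1.1 < g.1.2 := by rw [h.2.2]; exact (index_sink h.1 h.2.1).1
      rw [genEdge_of_lt hlt]
      exact ⟨Or.inr (Or.inl ⟨h.1, h.2.1, h.2.2, rfl⟩), by simp⟩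

open Classical in
theorem mem_graphG {i : Fin (numValleys ν)} {e : SignedEdge (Vertex ν)} : e ∈ graphG ν i ↔
    (e ∈ graphGB ν ∧ e.kind ≠ .bidirectional) ∨ ∃ j, j ≠ i ∧ IsCycleEdge ν j e := by
  rw [graphG, Finset.mem_filter, and_iff_right (Finset.mem_univ _)]

open Classical in
theorem mem_graphInter {S : Finset (Fin (numValleys ν))} {e : SignedEdge (Vertex ν)} :
    e ∈ graphInter ν S ↔ ∀ i ∈ S, e ∈ graphG ν i := by
  rw [graphInter, Finset.mem_filter, and_iff_right (Finset.mem_univ _)]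

theorem graphInter_eq {S : Finset (Fin (numValleys ν))} (hS : S.Nonempty) :
    graphInter ν S = toGraph ((pathCaterpillar ν).graph S) := by
  ext e
  simp only [mem_graphInter, mem_graphG, toGraph, Finset.mem_image, mem_graphGB_kind_ne,
    isCycleEdge_iff]
  constructor
  · intro h
    obtain ⟨i, hi⟩ := hS
    rcases h i hi with ⟨g, hge, hg | hg⟩ | ⟨j, -, g, h1, h2, hge⟩
    · exact ⟨g, (pathCaterpillar ν).mem_graph.2 (Or.inl hg), hge⟩
    · exact ⟨g, (pathCaterpillar ν).mem_graph.2 (Or.inr (Or.inl hg)), hge⟩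
    -- If j were in S, the graph G(ν, j) would have to contain the very cycle edge that it omits.
    · refine ⟨g, (pathCaterpillar ν).mem_graph.2 (Or.inr (Or.inr ⟨j, fun hj => ?_, h1, h2⟩)), hge⟩
      rcases h j hj with ⟨g', hge', hg' | hg'⟩ | ⟨l, hl, g', h1', h2', hge'⟩
      · obtain rfl := genEdge_injective (hge.trans hge'.symm)
        exact hg'.2.1 (h1 ▸ ((pathCaterpillar ν).valley_mem j).2)
      · obtain rfl := genEdge_injective (hge.trans hge'.symm)
        exact hg'.2.1 (h2 ▸ ((pathCaterpillar ν).valley_mem _).1)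
      · obtain rfl := genEdge_injective (hge.trans hge'.symm)
        exact hl ((valley_strictMono ν).injective (h1'.symm.trans h1))
  · rintro ⟨g, hg, hge⟩ i hi
    rcases (pathCaterpillar ν).mem_graph.1 hg with hg | hg | ⟨k, hk, h1, h2⟩
    · exact Or.inl ⟨g, hge, Or.inl hg⟩
    · exact Or.inl ⟨g, hge, Or.inr hg⟩
    · exact Or.inr ⟨k, fun h => hk (h ▸ hi), g, h1, h2, hge⟩

theorem polyP_eq : polyP ν = fanPoly (Fintype.card (Vertex ν) - 1) (pathCaterpillar ν).fan := by
  rw [polyP]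
  refine Eq.trans ?_ (pathCaterpillar ν).fanPoly_fan.symm
  refine Finset.sum_congr rfl fun S hS => ?_
  have hmem : ∀ {n : ℕ} {T : Finset (Fin n)}, T ∈ Finset.univ.filter Finset.Nonempty →
      T.Nonempty := fun h => (Finset.mem_filter.1 h).2
  have hS' : S.Nonempty := hmem (n := numValleys ν) hS
  rw [graphInter_eq hS', graphMonomial_toGraph]
  rfl

variable (ν)

/-- The tree underlying `G_B(ν)`, with all edges directed upwards. -/
noncomputable def upwardTree : Finset (Gen (Vertex ν)) :=
  (pathCaterpillar ν).graph {(pathCaterpillar ν).last}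

theorem upwardTree_mem_fan : upwardTree ν ∈ (pathCaterpillar ν).fan :=
  (pathCaterpillar ν).mem_fan.2 ⟨_, by simp, rfl⟩

variable {ν}

theorem lt_numValleys_iff {k : Fin (pathCaterpillar ν).w} :
    k ∉ ({(pathCaterpillar ν).last} : Finset (Fin (pathCaterpillar ν).w)) ↔
      k.1 + 1 < numValleys ν := by
  have hlast : (pathCaterpillar ν).last.1 = numValleys ν - 1 := rfl
  have hk : k.1 < numValleys ν := k.2
  rw [Finset.mem_singleton, Fin.ext_iff, hlast]
  omega

theorem mem_upwardTree {g : Gen (Vertex ν)} : g ∈ upwardTree ν ↔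
    (g.1.1 ∈ indexI ν ∧ g.1.1 ∉ indexJ ν ∧ g.1.2 = valley ν ((pathCaterpillar ν).index g.1.1)) ∨
    (g.1.2 ∈ indexJ ν ∧ g.1.2 ∉ indexI ν ∧ g.1.1 = valley ν ((pathCaterpillar ν).index g.1.2)) ∨
    ∃ k, ∃ h : k.1 + 1 < numValleys ν, g.1.1 = valley ν k ∧ g.1.2 = valley ν ⟨k.1 + 1, h⟩ := by
  rw [upwardTree, Caterpillar.mem_graph]
  refine or_congr Iff.rfl (or_congr Iff.rfl (exists_congr fun k => ?_))
  constructor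
  · rintro ⟨hk, h1, h2⟩
    have hk' := lt_numValleys_iff.1 hk
    exact ⟨hk', h1, h2.trans (congrArg _ (next_of_lt hk'))⟩
  · rintro ⟨hk, h1, h2⟩
    exact ⟨lt_numValleys_iff.2 hk, h1, h2.trans (congrArg (valley ν) (next_of_lt (ν := ν) (k := k) hk).symm)⟩

/-- The edge `(lo, hi)` directed upwards. -/
def upwardGen (e : SignedEdge (Vertex ν)) : Gen (Vertex ν) := ⟨(e.lo, e.hi), e.lt.ne⟩

theorem upwardGen_mem {e : SignedEdge (Vertex ν)} (he : e ∈ graphGB ν) :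
    upwardGen e ∈ upwardTree ν := by
  rw [mem_upwardTree]
  rcases mem_graphGB.1 he with ⟨h1, h2, h3, -⟩ | ⟨h1, h2, h3, -⟩ | ⟨k, h, h3, h4, -⟩
  · exact Or.inl ⟨h1, h2, h3⟩
  · exact Or.inr (Or.inl ⟨h1, h2, h3⟩)
  · exact Or.inr (Or.inr ⟨k, h, h3, h4⟩)

theorem eq_of_mem_graphGB {e e' : SignedEdge (Vertex ν)} (he : e ∈ graphGB ν) (he' : e' ∈ graphGB ν)
    (hlo : e.lo = e'.lo) (hhi : e.hi = e'.hi) : e = e' := by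
  have h1 := (Finset.mem_filter.1 he).2.2.2.2
  have h2 := (Finset.mem_filter.1 he').2.2.2.2
  rw [← hlo, ← hhi, ← h1] at h2
  cases e; cases e'; simp_all

variable (ν) in
/-- The correspondence of the edges of `G_B(ν)` and of `upwardTree ν`. -/
noncomputable def upwardEquiv : {e // e ∈ graphGB ν} ≃ {g // g ∈ upwardTree ν} :=
  Equiv.ofBijective (fun e => ⟨upwardGen e.1, upwardGen_mem e.2⟩)
    ⟨fun e e' h => by
      have h := congrArg (fun g => g.1.1) h
      simp only [upwardGen, Prod.mk.injEq] at h
      exact Subtype.ext (eq_of_mem_graphGB e.2 e'.2 h.1 h.2), by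
      rintro ⟨g, hg⟩
      rcases mem_upwardTree.1 hg with h | h | ⟨k, hk, h1, h2⟩
      · have hlt : g.1.1 < g.1.2 := by rw [h.2.2]; exact (index_source h.1 h.2.1).1
        exact ⟨⟨⟨g.1.1, g.1.2, hlt, .forward⟩,
          mem_graphGB.2 (Or.inl ⟨h.1, h.2.1, h.2.2, rfl⟩)⟩, rfl⟩
      · have hlt : g.1.1 < g.1.2 := by rw [h.2.2]; exact (index_sink h.1 h.2.1).1
        exact ⟨⟨⟨g.1.1, g.1.2, hlt, .forward⟩,
          mem_graphGB.2 (Or.inr (Or.inl ⟨h.1, h.2.1, h.2.2, rfl⟩))⟩, rfl⟩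
      · have hlt : g.1.1 < g.1.2 := by
          rw [h1, h2]
          exact valley_strictMono ν (show k.1 < k.1 + 1 by omega)
        exact ⟨⟨⟨g.1.1, g.1.2, hlt, .bidirectional⟩,
          mem_graphGB.2 (Or.inr (Or.inr ⟨k, hk, h1, h2, rfl⟩))⟩, rfl⟩⟩

variable (ν)

/-- The orientation of `G_B(ν)` with all edges directed upwards. -/
noncomputable def upwardOrientation : EdgeOrientation (graphGB ν) (upwardTree ν) where
  equiv := upwardEquiv ν
  sign _ := 1
  spec _ := Or.inl ⟨rfl, rfl⟩

/-- The weights on `upwardTree ν` with a given net vector. -/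
noncomputable def treeWeight : (Vertex ν → ℝ) →ₗ[ℝ] (Gen (Vertex ν) → ℝ) :=
  ((pathCaterpillar ν).isFan_fan.exists_dual (upwardTree_mem_fan ν)).choose

theorem treeWeight_mem (d : Vertex ν → ℝ) : treeWeight ν d ∈ supportedIn (upwardTree ν) :=
  ((pathCaterpillar ν).isFan_fan.exists_dual (upwardTree_mem_fan ν)).choose_spec.1 d

theorem treeWeight_boundary {c : Gen (Vertex ν) → ℝ} (hc : c ∈ supportedIn (upwardTree ν)) :
    treeWeight ν (boundary c) = c :=
  ((pathCaterpillar ν).isFan_fan.exists_dual (upwardTree_mem_fan ν)).choose_spec.2 c hc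

theorem boundary_treeWeight {d : Vertex ν → ℝ} (hd : ∑ v, d v = 0) :
    boundary (treeWeight ν d) = d := by
  -- With m = 0 the closing edge gets the total sum as its weight, which is zero, so this lift lives
  -- on the tree.
  have hmem : (pathCaterpillar ν).lift d 0 ∈ supportedIn (upwardTree ν) := by
    refine (pathCaterpillar ν).lift_mem_graph fun k hk => ?_
    rw [Finset.mem_singleton] at hk
    have : k.1 + 1 = (pathCaterpillar ν).w := by
      have h1 := k.2
      have h2 : k.1 = (pathCaterpillar ν).w - 1 := by rw [hk]; rfl
      omega
    rw [this, Caterpillar.prefixSum_w, hd]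
  have hb := (pathCaterpillar ν).boundary_lift hd 0
  conv_lhs => rw [← hb, treeWeight_boundary ν hmem, hb]

/-- The flow on the augmentation of `G_B(ν)` with given values on source and sink edges. -/
noncomputable def flowLift :
    (Ends (indexI ν) (indexJ ν) → ℝ) →ₗ[ℝ] (AugEdge ν (graphGB ν) → ℝ) where
  toFun x := Sum.elim
    ((upwardOrientation ν).flow (treeWeight ν (netMap (indexI ν) (indexJ ν) x))) x
  map_add' x y := by ext (e | k) <;> simp
  map_smul' r x := by ext (e | k) <;> simp

/-- The values of a flow on source and sink edges. -/
noncomputable def endValues :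
    (AugEdge ν (graphGB ν) → ℝ) →ₗ[ℝ] (Ends (indexI ν) (indexJ ν) → ℝ) :=
  LinearMap.funLeft ℝ ℝ Sum.inr

theorem endValues_flowLift (x : Ends (indexI ν) (indexJ ν) → ℝ) :
    endValues ν (flowLift ν x) = x := rfl

theorem flowLift_injective : Function.Injective (flowLift ν) :=
  Function.LeftInverse.injective (endValues_flowLift ν)

variable {ν}

theorem flowLift_inl (x : Ends (indexI ν) (indexJ ν) → ℝ) (e : {e // e ∈ graphGB ν}) :
    flowLift ν x (.inl e)
      = treeWeight ν (netMap (indexI ν) (indexJ ν) x) (upwardGen e.1) := by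
  change ((1 : ℤ) : ℝ) * treeWeight ν _ _ = _
  rw [Int.cast_one, one_mul]
  rfl

theorem endValues_mem {y : AugEdge ν (graphGB ν) → ℝ} (hy : y ∈ flowGB ν) :
    endValues ν y ∈ endsPolytope (indexI ν) (indexJ ν) :=
  ((mem_augFlow (upwardOrientation ν)).1 hy).1

/-- On a tree the net vector determines the weights of the inner edges, so the end values determine
the flow. -/
theorem flowLift_endValues {y : AugEdge ν (graphGB ν) → ℝ} (hy : y ∈ flowGB ν) :
    flowLift ν (endValues ν y) = y := by
  obtain ⟨-, h2, -⟩ := (mem_augFlow (upwardOrientation ν)).1 hy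
  have h3 : netMap (indexI ν) (indexJ ν) (endValues ν y)
    = boundary ((upwardOrientation ν).weight fun e => y (.inl e)) := h2.symm
  ext (e | k)
  · change (upwardOrientation ν).flow _ e = _
    rw [h3, treeWeight_boundary ν ((upwardOrientation ν).weight_mem _),
      EdgeOrientation.flow_weight]
  · rfl

/-- The only inner edges with a sign condition are leaf edges, and their values are, up to sign, the
net values at the leaves. -/
theorem flowLift_mem {x : Ends (indexI ν) (indexJ ν) → ℝ}
    (hx : x ∈ endsPolytope (indexI ν) (indexJ ν)) : flowLift ν x ∈ flowGB ν := by
  have hb := boundary_treeWeight ν (sum_netMap_of_mem hx)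
  rw [flowGB, mem_augFlow (upwardOrientation ν)]
  have hw : ((upwardOrientation ν).weight fun e => flowLift ν x (.inl e))
      = treeWeight ν (netMap (indexI ν) (indexJ ν) x) :=
    (upwardOrientation ν).weight_flow (treeWeight_mem ν _)
  have hcl := netMap_mem_closedNets hx
  refine ⟨hx, by rw [hw, hb]; rfl, fun e he => ?_, fun e he => ?_⟩
  · rw [flowLift_inl]
    rcases mem_graphGB.1 e.2 with ⟨h1, h2, h3, -⟩ | ⟨h1, h2, h3, -⟩ | ⟨k, h, h3, h4, h5⟩
    · have := (pathCaterpillar ν).boundary_apply_source (treeWeight_mem ν (netMap (indexI ν) (indexJ ν) x)) h1 h2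
      rw [hb] at this
      rw [← Caterpillar.weight_eq (treeWeight ν _) (upwardGen e.1)]
      change 0 ≤ Caterpillar.weight _ e.1.lo e.1.hi
      rw [h3]
      exact (hcl.2.1 _ h1 h2).trans_eq this
    · have := (pathCaterpillar ν).boundary_apply_sink (treeWeight_mem ν (netMap (indexI ν) (indexJ ν) x)) h1 h2
      rw [hb] at this
      rw [← Caterpillar.weight_eq (treeWeight ν _) (upwardGen e.1)]
      change 0 ≤ Caterpillar.weight _ e.1.lo e.1.hi
      rw [h3]
      have h0 := hcl.2.2 _ h1 h2
      rw [this] at h0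
      exact neg_nonpos.1 h0
    · rw [he] at h5; cases h5
  · rcases mem_graphGB.1 e.2 with ⟨-, -, -, h⟩ | ⟨-, -, -, h⟩ | ⟨_, _, -, -, h⟩ <;>
      rw [he] at h <;> cases h

variable (ν) in
theorem flowGB_eq : flowGB ν = flowLift ν '' endsPolytope (indexI ν) (indexJ ν) := by
  refine Subset.antisymm (fun y hy => ⟨_, endValues_mem hy, flowLift_endValues hy⟩) ?_
  rintro _ ⟨x, hx, rfl⟩
  exact flowLift_mem hx

theorem cell_toGraph (A : Finset (Gen (Vertex ν))) :
    cell ν (toGraph A) = flowLift ν '' coneFace (indexI ν) (indexJ ν) A ∅ := by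
  rw [← image_inr_augFlow]
  ext y
  constructor
  · rintro ⟨hy, z, hz, hyz⟩
    refine ⟨_, mem_image_of_mem _ hz, ?_⟩
    rw [← flowLift_endValues hy]
    congr 1
    ext k
    exact (hyz k).symm
  · rintro ⟨_, ⟨z, hz, rfl⟩, rfl⟩
    exact ⟨flowLift_mem ((mem_augFlow (toGraphOrientation A)).1 hz).1, z, hz, fun k => rfl⟩

/-- The tree is unimodular: integral end values give an integral net vector and hence integral
values on the inner edges. -/
theorem mem_latticePoints_flowLift {x : Ends (indexI ν) (indexJ ν) → ℝ}
    (hx : ∑ v, netMap (indexI ν) (indexJ ν) x v = 0) :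
    x ∈ latticePoints _ ↔ flowLift ν x ∈ latticePoints _ := by
  refine ⟨fun h => ?_, fun h k => h (.inr k)⟩
  have hint := (pathCaterpillar ν).isFan_fan.integral _ (upwardTree_mem_fan ν) _
    (treeWeight_mem ν (netMap (indexI ν) (indexJ ν) x)) fun v => by
      rw [boundary_treeWeight ν hx, netMap_apply]
      by_cases h1 : v ∈ indexI ν <;> by_cases h2 : v ∈ indexJ ν
      · obtain ⟨a, ha⟩ := h (.inl ⟨v, h1⟩)
        obtain ⟨b, hb⟩ := h (.inr ⟨v, h2⟩)
        exact ⟨a - b, by simp [h1, h2, ha, hb]⟩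
      · obtain ⟨a, ha⟩ := h (.inl ⟨v, h1⟩)
        exact ⟨a, by simp [h1, h2, ha]⟩
      · obtain ⟨b, hb⟩ := h (.inr ⟨v, h2⟩)
        exact ⟨-b, by simp [h1, h2, hb]⟩
      · exact ⟨0, by simp [h1, h2]⟩
  rintro (e | k)
  · rw [flowLift_inl]
    exact hint _
  · exact h k

/-- The value on the bidirectional edge `(v_k, v_{k+1})` is a prefix sum. -/
theorem treeWeight_spine {d : Vertex ν → ℝ} (hd : ∑ v, d v = 0) {k : Fin (numValleys ν)}
    (hk : k.1 + 1 < numValleys ν) {g : Gen (Vertex ν)} (h1 : g.1.1 = valley ν k)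
    (h2 : g.1.2 = valley ν ⟨k.1 + 1, hk⟩) :
    treeWeight ν d g = (pathCaterpillar ν).prefixSum (k + 1) d := by
  have h := (pathCaterpillar ν).prefixSum_boundary (treeWeight_mem ν d) k
  rw [boundary_treeWeight ν hd, (pathCaterpillar ν).spineWeight_eq_zero (treeWeight_mem ν d)
    (Finset.mem_singleton_self _), sub_zero] at h
  rw [← Caterpillar.weight_eq (treeWeight ν d) g, h, h1, h2, ← next_of_lt hk]
  rfl

end PathGraphs

/-! ### Maximal cells by minimal prefix sums, and their vertices -/

namespace Caterpillar

variable {V : Type} [Fintype V] [DecidableEq V] {I J : Finset V} (Γ : Caterpillar I J)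

/-- The prefix sum of the net vector as a linear form on the values on source and sink edges. -/
noncomputable def prefixNet (m : ℕ) : (Ends I J → ℝ) →ₗ[ℝ] ℝ :=
  (∑ v, (if (Γ.index v).1 < m then (1 : ℝ) else 0) • LinearMap.proj v) ∘ₗ netMap I J

theorem prefixNet_apply (m : ℕ) (x : Ends I J → ℝ) :
    Γ.prefixNet m x = Γ.prefixSum m (netMap I J x) := by
  simp only [prefixNet, prefixSum, LinearMap.comp_apply, LinearMap.sum_apply, LinearMap.smul_apply,
    LinearMap.proj_apply, smul_eq_mul]

theorem prefixNet_eq (m : ℕ) (x : Ends I J → ℝ) : Γ.prefixNet m x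
    = ∑ i : {i // i ∈ I}, (if (Γ.index i.1).1 < m then 1 else 0) * x (.inl i)
      - ∑ j : {j // j ∈ J}, (if (Γ.index j.1).1 < m then 1 else 0) * x (.inr j) := by
  rw [prefixNet_apply, prefixSum, sum_mul_netMap]

theorem prefixNet_zero (x : Ends I J → ℝ) : Γ.prefixNet 0 x = 0 := by
  simp [prefixNet_eq]

theorem prefixNet_w {x : Ends I J → ℝ} (hx : x ∈ endsPolytope I J) : Γ.prefixNet Γ.w x = 0 := by
  rw [prefixNet_apply, prefixSum_w, sum_netMap_of_mem hx]

/-- The weight of the spine edge at k is the prefix sum at k minus that at i, so nonnegativity of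
the weights means minimality at i. -/
theorem mem_coneFace_singleton [Nonempty V] {i : Fin Γ.w} {x : Ends I J → ℝ} :
    x ∈ coneFace I J (Γ.graph {i}) ∅ ↔
      x ∈ endsPolytope I J ∧ ∀ k : Fin Γ.w, Γ.prefixNet (i + 1) x ≤ Γ.prefixNet (k + 1) x := by
  simp only [prefixNet_apply]
  constructor
  · rintro ⟨hx, c, hc, h0, hb, -⟩
    refine ⟨hx, fun k => ?_⟩
    rw [← hb, Γ.prefixSum_boundary hc, Γ.prefixSum_boundary hc,
      Γ.spineWeight_eq_zero hc (Finset.mem_singleton_self i)]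
    linarith [Γ.spineWeight_nonneg h0 k]
  · rintro ⟨hx, h⟩
    have hd := netMap_mem_closedNets hx
    refine ⟨hx, Γ.lift (netMap I J x) (Γ.prefixSum (i + 1) (netMap I J x)),
      Γ.lift_mem_graph (by simp), Γ.lift_nonneg hd h, Γ.boundary_lift hd.1 _, by simp⟩

/-- The equations of `endsPolytope`. -/
def endsSpace (I J : Finset V) : AffineSubspace ℝ (Ends I J → ℝ) where
  carrier := {x | ∑ i, x (.inl i) = 1 ∧ ∑ j, x (.inr j) = 1}
  smul_vsub_vadd_mem' := by
    rintro r x y z ⟨hx1, hx2⟩ ⟨hy1, hy2⟩ ⟨hz1, hz2⟩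
    constructor
    · simp [-Finset.univ_eq_attach, Finset.sum_add_distrib, ← Finset.mul_sum, hx1, hy1, hz1]
    · simp [-Finset.univ_eq_attach, Finset.sum_add_distrib, ← Finset.mul_sum, hx2, hy2, hz2]

/-- The inequalities of the part of `endsPolytope` where the prefix sums are minimal at `i`. -/
noncomputable def minForm (i : Fin Γ.w) : Ends I J ⊕ Fin Γ.w → (Ends I J → ℝ) →ᵃ[ℝ] ℝ
  | .inl k => (LinearMap.proj k : (Ends I J → ℝ) →ₗ[ℝ] ℝ).toAffineMap
  | .inr k => (Γ.prefixNet (k + 1) - Γ.prefixNet (i + 1)).toAffineMap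

theorem coneFace_singleton_eq [Nonempty V] (i : Fin Γ.w) :
    coneFace I J (Γ.graph {i}) ∅ = hset (endsSpace I J) (Γ.minForm i) := by
  ext x
  rw [mem_coneFace_singleton]
  constructor
  · rintro ⟨⟨h1, h2⟩, h3⟩
    refine ⟨h2, ?_⟩
    rintro (k | k)
    · exact h1 k
    · exact sub_nonneg.2 (h3 k)
  · rintro ⟨h1, h2⟩
    exact ⟨⟨fun k => h2 (.inl k), h1⟩, fun k => sub_nonneg.1 (h2 (.inr k))⟩

theorem convex_coneFace_singleton [Nonempty V] (i : Fin Γ.w) :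
    Convex ℝ (coneFace I J (Γ.graph {i}) ∅) := by
  rw [coneFace_singleton_eq]
  exact convex_hset

section Vertices

variable {x : Ends I J → ℝ}

/-- A vertex of `endsPolytope`. -/
def endsVertex (i : {i // i ∈ I}) (j : {j // j ∈ J}) : Ends I J → ℝ :=
  Sum.elim (Pi.single i 1) (Pi.single j 1)

theorem endsVertex_mem (i : {i // i ∈ I}) (j : {j // j ∈ J}) :
    endsVertex i j ∈ endsPolytope I J := by
  refine ⟨?_, by simp [endsVertex, -Finset.univ_eq_attach], by simp [endsVertex, -Finset.univ_eq_attach]⟩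
  rintro (k | k) <;> simp only [endsVertex, Sum.elim_inl, Sum.elim_inr, Pi.single_apply] <;>
    split_ifs <;> simp

theorem prefixNet_endsVertex (m : ℕ) (i : {i // i ∈ I}) (j : {j // j ∈ J}) :
    Γ.prefixNet m (endsVertex i j) = (if (Γ.index i.1).1 < m then 1 else 0)
      - (if (Γ.index j.1).1 < m then 1 else 0) := by
  rw [prefixNet_eq]
  simp [endsVertex, Pi.single_apply, -Finset.univ_eq_attach]

theorem exists_pos_of_sum_lt {τ : Type*} [Fintype τ] (r : τ → ℕ) {q : τ → ℝ} (hq : ∀ j, 0 ≤ q j)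
    {a m : ℕ} (h : ∑ j, (if r j < a then 1 else 0) * q j < ∑ j, (if r j < m then 1 else 0) * q j) :
    ∃ j, 0 < q j ∧ a ≤ r j ∧ r j < m := by
  by_contra hc
  push Not at hc
  refine h.not_ge (Finset.sum_le_sum fun j _ => ?_)
  rcases (hq j).eq_or_lt with h0 | h0
  · simp [← h0]
  · have := hc j h0
    split_ifs
    · exact le_rfl
    · omega
    · simpa using hq j
    · exact le_rfl

theorem add_le_sum_of_le {τ : Type*} [Fintype τ] (r : τ → ℕ) {p : τ → ℝ}
    (hp : ∀ j, 0 ≤ p j) (i : τ) {m : ℕ} (hm : r i < m) :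
    ∑ j, (if r j < r i then 1 else 0) * p j + p i ≤ ∑ j, (if r j < m then 1 else 0) * p j := by
  classical
  have : ∑ j, (if j = i then 1 else 0) * p j = p i := by simp
  rw [← this, ← Finset.sum_add_distrib]
  refine Finset.sum_le_sum fun j _ => ?_
  rw [← add_mul]
  refine mul_le_mul_of_nonneg_right ?_ (hp j)
  split_ifs <;> norm_num <;> subst_vars <;> omega

/-- The prefix sums of a vertex are 1 between source position and sink position if the source comes
first, -1 there if the sink comes first, and 0 elsewhere. The source i₀ is arbitrary in the support
of x, and the sink is chosen so that an elevation avoids the minima of x, or a depression covers all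
of them. -/
theorem exists_endsVertex [Nonempty V] {i : Fin Γ.w} (hx : x ∈ endsPolytope I J)
    (h : ∀ k : Fin Γ.w, Γ.prefixNet (i + 1) x ≤ Γ.prefixNet (k + 1) x) :
    ∃ i₀ j₀, 0 < x (.inl i₀) ∧ 0 < x (.inr j₀) ∧ ∀ k : Fin Γ.w,
      Γ.prefixNet (i + 1) (endsVertex i₀ j₀) ≤ Γ.prefixNet (k + 1) (endsVertex i₀ j₀) ∧
      (Γ.prefixNet (k + 1) x = Γ.prefixNet (i + 1) x →
        Γ.prefixNet (k + 1) (endsVertex i₀ j₀) = Γ.prefixNet (i + 1) (endsVertex i₀ j₀)) := by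
  have hw := Γ.prefixNet_w hx
  -- The empty prefix is included because its sum agrees with the full one: both are zero.
  have hmin : ∀ m ≤ Γ.w, Γ.prefixNet (i + 1) x ≤ Γ.prefixNet m x := by
    intro m hm
    rcases Nat.eq_zero_or_pos m with rfl | hpos
    · have := h Γ.last
      have hl : Γ.last.1 + 1 = Γ.w := by
        have := i.pos
        simp only [last]
        omega
      rwa [hl, hw, ← Γ.prefixNet_zero x] at this
    · have := h ⟨m - 1, by omega⟩
      simpa only [Nat.sub_add_cancel hpos] using this
  obtain ⟨i₀, hi₀⟩ : ∃ i₀, 0 < x (.inl i₀) := by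
    by_contra hc
    push Not at hc
    have := hx.2.1
    have := Finset.sum_nonpos fun i (_ : i ∈ Finset.univ) => hc i
    linarith
  set a := (Γ.index i₀.1).1 with ha
  have haw : a < Γ.w := (Γ.index i₀.1).2
  have hP : ∀ m, a < m → ∑ i : {i // i ∈ I}, (if (Γ.index i.1).1 < a then 1 else 0) * x (.inl i)
      + x (.inl i₀) ≤ ∑ i : {i // i ∈ I}, (if (Γ.index i.1).1 < m then 1 else 0) * x (.inl i) :=
    fun m hm => add_le_sum_of_le (fun i : {i // i ∈ I} => (Γ.index i.1).1) (fun i => hx.1 (.inl i)) i₀ hm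
  have hQ : ∀ b m, ∑ j : {j // j ∈ J}, (if (Γ.index j.1).1 < b then 1 else 0) * x (.inr j)
      < ∑ j : {j // j ∈ J}, (if (Γ.index j.1).1 < m then 1 else 0) * x (.inr j) →
      ∃ j : {j // j ∈ J}, 0 < x (.inr j) ∧ b ≤ (Γ.index j.1).1 ∧ (Γ.index j.1).1 < m :=
    fun b m => exists_pos_of_sum_lt (fun j : {j // j ∈ J} => (Γ.index j.1).1) (fun j => hx.1 (.inr j))
  have hYa := hmin a haw.le
  -- the prefix sums increase beyond `a` until a sink edge with positive value is met
  have hinc : ∀ m, a < m → (∀ j : {j // j ∈ J}, 0 < x (.inr j) → a ≤ (Γ.index j.1).1 →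
      m ≤ (Γ.index j.1).1) → Γ.prefixNet a x + x (.inl i₀) ≤ Γ.prefixNet m x := by
    intro m hm hj
    have h1 := hP m hm
    have h2 : ¬ _ := fun h' => by
      obtain ⟨j, h1, h2, h3⟩ := hQ a m h'
      exact absurd (hj j h1 h2) (by omega)
    rw [not_lt] at h2
    rw [prefixNet_eq, prefixNet_eq]
    linarith
  -- If some sink in the support lies at or after a, take the first such: up to it the prefix sums
  -- of x stay above the minimum, so the elevation meets no minimum.
  by_cases hex : ∃ j : {j // j ∈ J}, 0 < x (.inr j) ∧ a ≤ (Γ.index j.1).1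
  · obtain ⟨j₀, ⟨hj₀, hab⟩, hj₀min⟩ := Set.exists_min_image
      {j : {j // j ∈ J} | 0 < x (.inr j) ∧ a ≤ (Γ.index j.1).1} (fun j => (Γ.index j.1).1)
      (Set.toFinite _) hex
    set b := (Γ.index j₀.1).1 with hb
    have hi : a < i.1 + 1 → b < i.1 + 1 := by
      intro hai
      by_contra hbi
      have := hinc (i + 1) hai fun j h1 h2 => (not_lt.1 hbi).trans (hj₀min j ⟨h1, h2⟩)
      linarith
    have hi' : b < i.1 + 1 → a < i.1 + 1 := fun h => by omega
    have hk : ∀ k : Fin Γ.w, a < k.1 + 1 → ¬ b < k.1 + 1 →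
        Γ.prefixNet (i + 1) x < Γ.prefixNet (k + 1) x := by
      intro k hak hbk
      have := hinc (k + 1) hak fun j h1 h2 => (not_lt.1 hbk).trans (hj₀min j ⟨h1, h2⟩)
      linarith
    refine ⟨i₀, j₀, hi₀, hj₀, fun k => ?_⟩
    have hk' := hk k
    simp only [prefixNet_endsVertex, ← ha, ← hb]
    by_cases h1 : a < k.1 + 1 <;> by_cases h2 : b < k.1 + 1 <;> by_cases h3 : a < i.1 + 1
    · simp [h1, h2, h3, hi h3]
    · simp [h1, h2, h3, mt hi' h3]
    · simp [h1, h2, h3, hi h3, (hk' h1 h2).ne']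
    · simp [h1, h2, h3, mt hi' h3, (hk' h1 h2).ne']
    · omega
    · omega
    · simp [h1, h2, h3, hi h3]
    · simp [h1, h2, h3, mt hi' h3]
  -- Now all sinks in the support lie before a, so the minimum is negative. With the first of them
  -- as j₀, every negative prefix sum comes after j₀, and beyond a the sums exceed the minimum.
  · push Not at hex
    have h1 := hinc Γ.w haw fun j h1 h2 => absurd (hex j h1) (by omega)
    have hneg : Γ.prefixNet (i + 1) x < 0 := by linarith
    have hi : ¬ a < i.1 + 1 := fun hai => by
      have := hinc (i + 1) hai fun j h1 h2 => absurd (hex j h1) (by omega)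
      linarith
    have hpos : ∀ m, Γ.prefixNet m x < 0 →
        ∃ j : {j // j ∈ J}, 0 < x (.inr j) ∧ (Γ.index j.1).1 < m := by
      intro m hm
      rw [prefixNet_eq] at hm
      have h2 : 0 ≤ ∑ i : {i // i ∈ I}, (if (Γ.index i.1).1 < m then 1 else 0) * x (.inl i) :=
        Finset.sum_nonneg fun i _ => mul_nonneg (by split_ifs <;> simp) (hx.1 _)
      have h3 : ∑ j : {j // j ∈ J}, (if (Γ.index j.1).1 < 0 then 1 else 0) * x (.inr j) = 0 := by
        simp only [Nat.not_lt_zero, if_false, zero_mul, Finset.sum_const_zero]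
      obtain ⟨j, h3, -, h4⟩ := hQ 0 m (by linarith)
      exact ⟨j, h3, h4⟩
    obtain ⟨j₁, hj₁, hj₁i⟩ := hpos _ hneg
    obtain ⟨j₀, hj₀, hj₀min⟩ := Set.exists_min_image {j : {j // j ∈ J} | 0 < x (.inr j)}
      (fun j => (Γ.index j.1).1) (Set.toFinite _) ⟨j₁, hj₁⟩
    set b := (Γ.index j₀.1).1 with hb
    have hbi : b < i.1 + 1 := (hj₀min j₁ hj₁).trans_lt hj₁i
    have hba : b < a := hex j₀ hj₀
    refine ⟨i₀, j₀, hi₀, hj₀, fun k => ?_⟩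
    simp only [prefixNet_endsVertex, ← ha, ← hb, hi, hbi, if_true, if_false]
    by_cases h2 : a < k.1 + 1
    · have h3 : b < k.1 + 1 := by omega
      have := hinc (k + 1) h2 fun j h1 h2 => absurd (hex j h1) (by omega)
      have hne : Γ.prefixNet (k + 1) x ≠ Γ.prefixNet (i + 1) x := by linarith
      simp [h2, h3, hne]
    · by_cases h3 : b < k.1 + 1
      · simp [h2, h3]
      · have hne : Γ.prefixNet (k + 1) x ≠ Γ.prefixNet (i + 1) x := fun heq => by
          obtain ⟨j, h4, h5⟩ := hpos (k + 1) (heq ▸ hneg)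
          have : b ≤ (Γ.index j.1).1 := hj₀min j h4
          omega
        simp [h2, h3, hne]

/-- The realizations of the maximal cones are convex hulls of vertices of `endsPolytope`. -/
theorem coneFace_singleton_subset_convexHull [Nonempty V] (i : Fin Γ.w) :
    coneFace I J (Γ.graph {i}) ∅ ⊆ convexHull ℝ {x | x ∈ coneFace I J (Γ.graph {i}) ∅ ∧
      ∃ i₀ j₀, x = endsVertex i₀ j₀} := by
  have hc : IsCompact (hset (endsSpace I J) (Γ.minForm i)) :=
    isCompact_endsPolytope.of_isClosed_subset isClosed_hset fun x hx => by
      rw [← coneFace_singleton_eq] at hx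
      exact hx.1
  conv_lhs => rw [coneFace_singleton_eq, ← convexHull_extremePoints_hset hc]
  refine convexHull_mono fun x hx => ?_
  have hx1 := hx.1
  rw [← coneFace_singleton_eq] at hx1
  refine ⟨hx1, ?_⟩
  obtain ⟨hxP, hmin⟩ := Γ.mem_coneFace_singleton.1 hx1
  obtain ⟨i₀, j₀, hi₀, hj₀, hk⟩ := Γ.exists_endsVertex hxP hmin
  -- All inequalities tight at the extreme point x are tight at the vertex, which must therefore
  -- equal x.
  refine ⟨i₀, j₀, (eq_of_mem_extremePoints_hset hx (y := endsVertex i₀ j₀) ?_ ?_).symm⟩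
  · rw [← coneFace_singleton_eq, mem_coneFace_singleton]
    exact ⟨endsVertex_mem _ _, fun k => (hk k).1⟩
  · rintro ((k | k) | k) h0
    · change x (.inl k) = 0 at h0
      have : k ≠ i₀ := by rintro rfl; exact hi₀.ne' h0
      change endsVertex i₀ j₀ (.inl k) = 0
      simp [endsVertex, this]
    · change x (.inr k) = 0 at h0
      have : k ≠ j₀ := by rintro rfl; exact hj₀.ne' h0
      change endsVertex i₀ j₀ (.inr k) = 0
      simp [endsVertex, this]
    · exact sub_eq_zero.2 ((hk k).2 (sub_eq_zero.1 h0))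

end Vertices

end Caterpillar

/-! ### Routes and their characteristic vectors -/

section Routes

variable {V E : Type} [LinearOrder V] [Fintype E] {edge : E → SignedEdge V}

theorem pair_infix_cons_cons {u v a b : V} {l : List V} :
    [u, v] <:+: a :: b :: l ↔ (u = a ∧ v = b) ∨ [u, v] <:+: b :: l := by
  rw [List.infix_cons_iff, List.cons_prefix_cons, List.cons_prefix_cons]
  simp

theorem mem_of_pair_infix {u v : V} {l : List V} (h : [u, v] <:+: l) : u ∈ l ∧ v ∈ l :=
  ⟨h.subset (by simp), h.subset (by simp)⟩

theorem List.IsChain.rel_of_infix {R : V → V → Prop} {l : List V} (hl : l.IsChain R) {u v : V}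
    (h : [u, v] <:+: l) : R u v := by
  have := hl.infix h
  simpa using this

theorem not_pair_infix_swap {u v : V} {l : List V} (hl : l.Nodup) (h : [u, v] <:+: l) :
    ¬ [v, u] <:+: l := by
  induction l with
  | nil => simp at h
  | cons a l ih =>
    cases l with
    | nil => exact absurd h.length_le (by simp)
    | cons b l =>
      have ha : a ∉ b :: l := (List.nodup_cons.1 hl).1
      rw [pair_infix_cons_cons] at h ⊢
      rintro (h' | h')
      · rcases h with h | h
        · exact ha (by simp [← h'.1, h.2])
        · exact ha (h'.1 ▸ (mem_of_pair_infix h).2)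
      · rcases h with h | h
        · exact ha (h.1 ▸ (mem_of_pair_infix h').2)
        · exact ih (List.nodup_cons.1 hl).2 h h'

theorem neg_one_le_routeVector (l : List V) (e : E) : -1 ≤ routeVector edge l e := by
  unfold routeVector
  split_ifs <;> norm_num

theorem routeVector_nonneg {l : List V} {e : E} (h : ¬ [(edge e).hi, (edge e).lo] <:+: l) :
    0 ≤ routeVector edge l e := by
  unfold routeVector
  rw [if_neg h]
  split_ifs <;> norm_num

theorem routeVector_nonpos {l : List V} {e : E} (h : ¬ [(edge e).lo, (edge e).hi] <:+: l) :
    routeVector edge l e ≤ 0 := by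
  unfold routeVector
  rw [if_neg h]
  split_ifs <;> norm_num

theorem routeVector_eq_neg_one {l : List V} (hl : l.Nodup) {e : E}
    (h : [(edge e).hi, (edge e).lo] <:+: l) : routeVector edge l e = -1 := by
  unfold routeVector
  rw [if_neg (not_pair_infix_swap hl h), if_pos h]

/-- Splits off the first step for inductions. As a does not recur, an edge used in this step is used
nowhere else. -/
theorem routeVector_cons_cons {a b : V} {l : List V} (h : (a :: b :: l).Nodup) (e : E) :
    routeVector edge (a :: b :: l) e
      = (if (edge e).lo = a ∧ (edge e).hi = b then 1 else 0)
        - (if (edge e).hi = a ∧ (edge e).lo = b then 1 else 0) + routeVector edge (b :: l) e := by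
  have ha : a ∉ b :: l := (List.nodup_cons.1 h).1
  have hab : a ≠ b := fun h => ha (by simp [h])
  unfold routeVector
  simp only [pair_infix_cons_cons]
  by_cases h1 : (edge e).lo = a ∧ (edge e).hi = b
  · have h2 : ¬ ((edge e).hi = a ∧ (edge e).lo = b) := fun h2 => hab (h1.1.symm.trans h2.2)
    have h3 : ¬ [(edge e).lo, (edge e).hi] <:+: b :: l := fun h3 =>
      ha (h1.1 ▸ (mem_of_pair_infix h3).1)
    have h4 : ¬ [(edge e).hi, (edge e).lo] <:+: b :: l := fun h4 =>
      ha (h1.1 ▸ (mem_of_pair_infix h4).2)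
    rw [if_pos (Or.inl h1), if_pos h1, if_neg h2, if_neg h3, if_neg h4]
    norm_num
  · by_cases h2 : (edge e).hi = a ∧ (edge e).lo = b
    · have h3 : ¬ [(edge e).lo, (edge e).hi] <:+: b :: l := fun h3 =>
        ha (h2.1 ▸ (mem_of_pair_infix h3).2)
      have h4 : ¬ [(edge e).hi, (edge e).lo] <:+: b :: l := fun h4 =>
        ha (h2.1 ▸ (mem_of_pair_infix h4).1)
      rw [if_neg (not_or.2 ⟨h1, h3⟩), if_pos (Or.inl h2), if_neg h1, if_pos h2, if_neg h3, if_neg h4]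
      norm_num
    · simp [h1, h2]

/-- A telescoping sum: a step from a to b contributes +1 at a and -1 at b. Without parallel edges
exactly one edge carries the step. -/
theorem netflow_routeVector (hinj : ∀ e e', (edge e).lo = (edge e').lo →
    (edge e).hi = (edge e').hi → e = e') {t : V} (v : V) {l : List V} {s : V}
    (hl : IsRoute edge s t l) :
    (∑ e, if (edge e).lo = v then routeVector edge l e else 0)
      - (∑ e, if (edge e).hi = v then routeVector edge l e else 0)
      = (if v = s then 1 else 0) - (if v = t then 1 else 0) := by
  rw [← Finset.sum_sub_distrib]
  induction l generalizing s with
  | nil => simp [IsRoute] at hl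
  | cons a l ih =>
    obtain ⟨h1, h2, h3, h4⟩ := hl
    obtain rfl : a = s := by simpa using h1
    cases l with
    | nil =>
      obtain rfl : a = t := by simpa using h2
      have h0 : ∀ e, routeVector edge [a] e = 0 := fun e => by
        unfold routeVector
        rw [if_neg, if_neg] <;> intro h <;> simpa using h.length_le
      simp [h0]
    | cons b l =>
      rw [List.isChain_cons_cons] at h4
      obtain ⟨⟨e₀, he₀⟩, h4⟩ := h4
      have hab : a ≠ b := fun h => (List.nodup_cons.1 h3).1 (by simp [h])
      have ih := ih ⟨rfl, by simpa using h2, (List.nodup_cons.1 h3).2, h4⟩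
      have key : ∑ e, ((if (edge e).lo = v then (1 : ℝ) else 0) - (if (edge e).hi = v then 1 else 0))
          * ((if (edge e).lo = a ∧ (edge e).hi = b then 1 else 0)
            - (if (edge e).hi = a ∧ (edge e).lo = b then 1 else 0))
          = (if v = a then 1 else 0) - (if v = b then 1 else 0) := by
        rw [Finset.sum_eq_single e₀]
        · rcases he₀ with ⟨rfl, rfl, -⟩ | ⟨rfl, rfl, -⟩
          · simp [(edge e₀).lt.ne', eq_comm]
          · simp [(edge e₀).lt.ne, eq_comm]
        · intro e _ hne
          have h5 : ¬ ((edge e).lo = a ∧ (edge e).hi = b) := by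
            rintro ⟨h5, h6⟩
            rcases he₀ with ⟨h7, h8, -⟩ | ⟨h7, h8, -⟩
            · exact hne (hinj _ _ (h5.trans h7.symm) (h6.trans h8.symm))
            · have := (edge e).lt
              have := (edge e₀).lt
              rw [h7, h8] at this
              rw [h5, h6] at *
              exact lt_asymm this ‹_›
          have h6 : ¬ ((edge e).hi = a ∧ (edge e).lo = b) := by
            rintro ⟨h5, h6⟩
            rcases he₀ with ⟨h7, h8, -⟩ | ⟨h7, h8, -⟩
            · have := (edge e).lt
              have := (edge e₀).lt
              rw [h7, h8] at this
              rw [h5, h6] at *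
              exact lt_asymm this ‹_›
            · exact hne (hinj _ _ (h6.trans h8.symm) (h5.trans h7.symm))
          simp [h5, h6]
        · simp
      have hsplit : ∀ e, ((if (edge e).lo = v then routeVector edge (a :: b :: l) e else 0)
          - (if (edge e).hi = v then routeVector edge (a :: b :: l) e else 0))
          = ((if (edge e).lo = v then (1 : ℝ) else 0) - (if (edge e).hi = v then 1 else 0))
            * ((if (edge e).lo = a ∧ (edge e).hi = b then 1 else 0)
              - (if (edge e).hi = a ∧ (edge e).lo = b then 1 else 0))
            + ((if (edge e).lo = v then routeVector edge (b :: l) e else 0)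
              - (if (edge e).hi = v then routeVector edge (b :: l) e else 0)) := fun e => by
        rw [routeVector_cons_cons h3]
        split_ifs <;> ring
      rw [Finset.sum_congr rfl fun e _ => hsplit e, Finset.sum_add_distrib, key, ih]
      ring

/-- Each step is permitted by some edge between its ends; without parallel edges it is the edge e
itself. -/
theorem IsRoute.allows (hinj : ∀ e e', (edge e).lo = (edge e').lo →
    (edge e).hi = (edge e').hi → e = e') {s t : V} {l : List V} (hl : IsRoute edge s t l) (e : E) :
    ([(edge e).lo, (edge e).hi] <:+: l → (edge e).kind ≠ .backward) ∧
    ([(edge e).hi, (edge e).lo] <:+: l → (edge e).kind ≠ .forward) := by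
  constructor
  · intro h
    obtain ⟨e', ⟨h1, h2, h3⟩ | ⟨h1, h2, h3⟩⟩ := hl.2.2.2.rel_of_infix h
    · rwa [← hinj e' e h1 h2]
    · have := (edge e').lt
      rw [h1, h2] at this
      exact absurd (edge e).lt this.asymm
  · intro h
    obtain ⟨e', ⟨h1, h2, h3⟩ | ⟨h1, h2, h3⟩⟩ := hl.2.2.2.rel_of_infix h
    · have := (edge e').lt
      rw [h1, h2] at this
      exact absurd (edge e).lt this.asymm
    · rwa [← hinj e' e h2 h1]

theorem routeVector_mem_flowPolytope (hinj : ∀ e e', (edge e).lo = (edge e').lo →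
    (edge e).hi = (edge e').hi → e = e') {s t : V} {l : List V} (hl : IsRoute edge s t l) :
    routeVector edge l ∈ flowPolytope edge s t := by
  exact ⟨fun v => netflow_routeVector hinj v hl,
    fun e he => routeVector_nonneg fun h => (hl.allows hinj e).2 h he,
    fun e he => routeVector_nonpos fun h => (hl.allows hinj e).1 h he⟩

theorem IsRoute.cons {u s t : V} {l : List V} (hl : IsRoute edge s t l)
    (h : ∃ e, (edge e).Allows u s) (hu : u ∉ l) : IsRoute edge u t (u :: l) := by
  obtain ⟨h1, h2, h3, h4⟩ := hl
  refine ⟨rfl, ?_, List.nodup_cons.2 ⟨hu, h3⟩, ?_⟩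
  · rw [List.getLast?_cons, h2]
    rfl
  · refine List.isChain_cons.2 ⟨fun v hv => ?_, h4⟩
    rw [h1] at hv
    obtain rfl : s = v := by simpa using hv
    exact h

theorem IsRoute.concat {u s t : V} {l : List V} (hl : IsRoute edge s t l)
    (h : ∃ e, (edge e).Allows t u) (hu : u ∉ l) : IsRoute edge s u (l ++ [u]) := by
  obtain ⟨h1, h2, h3, h4⟩ := hl
  refine ⟨?_, by simp, ?_, ?_⟩
  · rw [List.head?_append, h1]
    rfl
  · rw [List.nodup_append]
    exact ⟨h3, by simp, fun a ha b hb => by rintro rfl; simp at hb; exact hu (hb ▸ ha)⟩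
  · refine List.isChain_append.2 ⟨h4, by simp, fun a ha b hb => ?_⟩
    rw [h2] at ha
    obtain rfl : t = a := by simpa using ha
    obtain rfl : u = b := by simpa using hb
    exact h

theorem IsRoute.map {V' E' : Type} [LinearOrder V'] {edge' : E' → SignedEdge V'} {f : V → V'}
    (hf : Function.Injective f)
    (h : ∀ e, ∃ e', (edge' e').lo = f (edge e).lo ∧ (edge' e').hi = f (edge e).hi ∧
      (edge' e').kind = (edge e).kind) {s t : V} {l : List V} (hl : IsRoute edge s t l) :
    IsRoute edge' (f s) (f t) (l.map f) := by
  obtain ⟨h1, h2, h3, h4⟩ := hl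
  refine ⟨by simp [h1], by simp [h2], h3.map hf, (List.isChain_map f).2 (h4.imp ?_)⟩
  rintro u v ⟨e, he⟩
  obtain ⟨e', h5, h6, h7⟩ := h e
  refine ⟨e', ?_⟩
  rcases he with ⟨rfl, rfl, h⟩ | ⟨rfl, rfl, h⟩
  · exact Or.inl ⟨h5, h6, h7 ▸ h⟩
  · exact Or.inr ⟨h6, h5, h7 ▸ h⟩

end Routes

/-! ### Routes of the augmentation of G_B(ν) and the polytopes Q_i -/

section PathRoutes

variable {ν : List Step}

theorem innerVertex_injective : Function.Injective (innerVertex ν) := fun u v h => by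
  simpa [innerVertex] using h

theorem bot_ne_innerVertex (v : Vertex ν) : (⊥ : AugVertex ν) ≠ innerVertex ν v :=
  (WithBot.coe_ne_bot).symm

theorem innerVertex_ne_top (v : Vertex ν) : innerVertex ν v ≠ (⊤ : AugVertex ν) := fun h =>
  WithTop.coe_ne_top (WithBot.coe_injective h)

theorem augmentation_injective (e e' : AugEdge ν (graphGB ν))
    (hlo : (augmentation ν (graphGB ν) e).lo = (augmentation ν (graphGB ν) e').lo)
    (hhi : (augmentation ν (graphGB ν) e).hi = (augmentation ν (graphGB ν) e').hi) : e = e' := by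
  rcases e with e | i | j <;> rcases e' with e' | i' | j'
  · exact congrArg _ (Subtype.ext (eq_of_mem_graphGB e.2 e'.2 (innerVertex_injective hlo)
      (innerVertex_injective hhi)))
  · exact absurd hlo.symm (bot_ne_innerVertex _)
  · exact absurd hhi (innerVertex_ne_top _)
  · exact absurd hlo (bot_ne_innerVertex _)
  · exact congrArg (fun i => Sum.inr (Sum.inl i)) (Subtype.ext (innerVertex_injective hhi))
  · exact absurd hlo (bot_ne_innerVertex _)
  · exact absurd hhi.symm (innerVertex_ne_top _)
  · exact absurd hlo.symm (bot_ne_innerVertex _)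
  · exact congrArg (fun j => Sum.inr (Sum.inr j)) (Subtype.ext (innerVertex_injective hlo))

theorem exists_allows_valley {k : Fin (numValleys ν)} (h : k.1 + 1 < numValleys ν) :
    ∃ e : {e // e ∈ graphGB ν}, e.1.lo = valley ν k ∧ e.1.hi = valley ν ⟨k.1 + 1, h⟩ ∧
      e.1.kind = .bidirectional := by
  refine ⟨⟨⟨_, _, valley_strictMono ν (show k < ⟨k.1 + 1, h⟩ from Nat.lt_succ_self k.1),
    .bidirectional⟩, ?_⟩, rfl, rfl, rfl⟩
  exact mem_graphGB.2 (Or.inr (Or.inr ⟨k, h, rfl, rfl, rfl⟩))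

theorem exists_valley_route (a b : Fin (numValleys ν)) : ∃ l : List (Vertex ν),
    IsRoute (fun e : {e // e ∈ graphGB ν} => e.1) (valley ν a) (valley ν b) l ∧
      ∀ v ∈ l, v ∈ valleys ν := by
  obtain ⟨p, hp⟩ := ((SimpleGraph.pathGraph_preconnected (numValleys ν)) a b).exists_isPath
  refine ⟨p.support.map (valley ν), ⟨?_, ?_, hp.support_nodup.map (valley_strictMono ν).injective,
    (List.isChain_map _).2 (p.isChain_adj_support.imp fun u v huv => ?_)⟩, ?_⟩
  · rw [List.head?_map, List.head?_eq_some_head p.support_ne_nil]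
    simp
  · rw [List.getLast?_map, List.getLast?_eq_some_getLast p.support_ne_nil]
    simp
  · rw [SimpleGraph.pathGraph_adj] at huv
    rcases huv with h | h
    · obtain ⟨e, h1, h2, h3⟩ := exists_allows_valley (k := u) (by rw [h]; exact v.2)
      refine ⟨e, Or.inl ⟨h1, h2.trans (congrArg _ (Fin.ext h)), by rw [h3]; simp⟩⟩
    · obtain ⟨e, h1, h2, h3⟩ := exists_allows_valley (k := v) (by rw [h]; exact u.2)
      refine ⟨e, Or.inr ⟨h2.trans (congrArg _ (Fin.ext h)), h1, by rw [h3]; simp⟩⟩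
  · intro v hv
    obtain ⟨k, -, rfl⟩ := List.mem_map.1 hv
    exact valley_mem_valleys ν k

/-- Bidirectional edges connect any two valleys in either direction; a leaf edge is added at each
end that is not a valley. -/
theorem exists_inner_route {i j : Vertex ν} (hi : i ∈ indexI ν) (hj : j ∈ indexJ ν) :
    ∃ l, IsRoute (fun e : {e // e ∈ graphGB ν} => e.1) i j l := by
  have hval : ∀ {v}, v ∈ indexI ν → v ∈ indexJ ν →
      valley ν ((pathCaterpillar ν).index v) = v := by
    intro v h1 h2
    obtain ⟨k, rfl⟩ := (pathCaterpillar ν).exists_valley v h1 h2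
    exact congrArg _ ((pathCaterpillar ν).index_valley k)
  obtain ⟨l, hl, hlv⟩ := exists_valley_route (ν := ν) ((pathCaterpillar ν).index i)
    ((pathCaterpillar ν).index j)
  obtain ⟨l', hl', hlI⟩ : ∃ l', IsRoute (fun e : {e // e ∈ graphGB ν} => e.1) i
      (valley ν ((pathCaterpillar ν).index j)) l' ∧ ∀ v ∈ l', v ∈ indexI ν := by
    by_cases h : i ∈ indexJ ν
    · rw [hval hi h] at hl
      exact ⟨l, hl, fun v hv => (Finset.mem_inter.1 (hlv v hv)).1⟩
    · refine ⟨i :: l, hl.cons ⟨⟨⟨i, _, (index_source hi h).1, .forward⟩, mem_graphGB.2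
        (Or.inl ⟨hi, h, rfl, rfl⟩)⟩, Or.inl ⟨rfl, rfl, by simp⟩⟩ fun hil =>
          h (Finset.mem_inter.1 (hlv i hil)).2, fun v hv => ?_⟩
      rcases List.mem_cons.1 hv with rfl | hv
      · exact hi
      · exact (Finset.mem_inter.1 (hlv v hv)).1
  by_cases h : j ∈ indexI ν
  · rw [hval h hj] at hl'
    exact ⟨l', hl'⟩
  · exact ⟨l' ++ [j], hl'.concat ⟨⟨⟨_, j, (index_sink hj h).1, .forward⟩, mem_graphGB.2
      (Or.inr (Or.inl ⟨hj, h, rfl, rfl⟩))⟩, Or.inl ⟨rfl, rfl, by simp⟩⟩ fun hjl => h (hlI j hjl)⟩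

theorem exists_route (i : {i // i ∈ indexI ν}) (j : {j // j ∈ indexJ ν}) :
    ∃ l, IsRoute (augmentation ν (graphGB ν)) ⊥ ⊤ l ∧
      [⊥, innerVertex ν i.1] <:+: l ∧ [innerVertex ν j.1, ⊤] <:+: l := by
  obtain ⟨l, hl⟩ := exists_inner_route i.2 j.2
  have hm : IsRoute (augmentation ν (graphGB ν)) (innerVertex ν i.1) (innerVertex ν j.1)
      (l.map (innerVertex ν)) :=
    hl.map innerVertex_injective fun e => ⟨.inl e, rfl, rfl, rfl⟩
  have h1 := hm.cons (u := ⊥) ⟨.inr (.inl i), Or.inl ⟨rfl, rfl, by simp [augmentation]⟩⟩ (by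
    simp only [List.mem_map, not_exists, not_and]
    exact fun v _ h => bot_ne_innerVertex v h.symm)
  have h2 := h1.concat (u := ⊤) ⟨.inr (.inr j), Or.inl ⟨rfl, rfl, by simp [augmentation]⟩⟩ (by
    simp only [List.mem_cons, List.mem_map, not_or, not_exists, not_and]
    exact ⟨by simp, fun v _ => innerVertex_ne_top v⟩)
  refine ⟨_, h2, ?_, ?_⟩
  · have hh := hm.1
    cases hc : l.map (innerVertex ν) with
    | nil => simp [hc] at hh
    | cons a L =>
      rw [hc] at hh
      obtain rfl : a = innerVertex ν i.1 := by simpa using hh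
      exact ⟨[], L ++ [⊤], by simp⟩
  · have hh := hm.2.1
    obtain ⟨L, hL⟩ := List.getLast?_eq_some_iff.1 hh
    exact ⟨⊥ :: L, [], by simp [hL]⟩

theorem eq_endsVertex {x : Ends (indexI ν) (indexJ ν) → ℝ}
    (hx : x ∈ endsPolytope (indexI ν) (indexJ ν)) {i : {i // i ∈ indexI ν}}
    {j : {j // j ∈ indexJ ν}} (hi : x (.inl i) = 1) (hj : x (.inr j) = 1) :
    x = Caterpillar.endsVertex i j := by
  have key : ∀ {τ : Type} [Fintype τ] [DecidableEq τ] (q : τ → ℝ) (k : τ), (∀ k, 0 ≤ q k) →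
      ∑ k, q k = 1 → q k = 1 → ∀ l, q l = (Pi.single k 1 : τ → ℝ) l := by
    intro τ _ _ q k h0 h1 hk l
    by_cases h : l = k
    · rw [h, hk, Pi.single_eq_same]
    · rw [Pi.single_eq_of_ne h]
      have := Finset.add_le_sum (s := Finset.univ) (f := q) (fun k _ => h0 k) (Finset.mem_univ l)
        (Finset.mem_univ k) h
      linarith [h0 l]
  ext (k | k)
  · exact key (fun k => x (.inl k)) i (fun k => hx.1 _) hx.2.1 hi k
  · exact key (fun k => x (.inr k)) j (fun k => hx.1 _) hx.2.2 hj k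

/-- A route through the source edge of i and the sink edge of j is a flow whose end values form the
given vertex, and end values determine flows. -/
theorem exists_route_eq (i : {i // i ∈ indexI ν}) (j : {j // j ∈ indexJ ν}) :
    ∃ l, IsRoute (augmentation ν (graphGB ν)) ⊥ ⊤ l ∧
      flowLift ν (Caterpillar.endsVertex i j) = routeVector (augmentation ν (graphGB ν)) l := by
  obtain ⟨l, hl, h1, h2⟩ := exists_route i j
  have hmem := routeVector_mem_flowPolytope augmentation_injective hl
  refine ⟨l, hl, ?_⟩
  rw [← eq_endsVertex (endValues_mem hmem) (i := i) (j := j) (if_pos h1) (if_pos h2),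
    flowLift_endValues hmem]

theorem flowLift_spine {x : Ends (indexI ν) (indexJ ν) → ℝ}
    (hx : x ∈ endsPolytope (indexI ν) (indexJ ν)) {e : {e // e ∈ graphGB ν}}
    {k : Fin (numValleys ν)} (hk : k.1 + 1 < numValleys ν) (h1 : e.1.lo = valley ν k)
    (h2 : e.1.hi = valley ν ⟨k.1 + 1, hk⟩) :
    flowLift ν x (.inl e) = (pathCaterpillar ν).prefixNet (k.1 + 1) x := by
  rw [flowLift_inl, Caterpillar.prefixNet_apply]
  exact treeWeight_spine (sum_netMap_of_mem hx) hk h1 h2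

/-- The values of a route on the bidirectional edges are its prefix sums, all in {-1, 0, 1}, and the
last prefix sum is 0. The conditions on routes in Q_i say that the value at i is at most 0, and is
-1 if any value is; that is minimality at i. The cell is the hull of its vertices, which are routes.
-/
theorem polytopeQ_eq (i : Fin (numValleys ν)) : polytopeQ ν i
    = flowLift ν '' coneFace (indexI ν) (indexJ ν)
      ((pathCaterpillar ν).graph ({i} : Finset (Fin (pathCaterpillar ν).w))) ∅ := by
  have hlast : ∀ {k : Fin (numValleys ν)} {x}, x ∈ endsPolytope (indexI ν) (indexJ ν) →
      ¬ k.1 + 1 < numValleys ν → (pathCaterpillar ν).prefixNet (k.1 + 1) x = 0 := by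
    intro k x hx hk
    have : k.1 + 1 = (pathCaterpillar ν).w := by
      change _ = numValleys ν
      have := k.2
      omega
    rw [this]
    exact (pathCaterpillar ν).prefixNet_w hx
  have hcone : ∀ {x}, x ∈ coneFace (indexI ν) (indexJ ν)
      ((pathCaterpillar ν).graph ({i} : Finset (Fin (pathCaterpillar ν).w))) ∅ ↔
      x ∈ endsPolytope (indexI ν) (indexJ ν) ∧ ∀ k : Fin (numValleys ν),
      (pathCaterpillar ν).prefixNet (i.1 + 1) x ≤ (pathCaterpillar ν).prefixNet (k.1 + 1) x :=
    (pathCaterpillar ν).mem_coneFace_singleton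
  unfold polytopeQ
  split_ifs with h
  · obtain ⟨e, h1, h2, h3⟩ := exists_allows_valley h
    have hnonpos : ∀ {x}, x ∈ coneFace (indexI ν) (indexJ ν)
        ((pathCaterpillar ν).graph ({i} : Finset (Fin (pathCaterpillar ν).w))) ∅ →
        (pathCaterpillar ν).prefixNet (i.1 + 1) x ≤ 0 := fun {x} hx => by
      -- The last prefix sum is the total 0, so the smallest one is nonpositive.
      have hlt : numValleys ν - 1 < numValleys ν := by omega
      rw [← hlast (hcone.1 hx).1 (k := ⟨_, hlt⟩) (by simp only; omega)]
      exact (hcone.1 hx).2 _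
    refine Subset.antisymm (convexHull_min ?_ ?_) ?_
    · rintro y ⟨l, hl, hup, hdown, rfl⟩
      have hmem := routeVector_mem_flowPolytope augmentation_injective hl
      have hx := flowLift_endValues hmem
      have hxP := endValues_mem hmem
      refine ⟨_, hcone.2 ⟨hxP, fun k => ?_⟩, hx⟩
      have hi := flowLift_spine hxP h h1 h2
      rw [← hi, hx]
      have hi0 : routeVector (augmentation ν (graphGB ν)) l (.inl e) ≤ 0 :=
        routeVector_nonpos (by change ¬ [innerVertex ν e.1.lo, innerVertex ν e.1.hi] <:+: l; rwa [h1, h2])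
      by_cases hk : k.1 + 1 < numValleys ν
      · obtain ⟨e', h1', h2', -⟩ := exists_allows_valley hk
        rw [← flowLift_spine hxP hk h1' h2', hx]
        -- A route that descends along this edge has the least possible value there; otherwise it
        -- descends nowhere and all its values are nonnegative.
        by_cases hd : [innerVertex ν (valley ν ⟨i.1 + 1, h⟩), innerVertex ν (valley ν i)] <:+: l
        · rw [routeVector_eq_neg_one hl.2.2.1 (e := Sum.inl e) (by
            change [innerVertex ν e.1.hi, innerVertex ν e.1.lo] <:+: l; rwa [h1, h2])]
          exact neg_one_le_routeVector _ _
        · refine hi0.trans (routeVector_nonneg fun hinf => hd (hdown ⟨_, _, ?_, hinf⟩))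
          exact SignedEdge.lt _
      · rwa [hlast hxP hk]
    · exact ((pathCaterpillar ν).convex_coneFace_singleton i).linear_image _
    · refine (image_mono ((pathCaterpillar ν).coneFace_singleton_subset_convexHull i)).trans ?_
      rw [LinearMap.image_convexHull]
      refine convexHull_mono ?_
      rintro _ ⟨x, ⟨hx, i₀, j₀, rfl⟩, rfl⟩
      obtain ⟨l, hl, hy⟩ := exists_route_eq i₀ j₀
      have hxP := (hcone.1 hx).1
      have hi := flowLift_spine hxP h h1 h2
      refine ⟨l, hl, fun hup => ?_, ?_, hy⟩
      · have hone : flowLift ν (Caterpillar.endsVertex i₀ j₀) (.inl e) = 1 := by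
          rw [hy]
          exact if_pos (by change [innerVertex ν e.1.lo, innerVertex ν e.1.hi] <:+: l; rwa [h1, h2])
        have := hnonpos hx
        rw [← hi, hone] at this
        norm_num at this
      · rintro ⟨u, v, hvu, hinf⟩
        obtain ⟨e', ⟨hlo, hhi, -⟩ | ⟨hhi, hlo, hkind⟩⟩ := hl.2.2.2.rel_of_infix hinf
        · have := (augmentation ν (graphGB ν) e').lt
          rw [hlo, hhi] at this
          exact absurd hvu this.asymm
        · rcases e' with e' | i' | j'
          · rcases mem_graphGB.1 e'.2 with ⟨-, -, -, hf⟩ | ⟨-, -, -, hf⟩ | ⟨k, hk, h1', h2', -⟩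
            · exact absurd hf hkind
            · exact absurd hf hkind
            -- Any descent has value -1, so by minimality the value at i is -1 as well.
            · have hneg : flowLift ν (Caterpillar.endsVertex i₀ j₀) (.inl e') = -1 := by
                rw [hy]
                exact routeVector_eq_neg_one hl.2.2.1 (by rwa [hlo, hhi])
              have hk' := (hcone.1 hx).2 k
              rw [← flowLift_spine hxP hk h1' h2', hneg, ← hi, hy] at hk'
              by_contra hd
              have := routeVector_nonneg (edge := augmentation ν (graphGB ν)) (l := l)
                (e := Sum.inl e) (by
                  change ¬ [innerVertex ν e.1.hi, innerVertex ν e.1.lo] <:+: l; rwa [h1, h2])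
              linarith
          · exact absurd rfl hkind
          · exact absurd rfl hkind
  -- At the last valley the prefix sum is 0, so minimality there means that all values on
  -- bidirectional edges are nonnegative.
  · refine Subset.antisymm ?_ ?_
    · rintro y ⟨hy, h0⟩
      have hxP := endValues_mem hy
      refine ⟨_, hcone.2 ⟨hxP, fun k => ?_⟩, flowLift_endValues hy⟩
      rw [hlast hxP h]
      by_cases hk : k.1 + 1 < numValleys ν
      · obtain ⟨e', h1', h2', -⟩ := exists_allows_valley hk
        rw [← flowLift_spine hxP hk h1' h2', flowLift_endValues hy]
        exact h0 _
      · rw [hlast hxP hk]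
    · rintro _ ⟨x, hx, rfl⟩
      obtain ⟨hxP, hmin⟩ := hcone.1 hx
      have hy := flowLift_mem hxP
      refine ⟨hy, ?_⟩
      rintro (e | k)
      · rcases mem_graphGB.1 e.2 with ⟨-, -, -, hf⟩ | ⟨-, -, -, hf⟩ | ⟨k, hk, h1, h2, -⟩
        · exact hy.2.1 (.inl e) hf
        · exact hy.2.1 (.inl e) hf
        · rw [flowLift_spine hxP hk h1 h2, ← hlast hxP h]
          exact hmin k
      · exact hxP.1 k

end PathRoutes

/-! ### Subdivisions encoded by polynomials -/

section Subdivisions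

variable {ν : List Step}

theorem valleys_nonempty : (indexI ν ∩ indexJ ν).Nonempty :=
  ⟨_, valley_mem_valleys ν (pathCaterpillar ν).last⟩

/-- The map f is left general so that the result applies both to flows and to the product of
simplices. -/
theorem encodes_fan {κ : Type} [Fintype κ]
    {f : (Ends (indexI ν) (indexJ ν) → ℝ) →ₗ[ℝ] (κ → ℝ)}
    {g : (κ → ℝ) →ₗ[ℝ] (Ends (indexI ν) (indexJ ν) → ℝ)} (hgf : ∀ x, g (f x) = x)
    (hint : ∀ x : Ends (indexI ν) (indexJ ν) → ℝ, ∑ v, netMap (indexI ν) (indexJ ν) x v = 0 →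
      (x ∈ latticePoints _ ↔ f x ∈ latticePoints κ))
    {𝒜 : Finset (Finset (Gen (Vertex ν)))}
    (h : IsFan (openNets (indexI ν) (indexJ ν)) (closedNets (indexI ν) (indexJ ν))
      (Fintype.card (Vertex ν) - 1) 𝒜)
    {c : Finset (SignedEdge (Vertex ν)) → Set (κ → ℝ)}
    (hc : ∀ A, c (toGraph A) = f '' coneFace (indexI ν) (indexJ ν) A ∅) :
    Encodes ν (f '' endsPolytope (indexI ν) (indexJ ν)) c
      (fanPoly (Fintype.card (Vertex ν) - 1) 𝒜) (fanFaces f 𝒜) := by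
  have hinj : Function.Injective f := Function.LeftInverse.injective hgf
  have hV := mem_indexI_or_mem_indexJ ν
  have hbij := h.bijOn_innerFaces valleys_nonempty hV hgf
  refine ⟨𝒜.image toGraph, ?_, ?_, ?_, ?_⟩
  · rintro G hG e he
    obtain ⟨A, -, rfl⟩ := Finset.mem_image.1 hG
    exact kind_ne_of_mem_toGraph he
  · have hc' : ∀ A ∈ 𝒜, c (toGraph A) ∈ _ := fun A hA => (hc A).symm ▸ hbij.mapsTo hA
    refine ⟨?_, ?_, fun F hF => ?_⟩
    · rw [Finset.coe_image]
      rintro _ ⟨A, hA, rfl⟩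
      exact hc' A hA
    · rw [Finset.coe_image]
      rintro _ ⟨A, hA, rfl⟩ _ ⟨B, hB, rfl⟩ hAB
      rw [hc, hc] at hAB
      rw [hbij.injOn hA hB hAB]
    · obtain ⟨A, hA, rfl⟩ := hbij.surjOn hF
      exact ⟨toGraph A, Finset.mem_image_of_mem _ hA, hc A⟩
  · rintro G hG
    obtain ⟨A, hA, rfl⟩ := Finset.mem_image.1 hG
    rw [hc]
    exact integrallyEquivalent_coneFace h hA hinj hint
  · rw [graphMonomial_sum, Finset.sum_image toGraph_injective.injOn]
    refine Finset.sum_congr rfl fun A hA => ?_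
    rw [hc, h.codim_coneFace hinj valleys_nonempty hV hA]

variable (ν) in
/-- The subdivision attached to a polynomial: the faces of the cells of the graphs of its
monomials. -/
def polySubdivision (R : BetaPoly (Vertex ν)) : Set (Set (AugEdge ν (graphGB ν) → ℝ)) :=
  {F | F.Nonempty ∧ ∃ A, graphExponent A ∈ R.support ∧ IsExposed ℝ (cell ν (toGraph A)) F}

/-- The support of the polynomial gives back the fan, so the definition through supports yields the
faces of the cells of the fan. -/
theorem polySubdivision_fanPoly {W W' : Set (Vertex ν → ℝ)} {N N' : ℕ}
    {𝒜 : Finset (Finset (Gen (Vertex ν)))} (h : IsFan W W' N 𝒜) :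
    polySubdivision ν (fanPoly N' 𝒜) = fanFaces (flowLift ν) 𝒜 := by
  rw [h.fanFaces_eq (endValues_flowLift ν)]
  simp only [polySubdivision, graphExponent_mem_support_fanPoly, cell_toGraph]

theorem simplexSubdivision_eq :
    simplexSubdivision ν = fanFaces (flowLift ν) (pathCaterpillar ν).fan := by
  rw [(pathCaterpillar ν).fanFaces_fan (endValues_flowLift ν), simplexSubdivision]
  simp only [polytopeQ_eq]
  rfl

theorem polySubdivision_polyP : polySubdivision ν (polyP ν) = simplexSubdivision ν := by
  rw [polyP_eq, polySubdivision_fanPoly (pathCaterpillar ν).isFan_fan, simplexSubdivision_eq]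

theorem iInter_polytopeQ {S : Finset (Fin (numValleys ν))} (hS : S.Nonempty) :
    ⋂ i ∈ S, polytopeQ ν i
      = flowLift ν '' coneFace (indexI ν) (indexJ ν) ((pathCaterpillar ν).graph S) ∅ := by
  rw [← (pathCaterpillar ν).iInter_coneFace hS]
  obtain ⟨i, hi⟩ := hS
  refine Subset.antisymm (fun y hy => ?_) (subset_iInter₂ fun k hk => ?_)
  · have hy' : ∀ k ∈ S, y ∈ flowLift ν '' coneFace (indexI ν) (indexJ ν)
        ((pathCaterpillar ν).graph ({k} : Finset (Fin (pathCaterpillar ν).w))) ∅ :=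
      fun k hk => polytopeQ_eq k ▸ mem_iInter₂.1 hy k hk
    obtain ⟨x, hx, rfl⟩ := hy' i hi
    exact ⟨x, mem_iInter₂.2 fun k hk => ((flowLift_injective ν).mem_set_image).1 (hy' k hk), rfl⟩
  · rw [polytopeQ_eq]
    exact image_mono fun x hx => mem_iInter₂.1 hx k hk

theorem Reduces.exists_fan_polyP {R : BetaPoly (Vertex ν)} (h : Reduces (polyP ν) R) :
    ∃ 𝒜, IsFan (openNets (indexI ν) (indexJ ν)) (closedNets (indexI ν) (indexJ ν))
      (Fintype.card (Vertex ν) - 1) 𝒜 ∧ R = fanPoly (Fintype.card (Vertex ν) - 1) 𝒜 := by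
  rw [polyP_eq] at h
  obtain ⟨ℬ, h1, h2, -⟩ := h.exists_fan (pathCaterpillar ν).isFan_fan
  exact ⟨ℬ, h1, h2⟩

end Subdivisions

/-! ### The product of simplices -/

section Simplices

variable {ν : List Step} {a b : ℕ}

/-- The numbering of the source edges and of the sink edges. -/
noncomputable def endsEquiv (ha : ν.count Step.E = a) (hb : ν.count Step.N = b) :
    Ends (indexI ν) (indexJ ν) ≃ Fin (a + 1) ⊕ Fin (b + 1) :=
  Equiv.sumCongr ((indexI ν).equivFinOfCardEq (by rw [card_indexI, ha]))
    ((indexJ ν).equivFinOfCardEq (by rw [card_indexJ, hb]))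

theorem image_endsEquiv (ha : ν.count Step.E = a) (hb : ν.count Step.N = b) :
    LinearMap.funLeft ℝ ℝ (endsEquiv ha hb).symm '' endsPolytope (indexI ν) (indexJ ν)
      = simplexProduct a b := by
  set e₁ := (indexI ν).equivFinOfCardEq (show _ = a + 1 by rw [card_indexI, ha]) with h₁
  set e₂ := (indexJ ν).equivFinOfCardEq (show _ = b + 1 by rw [card_indexJ, hb]) with h₂
  ext z
  constructor
  · rintro ⟨x, ⟨h0, h1, h2⟩, rfl⟩
    refine ⟨⟨fun i => h0 _, ?_⟩, ⟨fun j => h0 _, ?_⟩⟩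
    · rw [← h1, ← e₁.symm.sum_comp]
      rfl
    · rw [← h2, ← e₂.symm.sum_comp]
      rfl
  · rintro ⟨⟨h0, h1⟩, ⟨h0', h2⟩⟩
    refine ⟨LinearMap.funLeft ℝ ℝ (endsEquiv ha hb) z, ⟨?_, ?_, ?_⟩, ?_⟩
    · rintro (k | k)
      · exact h0 _
      · exact h0' _
    · rw [← h1, ← e₁.sum_comp]
      rfl
    · rw [← h2, ← e₂.sum_comp]
      rfl
    · ext k
      simp [LinearMap.funLeft_apply]

/-- Both identities are affine and hold on the polytope, so they extend to its affine span. -/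
theorem mem_affineSpan_flowGB {y : AugEdge ν (graphGB ν) → ℝ} (hy : y ∈ affineSpan ℝ (flowGB ν)) :
    flowLift ν (endValues ν y) = y ∧ ∑ v, netMap (indexI ν) (indexJ ν) (endValues ν y) v = 0 := by
  let L : (AugEdge ν (graphGB ν) → ℝ) →ₗ[ℝ] (AugEdge ν (graphGB ν) → ℝ) :=
    flowLift ν ∘ₗ endValues ν
  let D : (AugEdge ν (graphGB ν) → ℝ) →ₗ[ℝ] ℝ :=
    (∑ v, LinearMap.proj v) ∘ₗ netMap (indexI ν) (indexJ ν) ∘ₗ endValues ν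
  have hD : ∀ y, D y = ∑ v, netMap (indexI ν) (indexJ ν) (endValues ν y) v := fun y => by
    simp [D]
  have h1 : EqOn L.toAffineMap (AffineMap.id ℝ _) (affineSpan ℝ (flowGB ν)) :=
    AffineMap.eqOn_affineSpan fun y hy => flowLift_endValues hy
  have h2 : EqOn D.toAffineMap (AffineMap.const ℝ _ (0 : ℝ)) (affineSpan ℝ (flowGB ν)) :=
    AffineMap.eqOn_affineSpan fun y hy =>
      (hD y).trans (sum_netMap_of_mem (endValues_mem hy))
  exact ⟨h1 hy, (hD y).symm.trans (h2 hy)⟩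

end Simplices

/-! ### The theorem -/

theorem theorem1p2 (a b : ℕ) (ν : List Step)
    (ha : ν.count Step.E = a) (hb : ν.count Step.N = b) :
    (IsSubdivision (flowGB ν) (simplexSubdivision ν) ∧
      Encodes ν (flowGB ν) (cell ν) (polyP ν) (simplexSubdivision ν) ∧
      ∀ S : Finset (Fin (numValleys ν)), S.Nonempty →
        (⋂ i ∈ S, polytopeQ ν i) = cell ν (graphInter ν S) ∧
        (⋂ i ∈ S, polytopeQ ν i) ∈ innerFaces (flowGB ν) (simplexSubdivision ν) ∧
        codim (flowGB ν) (⋂ i ∈ S, polytopeQ ν i) + 1 = S.card ∧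
        IntegrallyEquivalent (augFlow ν (graphInter ν S)) (⋂ i ∈ S, polytopeQ ν i)) ∧
    ∃ 𝒮 : BetaPoly (Vertex ν) → Set (Set (AugEdge ν (graphGB ν) → ℝ)),
      𝒮 (polyP ν) = simplexSubdivision ν ∧
      (∀ R, Reduces (polyP ν) R →
        Ideal.Quotient.mk (subdivisionIdeal (Vertex ν)) R
          = Ideal.Quotient.mk (subdivisionIdeal (Vertex ν)) (polyP ν) ∧
        IsSubdivision (flowGB ν) (𝒮 R) ∧
        Encodes ν (flowGB ν) (cell ν) R (𝒮 R) ∧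
        ∀ R', Reduces R R' → Refines (𝒮 R') (𝒮 R)) ∧
      ∃ φ : (AugEdge ν (graphGB ν) → ℝ) →ᵃ[ℝ] (Fin (a + 1) ⊕ Fin (b + 1) → ℝ),
        IsIntegralEquivalence φ (flowGB ν) (simplexProduct a b) ∧
        ∀ R, Reduces (polyP ν) R →
          IsSubdivision (simplexProduct a b) ((fun C => φ '' C) '' 𝒮 R) ∧
          Encodes ν (simplexProduct a b) (fun G => φ '' cell ν G) R
            ((fun C => φ '' C) '' 𝒮 R) ∧
          ∀ R', Reduces R R' →
            Refines ((fun C => φ '' C) '' 𝒮 R') ((fun C => φ '' C) '' 𝒮 R) := by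
  have hfan := (pathCaterpillar ν).isFan_fan
  have hV := mem_indexI_or_mem_indexJ ν
  have hgf := endValues_flowLift ν
  have hsub := hfan.isSubdivision hgf
  have henc := encodes_fan hgf (fun x => mem_latticePoints_flowLift) hfan (c := cell ν) cell_toGraph
  rw [← flowGB_eq] at hsub henc
  -- The subdivision depends on the polynomial alone, not on the sequence of reductions that led to
  -- it.
  refine ⟨⟨by rwa [simplexSubdivision_eq], by rwa [simplexSubdivision_eq, polyP_eq],
    fun S hS => ?_⟩, polySubdivision ν, polySubdivision_polyP, fun R hR => ?_, ?_⟩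
  · have hmem : (pathCaterpillar ν).graph S ∈ (pathCaterpillar ν).fan :=
      (pathCaterpillar ν).mem_fan.2 ⟨S, hS, rfl⟩
    rw [graphInter_eq hS, cell_toGraph, iInter_polytopeQ hS, simplexSubdivision_eq, flowGB_eq]
    refine ⟨rfl, (hfan.bijOn_innerFaces valleys_nonempty hV hgf).mapsTo hmem, ?_,
      integrallyEquivalent_coneFace hfan hmem (flowLift_injective ν)
        fun x => mem_latticePoints_flowLift⟩
    rw [hfan.codim_coneFace (flowLift_injective ν) valleys_nonempty hV hmem]
    have h1 : ((pathCaterpillar ν).graph S).card + S.card = _ := (pathCaterpillar ν).card_graph hS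
    have h2 := hS.card_pos
    omega
  · obtain ⟨𝒜, h𝒜, rfl⟩ := hR.exists_fan_polyP
    rw [polySubdivision_fanPoly h𝒜]
    refine ⟨hR.mk_eq, ?_, ?_, fun R' hR' => ?_⟩
    · rw [flowGB_eq]
      exact h𝒜.isSubdivision hgf
    · rw [flowGB_eq]
      exact encodes_fan hgf (fun x => mem_latticePoints_flowLift) h𝒜 cell_toGraph
    · obtain ⟨ℬ, hℬ, rfl, hcone⟩ := hR'.exists_fan h𝒜
      rw [polySubdivision_fanPoly hℬ]
      exact IsFan.fanFaces_refines hcone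
  -- The integral equivalence forgets the inner edges and numbers the source and sink edges; it is
  -- the same for all R.
  set f := LinearMap.funLeft ℝ ℝ (endsEquiv ha hb).symm with hf
  have hgf' : ∀ x, LinearMap.funLeft ℝ ℝ (endsEquiv ha hb) (f x) = x := fun x => by
    ext k
    simp [f, LinearMap.funLeft_apply]
  have hint : ∀ x : Ends (indexI ν) (indexJ ν) → ℝ,
      x ∈ latticePoints _ ↔ f x ∈ latticePoints _ := fun x =>
    ⟨fun h k => h _, fun h k => by simpa [f, LinearMap.funLeft_apply] using h (endsEquiv ha hb k)⟩
  have himg : ∀ Z : Set (Ends (indexI ν) (indexJ ν) → ℝ),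
      (f ∘ₗ endValues ν).toAffineMap '' (flowLift ν '' Z) = f '' Z := fun Z => by
    rw [image_image]
    rfl
  have hfaces : ∀ 𝒜 : Finset (Finset (Gen (Vertex ν))),
      (fun C => (f ∘ₗ endValues ν).toAffineMap '' C) '' fanFaces (flowLift ν) 𝒜
        = fanFaces f 𝒜 := by
    intro 𝒜
    ext F
    constructor
    · rintro ⟨_, ⟨hne, A, hA, T, rfl⟩, rfl⟩
      exact ⟨hne.image _, A, hA, T, himg _⟩
    · rintro ⟨hne, A, hA, T, rfl⟩
      exact ⟨_, ⟨(image_nonempty.1 hne).image _, A, hA, T, rfl⟩, himg _⟩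
  have himgP : (f ∘ₗ endValues ν).toAffineMap '' flowGB ν = simplexProduct a b := by
    rw [flowGB_eq, himg, image_endsEquiv]
  refine ⟨(f ∘ₗ endValues ν).toAffineMap, ?_, fun R hR => ?_⟩
  · rw [← himgP]
    refine isIntegralEquivalence_image (fun y hy z hz h => ?_) fun y hy => ?_
    · have h' : endValues ν y = endValues ν z := Function.LeftInverse.injective hgf' h
      rw [← (mem_affineSpan_flowGB hy).1, h', (mem_affineSpan_flowGB hz).1]
    · obtain ⟨h1, h2⟩ := mem_affineSpan_flowGB hy
      rw [← h1, ← mem_latticePoints_flowLift h2]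
      exact hint _
  · obtain ⟨𝒜, h𝒜, rfl⟩ := hR.exists_fan_polyP
    rw [polySubdivision_fanPoly h𝒜, hfaces, ← image_endsEquiv ha hb]
    refine ⟨h𝒜.isSubdivision hgf', encodes_fan hgf' (fun x _ => hint x) h𝒜 fun A => ?_,
      fun R' hR' => ?_⟩
    · rw [cell_toGraph, himg]
    · obtain ⟨ℬ, hℬ, rfl, hcone⟩ := hR'.exists_fan h𝒜
      rw [polySubdivision_fanPoly hℬ, hfaces]
      exact IsFan.fanFaces_refines hcone
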